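/- Let $w(v)=e^{-v^2}/\sqrt\pi$ and let $L^2_w=L^2(\mathbb R,w(v)\,dv)$ (complex valued), with $(f,g)_{L^2_w}=\int_{\mathbb R}f\bar g\,w\,dv$ and $\mathbb 1(v)\equiv1$. For $\xi\in\mathbb R$ let $$(L_\xi h)(v)=-iv\xi\,h(v)-h(v)+\int_{\mathbb R}w(r)h(r)\,dr,\qquad \mathrm{dom}(L_\xi)=\{h\in L^2_w: L_\xi h\in L^2_w\},$$ and let $L$ be the operator $(Lh)(\xi,\cdot)=L_\xi h(\xi,\cdot)$ on $L^2(\mathbb R,L^2_w)$ with its maximal domain. For $|\xi|<\sqrt\pi$ let $\lambda^*(\xi)$ be the unique zero in $(-1,0]$ of $\omega(\lambda,\xi)=1-\int_{\mathbb R}\frac{w(v)\,dv}{iv\xi+1+\lambda}$; it is an isolated simple eigenvalue of $L_\xi$, with Riesz projection $P_{\lambda^*}(\xi)=-\frac1{2\pi i}\oint(L_\xi-z)^{-1}dz$ (over a small circle around $\lambda^*(\xi)$) and eigenvector $e_1(v,\xi)=\frac1{iv\xi+1+\lambda^*(\xi)}$. For $\xi_0\in(0,\sqrt\pi)$ put $P_{\xi_0}(\xi)=P_{\lambda^*}(\xi)$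 if $\xi\in[-\xi_0,\xi_0]$ and $P_{\xi_0}(\xi)=0$ otherwise. Let $\mathfrak F$ be the unitary Fourier transform in $x$ on $L^2(\mathbb R,L^2_w)$ under which $\partial_x$ becomes multiplication by $i\xi$. **Theorem 9.4.** For every $\hat f_0\in L^2(\mathbb R,L^2_w)$ the Cauchy problem $\partial_t\hat f=L\hat f$, $\hat f(0)=\hat f_0$, has a unique (mild) solution $\hat f\in C([0,\infty);L^2(\mathbb R,L^2_w))$. For every $\xi_0\in(0,\sqrt\pi)$ the function $\hat g^{\xi_0}(t,\xi,\cdot)=P_{\xi_0}(\xi)\hat f(t,\xi,\cdot)$ lies in $L^2(\mathbb R,L^2_w)$ for all $t\ge0$ and is a grossly determined solution: it solves the same equation, it vanishes for $|\xi|>\xi_0$, and for $|\xi|\le\xi_0$ it is determined by its moment $\hat\mu(t,\xi)=(\hat g^{\xi_0}(t,\xi,\cdot),\mathbb 1)_{L^2_w}$ through $\hat g^{\xi_0}(t,\xi,v)=\hat\mu(t,\xi)e_1(v,\xi)$ and $\hat\mu(t,\xi)=e^{\lambda^*(\xi)t}\hat\mu(0,\xi)$. With $f=\mathfrak F^{-1}\hat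 f$, $g^{\xi_0}=\mathfrak F^{-1}\hat g^{\xi_0}$, $f_0=f(0)$ and $g^{\xi_0}_0=g^{\xi_0}(0)$, one has $\|f(t)-g^{\xi_0}(t)\|_{L^2(\mathbb R,L^2_w)}\to0$ as $t\to\infty$. More precisely, for every $\varepsilon>0$ there is $C=C(\varepsilon)>0$, and for each $\xi_0\in(0,\sqrt\pi)$ a $C_2=C_2(\varepsilon,\xi_0)>0$, such that for all $\hat f_0\in L^2(\mathbb R,L^2_w)$ and all $t\ge0$ $$\|f(t)-g^{\xi_0}(t)\|\le Ce^{(\lambda^*(\xi_0)+\varepsilon)t}\|f_0-g^{\xi_0}_0\|\le C_2e^{(\lambda^*(\xi_0)+\varepsilon)t}\|f_0\|,$$ all norms being those of $L^2(\mathbb R,L^2_w)$. -/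

import Mathlib

open MeasureTheory Set Filter Topology
open scoped FourierTransform

namespace BGK

noncomputable section

/-- The Maxwellian weight `w(v) = exp(-v²) / √π`. -/
def w (v : ℝ) : ℝ := Real.exp (-v ^ 2) / Real.sqrt Real.pi

/-- The measure `w(v) dv` on the velocity line. -/
def velMeasure : Measure ℝ := volume.withDensity fun v => ENNReal.ofReal (w v)

/-- The weighted space `L²_w` of functions of the velocity `v`; its inner product is
`(f, g) = ∫ f(v) conj(g(v)) w(v) dv`. -/
abbrev L2w : Type := Lp ℂ 2 velMeasure

/-- The space `L²(ℝ, L²_w)`.  The outer variable is the frequency `ξ` or the position `x`. -/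
abbrev L2L2w : Type := Lp L2w 2 (volume : Measure ℝ)

/-- The moment `(h, 𝟙)_{L²_w} = ∫ h(v) w(v) dv`. -/
def moment (h : L2w) : ℂ := ∫ v, h v ∂velMeasure

/-- `IsL_xi ξ h k` says that `h ∈ dom L_ξ` and `L_ξ h = k`, where
`(L_ξ h)(v) = -i v ξ h(v) - h(v) + ∫ h(r) w(r) dr` and
`dom L_ξ = {h ∈ L²_w : L_ξ h ∈ L²_w}`. -/
def IsL_xi (ξ : ℝ) (h k : L2w) : Prop :=
  ∀ᵐ v ∂velMeasure, k v = -(Complex.I * v * ξ) * h v - h v + moment h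

/-- `IsL h k` says that `h ∈ dom L` and `L h = k`, where `L` acts on `L²(ℝ, L²_w)` by `L_ξ` at
each frequency `ξ` and `dom L = {h ∈ L²(ℝ, L²_w) : L h ∈ L²(ℝ, L²_w)}`. -/
def IsL (h k : L2L2w) : Prop := ∀ᵐ ξ : ℝ, IsL_xi ξ (h ξ) (k ξ)

/-- `f : [0, ∞) → L²(ℝ, L²_w)` is the (mild) solution of the Cauchy problem `∂ₜ f = L f`,
`f(0) = f₀`: it is continuous, `∫₀ᵗ f(s) ds ∈ dom L` and `f(t) = f₀ + L ∫₀ᵗ f(s) ds` for `t ≥ 0`.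
Values at negative times are irrelevant. -/
structure IsSolution (f₀ : L2L2w) (f : ℝ → L2L2w) : Prop where
  continuousOn : ContinuousOn f (Ici 0)
  initial : f 0 = f₀
  equation : ∀ t, 0 ≤ t → IsL (∫ s in (0 : ℝ)..t, f s) (f t - f₀)

/-- The spectral determinant `ω(λ, ξ) = 1 - ∫ w(v) dv / (i v ξ + 1 + λ)`. -/
def omega (z : ℂ) (ξ : ℝ) : ℂ := 1 - ∫ v, (Complex.I * v * ξ + 1 + z)⁻¹ ∂velMeasure

/-- For `ξ ∈ (-√π, √π)`: the unique zero `λ*(ξ) ∈ (-1, 0]` of `ω(·, ξ)`. -/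
def lamStar (ξ : ℝ) : ℝ := Classical.epsilon fun l : ℝ => -1 < l ∧ l ≤ 0 ∧ omega l ξ = 0

/-- The resolvent `(L_ξ - z)⁻¹ g`, that is, the `u ∈ dom L_ξ` with `L_ξ u - z u = g`
(for `z` in the resolvent set). -/
def resolventL (ξ : ℝ) (z : ℂ) (g : L2w) : L2w :=
  Classical.epsilon fun u : L2w => IsL_xi ξ u (g + z • u)

/-- For `ξ ∈ (-√π, √π)`: the Riesz projection `P_{λ*}(ξ) = -(2πi)⁻¹ ∮ (L_ξ - z)⁻¹ dz` of `L_ξ`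
at its isolated eigenvalue `λ*(ξ)`.  The circle of centre `λ*(ξ)` and radius `(1 + λ*(ξ))/2` stays
away from the essential spectrum `{Re z = -1}`, and in `{Re z > -1}` the only spectral point of
`L_ξ` is `λ*(ξ)`. -/
def rieszProj (ξ : ℝ) (h : L2w) : L2w :=
  -((2 * Real.pi * Complex.I : ℂ)⁻¹ •
    ∮ z in C((lamStar ξ : ℂ), (1 + lamStar ξ) / 2), resolventL ξ z h)

open Classical in
/-- The truncated projector `P_{ξ₀}(ξ)`: equal to `P_{λ*}(ξ)` for `ξ ∈ [-ξ₀, ξ₀]` and to `0`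
otherwise. -/
def truncProj (ξ₀ ξ : ℝ) (h : L2w) : L2w :=
  if ξ ∈ Icc (-ξ₀) ξ₀ then rieszProj ξ h else 0

/-- `g(t) = P_{ξ₀}(·) f(t)` for all times `t ≥ 0`, in the frequency variable. -/
def IsTruncation (ξ₀ : ℝ) (f g : ℝ → L2L2w) : Prop :=
  ∀ t, 0 ≤ t → ∀ᵐ ξ : ℝ, g t ξ = truncProj ξ₀ ξ (f t ξ)

/-- `g` (in the frequency variable) is a grossly determined solution with frequencies in
`[-ξ₀, ξ₀]`: it solves `∂ₜ g = L g`, its moment `μ(t, ξ) = (g(t, ξ, ·), 𝟙)` evolves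
autonomously, `μ(t, ξ) = exp(λ*(ξ) t) μ(0, ξ)`, and `g` is recovered from its moment through
`g(t, ξ, v) = μ(t, ξ) e₁(v, ξ)` with `e₁(v, ξ) = 1 / (i v ξ + 1 + λ*(ξ))`. -/
structure IsGrosslyDetermined (ξ₀ : ℝ) (g : ℝ → L2L2w) : Prop where
  solution : IsSolution (g 0) g
  moment_evolution : ∀ t, 0 ≤ t → ∀ᵐ ξ : ℝ, ξ ∈ Icc (-ξ₀) ξ₀ →
    moment (g t ξ) = Real.exp (lamStar ξ * t) * moment (g 0 ξ)
  recovery : ∀ t, 0 ≤ t → ∀ᵐ ξ : ℝ, ξ ∈ Icc (-ξ₀) ξ₀ →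
    ∀ᵐ v ∂velMeasure, g t ξ v = moment (g t ξ) * (Complex.I * v * ξ + 1 + lamStar ξ)⁻¹
  vanishing : ∀ t, 0 ≤ t → ∀ᵐ ξ : ℝ, ξ ∉ Icc (-ξ₀) ξ₀ → g t ξ = 0

lemma memLp_dilate (h : L2L2w) :
    MemLp (fun η : ℝ => ((Real.sqrt (2 * Real.pi) : ℝ) : ℂ) • h (2 * Real.pi * η)) 2 volume := by
  have h2 : (2 * Real.pi : ℝ) ≠ 0 := by positivity
  have h3 : MemLp (h : ℝ → L2w) 2 (Measure.map (fun η : ℝ => 2 * Real.pi * η) volume) := by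
    rw [Real.map_volume_mul_left h2]
    exact (Lp.memLp h).smul_measure ENNReal.ofReal_ne_top
  have h4 : MemLp (fun η : ℝ => h (2 * Real.pi * η)) 2 volume :=
    h3.comp_of_map (by fun_prop)
  exact h4.const_smul ((Real.sqrt (2 * Real.pi) : ℝ) : ℂ)

/-- The inverse Fourier transform `𝔉⁻¹` on `L²(ℝ, L²_w)` in the variable `ξ`, in the convention for
which `∂ₓ` becomes multiplication by `i ξ` (and unitarily normalised):
`(𝔉⁻¹ h)(x) = (2π)^(-1/2) ∫ exp(i x ξ) h(ξ) dξ = ∫ exp(2π i x η) (2π)^(1/2) h(2π η) dη`. -/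
def invFourier (h : L2L2w) : L2L2w := 𝓕⁻ ((memLp_dilate h).toLp _ : L2L2w)

end

end BGK

/-! The problem decouples in `ξ`, so everything happens at a fixed frequency. Put `δ(ξ) = 1 + λ*(ξ)`
and let `k̂` be the Laplace transform of `exp(-ξ² t²/4)`, so that `ω(λ, ξ) = 1 - k̂(1 + λ)`. Since
`L_ξ` is multiplication by `-(i v ξ + 1)` plus the rank one map `h ↦ (h, 𝟙) 𝟙`, Duhamel's formula
expresses the solution through the single scalar `ρ(t) = e^t (u(t), 𝟙)`, which solves a Volterra
equation with kernel `exp(-ξ² t²/4)`. Solving it jointly in `(ξ, t)` gives existence and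
measurability (`exists_volterra`, `isL_xi_fiberSol`); dissipativity of `L_ξ` gives uniqueness.

In `Re z > 0` the only root of `k̂ = 1` is `δ(ξ)`, and it is simple. Cauchy's formula makes the
Riesz projection explicit: it has rank one, with range spanned by `e₁` and kernel equal to that of
the functional `h ↦ ∫ h w / (i v ξ + δ)`. The flow acts on both by the factor `exp(λ* t)`, so the
truncation solves the same equation and is determined by its moment.

The delicate point is that `C` depends on `ε` alone, although the norm bound for the projection
degenerates as `ξ₀` tends to `√π`. Two decay estimates are combined in `exists_remainder_decay`.

Without any projection, `exists_fiberSol_decay` gives the rate `δ - 1 + ε`: weighting by `exp(-(δ +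
ε) t)` brings the mass of the Volterra kernel below 1 by an amount depending on `ε` only. This
serves beyond `ξ₀`, where `δ = δ(ξ₀)` is admissible, and also where `δ(ξ)` is small.

Where `δ(ξ)` is bounded below and the spectral functional vanishes, the root has to be removed. The
vanishing yields a second, first kind, Volterra equation for `ρ` with symbol `(1 - k̂(z))/(z - δ)`.
Adding `c + δ` times it to the original one gives the symbol `(z + c)(1 - k̂(z))/(z - δ)`, whose
real part on a line `Re z = p < δ` is at least `1/2` for a suitable `c` (`symbol_pos`,
`exists_coercive_symbol`). Plancherel turns this into an `L²` bound for `exp(-p t) ρ`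
(`coercive_volterra`), hence into decay at rate `p - 1`. -/

open scoped BoundedContinuousFunction

namespace BGK

noncomputable section

/-! ### Plancherel's identity and coercive convolution operators -/

/-- The Fourier transform on `L²` is given by the Fourier integral on `L¹ ∩ L²`. -/
theorem fourier_toLp_ae_eq {f : ℝ → ℂ} (h1 : Integrable f) (h2 : MemLp f 2) :
    ((𝓕 (h2.toLp f) : Lp ℂ 2 (volume : Measure ℝ)) : ℝ → ℂ) =ᵐ[volume] 𝓕 f := by
  have hc : Continuous (𝓕 f) :=
    VectorFourier.fourierIntegral_continuous Real.continuous_fourierChar (by fun_prop) h1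
  -- Test against a smooth compactly supported `g` and move the transform onto `g`: by duality of
  -- tempered distributions for the `L²` transform, by Fubini for the integral.
  refine ae_eq_of_integral_contDiff_smul_eq
    ((Lp.memLp _).locallyIntegrable (by norm_num)) hc.locallyIntegrable ?_
  intro g g_smooth g_cpt
  have hg₁ : HasCompactSupport (Complex.ofRealCLM ∘ g) := g_cpt.comp_left rfl
  have hg₂ : ContDiff ℝ (↑(⊤ : ℕ∞)) (Complex.ofRealCLM ∘ g) := by fun_prop
  set G : SchwartzMap ℝ ℂ := hg₁.toSchwartzMap hg₂ with hG
  have hGg : ∀ x, G x = (g x : ℂ) := fun x => rfl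
  have key : (Lp.toTemperedDistribution (𝓕 (h2.toLp f))) G
      = (Lp.toTemperedDistribution (h2.toLp f)) (𝓕 G) := by
    rw [← Lp.fourier_toTemperedDistribution_eq, TemperedDistribution.fourier_apply]
  rw [Lp.toTemperedDistribution_apply, Lp.toTemperedDistribution_apply] at key
  have e1 : ∫ x, g x • (𝓕 (h2.toLp f) : Lp ℂ 2 (volume : Measure ℝ)) x
      = ∫ x, (𝓕 G) x • (h2.toLp f) x := by
    rw [← key]
    simp [hGg]
  rw [e1]
  have e2 : ∫ x, (𝓕 G) x • (h2.toLp f) x = ∫ x, (𝓕 (G : ℝ → ℂ)) x • f x := by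
    apply integral_congr_ae
    filter_upwards [h2.coeFn_toLp] with x hx
    rw [hx, SchwartzMap.fourier_coe]
  rw [e2]
  have e3 := VectorFourier.integral_fourierIntegral_smul_eq_flip (L := innerₗ ℝ) (μ := volume)
    (ν := volume) Real.continuous_fourierChar (by simp only [innerₗ_apply_apply]; fun_prop)
    G.integrable h1
  simp only [flip_innerₗ] at e3
  refine e3.trans ?_
  refine integral_congr_ae (Eventually.of_forall fun x => ?_)
  simp only [hGg, smul_eq_mul, Complex.real_smul]
  rfl

/-- Working in `L¹ ∩ L²` makes the convolution theorem and the `L²` isometry available at once. -/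
theorem integral_conj_mul_fourier {f g : ℝ → ℂ} (hf1 : Integrable f) (hf2 : MemLp f 2)
    (hg1 : Integrable g) (hg2 : MemLp g 2) :
    ∫ x, (starRingEnd ℂ) (𝓕 f x) * 𝓕 g x = ∫ x, (starRingEnd ℂ) (f x) * g x := by
  have h := Lp.inner_fourier_eq (hf2.toLp f) (hg2.toLp g)
  rw [L2.inner_def, L2.inner_def] at h
  refine Eq.trans ?_ (h.trans ?_)
  · refine integral_congr_ae ?_
    filter_upwards [fourier_toLp_ae_eq hf1 hf2, fourier_toLp_ae_eq hg1 hg2] with x h1 h2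
    rw [h1, h2, RCLike.inner_apply, mul_comm]
  · refine integral_congr_ae ?_
    filter_upwards [hf2.coeFn_toLp, hg2.coeFn_toLp] with x h1 h2
    rw [h1, h2, RCLike.inner_apply, mul_comm]

theorem memLp_two_fourier {f : ℝ → ℂ} (hf1 : Integrable f) (hf2 : MemLp f 2) :
    MemLp (𝓕 f) 2 :=
  (memLp_congr_ae (fourier_toLp_ae_eq hf1 hf2)).1 (Lp.memLp _)

theorem memLp_two_of_integrable_of_bound {f : ℝ → ℂ} {B : ℝ} (hf : Integrable f)
    (hB : ∀ x, ‖f x‖ ≤ B) : MemLp f 2 := by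
  rw [memLp_two_iff_integrable_sq_norm hf.1]
  refine (hf.norm.const_mul B).mono' (hf.1.norm.pow 2) (Eventually.of_forall fun x => ?_)
  rw [Real.norm_of_nonneg (by positivity), sq]
  exact mul_le_mul_of_nonneg_right (hB x) (norm_nonneg _)

/-- Coercivity of `φ ↦ φ + J ⋆ φ` from a lower bound on the real part of its symbol. -/
theorem coercive_convolution {φ J : ℝ → ℂ} {B κ : ℝ} (hφ : Integrable φ) (hφB : ∀ x, ‖φ x‖ ≤ B)
    (hJ : Integrable J) (hκ : ∀ x, κ ≤ (1 + 𝓕 J x).re) :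
    κ * ∫ x, ‖φ x‖ ^ 2 ≤
      (∫ x, (starRingEnd ℂ) (φ x) * (φ x + ∫ s, J s * φ (x - s))).re := by
  set ψ : ℝ → ℂ := convolution J φ (ContinuousLinearMap.mul ℂ ℂ) volume with hψ
  have hψ1 : Integrable ψ := hJ.integrable_convolution _ hφ
  have hψe : ∀ x, ψ x = ∫ s, J s * φ (x - s) := fun x => rfl
  have hψB : ∀ x, ‖ψ x‖ ≤ (∫ s, ‖J s‖) * B := by
    intro x
    rw [hψe, ← integral_mul_const]
    refine norm_integral_le_of_norm_le (hJ.norm.mul_const B) (Eventually.of_forall fun s => ?_)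
    rw [norm_mul]
    exact mul_le_mul_of_nonneg_left (hφB _) (norm_nonneg _)
  have hφ2 : MemLp φ 2 := memLp_two_of_integrable_of_bound hφ hφB
  have hψ2 : MemLp ψ 2 := memLp_two_of_integrable_of_bound hψ1 hψB
  have hsum2 : MemLp (φ + ψ) 2 := hφ2.add hψ2
  have hsum1 : Integrable (φ + ψ) := hφ.add hψ1
  -- The convolution theorem turns the quadratic form into `∫ (1 + 𝓕 J) |𝓕 φ|²`.
  have hF : ∀ x, 𝓕 (φ + ψ) x = (1 + 𝓕 J x) * 𝓕 φ x := by
    intro x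
    have h1 : 𝓕 (φ + ψ) x = 𝓕 φ x + 𝓕 ψ x := by
      simp only [Real.fourier_eq, Pi.add_apply, smul_add]
      exact integral_add ((Real.fourierIntegral_convergent_iff x).2 hφ)
        ((Real.fourierIntegral_convergent_iff x).2 hψ1)
    rw [h1, hψ, Real.fourier_mul_convolution_eq hJ hφ]
    ring
  have e := integral_conj_mul_fourier hφ hφ2 hsum1 hsum2
  have e' := integral_conj_mul_fourier hφ hφ2 hφ hφ2
  have i1 : Integrable fun x => (starRingEnd ℂ) (𝓕 φ x) * 𝓕 (φ + ψ) x := by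
    have := (memLp_two_fourier hφ hφ2).star.integrable_mul (memLp_two_fourier hsum1 hsum2)
    exact this
  have i2 : Integrable fun x => (starRingEnd ℂ) (𝓕 φ x) * 𝓕 φ x := by
    have := (memLp_two_fourier hφ hφ2).star.integrable_mul (memLp_two_fourier hφ hφ2)
    exact this
  have n : ∀ z : ℂ, (starRingEnd ℂ) z * z = ((‖z‖ ^ 2 : ℝ) : ℂ) := by
    intro z
    rw [mul_comm, Complex.mul_conj, Complex.normSq_eq_norm_sq]
  have i3 : Integrable fun x => ‖𝓕 φ x‖ ^ 2 := by
    simp only [n] at i2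
    exact i2.re
  have e2 : ∫ x, ‖𝓕 φ x‖ ^ 2 = ∫ x, ‖φ x‖ ^ 2 := by
    simp only [n] at e'
    exact_mod_cast e'
  have e3 : (∫ x, (starRingEnd ℂ) (φ x) * (φ x + ∫ s, J s * φ (x - s)))
      = ∫ x, (starRingEnd ℂ) (𝓕 φ x) * 𝓕 (φ + ψ) x := e.symm
  rw [e3, ← e2, ← integral_const_mul]
  have e4 := integral_re i1
  simp only [RCLike.re_eq_complex_re] at e4
  rw [← e4]
  refine integral_mono (i3.const_mul κ) i1.re fun x => ?_
  have : (starRingEnd ℂ) (𝓕 φ x) * 𝓕 (φ + ψ) x = (1 + 𝓕 J x) * ((‖𝓕 φ x‖ ^ 2 : ℝ) : ℂ) := by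
    rw [hF, ← n]; ring
  simp only [this, Complex.re_mul_ofReal]
  exact mul_le_mul_of_nonneg_right (hκ x) (by positivity)

/-- Coercivity of a causal convolution operator on a bounded time interval. -/
theorem coercive_volterra {j ρ : ℝ → ℂ} {κ T : ℝ} (hT : 0 ≤ T) (hρ : Continuous ρ)
    (hj : IntegrableOn j (Ioi 0))
    (hκ : ∀ x : ℝ, κ ≤ (1 + ∫ s in Ioi (0 : ℝ), j s * Complex.exp (-(Complex.I * x * s))).re) :
    κ * ∫ t in (0 : ℝ)..T, ‖ρ t‖ ^ 2 ≤
      (∫ t in (0 : ℝ)..T, (starRingEnd ℂ) (ρ t) *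
        (ρ t + ∫ s in (0 : ℝ)..t, j (t - s) * ρ s)).re := by
  -- Both functions are extended by zero. The pairing with `φ` only sees times in `(0, T]`, where
  -- causality of `J` reduces the whole-line convolution to the Volterra integral.
  set φ : ℝ → ℂ := (Ioc 0 T).indicator ρ with hφ
  set J : ℝ → ℂ := (Ioi 0).indicator j with hJ
  have hφi : Integrable φ :=
    ((hρ.integrableOn_Icc (a := 0) (b := T)).mono_set Ioc_subset_Icc_self).integrable_indicator
      measurableSet_Ioc
  obtain ⟨B, hB⟩ := (isCompact_Icc (a := (0 : ℝ)) (b := T)).exists_bound_of_continuousOn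
    hρ.continuousOn
  have hB0 : 0 ≤ B := (norm_nonneg _).trans (hB 0 ⟨le_rfl, hT⟩)
  have hφB : ∀ x, ‖φ x‖ ≤ B := by
    intro x
    by_cases hx : x ∈ Ioc 0 T
    · rw [hφ, indicator_of_mem hx]; exact hB x (Ioc_subset_Icc_self hx)
    · rw [hφ, indicator_of_notMem hx, norm_zero]; exact hB0
  have hJi : Integrable J := hj.integrable_indicator measurableSet_Ioi
  have key := coercive_convolution (κ := κ) hφi hφB hJi (by
    intro x
    have : 𝓕 J x = ∫ s in Ioi (0 : ℝ),
        j s * Complex.exp (-(Complex.I * (2 * Real.pi * x : ℝ) * s)) := by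
      rw [Real.fourier_eq', ← integral_indicator measurableSet_Ioi]
      refine integral_congr_ae (Eventually.of_forall fun s => ?_)
      by_cases hs : s ∈ Ioi (0 : ℝ)
      · simp only [hJ, indicator_of_mem hs, smul_eq_mul]
        rw [mul_comm]
        congr 2
        simp
        ring
      · simp only [hJ, indicator_of_notMem hs, smul_zero]
    rw [this]
    exact hκ _)
  have e1 : ∫ x, ‖φ x‖ ^ 2 = ∫ t in (0 : ℝ)..T, ‖ρ t‖ ^ 2 := by
    rw [intervalIntegral.integral_of_le hT, ← integral_indicator measurableSet_Ioc]
    refine integral_congr_ae (Eventually.of_forall fun s => ?_)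
    by_cases hs : s ∈ Ioc (0 : ℝ) T
    · simp only [hφ, indicator_of_mem hs]
    · simp only [hφ, indicator_of_notMem hs]; simp
  have e2 : ∫ x, (starRingEnd ℂ) (φ x) * (φ x + ∫ s, J s * φ (x - s)) =
      ∫ t in (0 : ℝ)..T, (starRingEnd ℂ) (ρ t) *
        (ρ t + ∫ s in (0 : ℝ)..t, j (t - s) * ρ s) := by
    rw [intervalIntegral.integral_of_le hT, ← integral_indicator measurableSet_Ioc]
    refine integral_congr_ae (Eventually.of_forall fun t => ?_)
    by_cases ht : t ∈ Ioc (0 : ℝ) T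
    · simp only [indicator_of_mem ht]
      rw [hφ, indicator_of_mem ht]
      congr 2
      rw [← integral_sub_left_eq_self (fun s => J s * φ (t - s)) volume t,
        intervalIntegral.integral_of_le ht.1.le, integral_Ioc_eq_integral_Ioo,
        ← integral_indicator measurableSet_Ioo]
      refine integral_congr_ae (Eventually.of_forall fun s => ?_)
      simp only [sub_sub_cancel]
      by_cases hs : s ∈ Ioo (0 : ℝ) t
      · rw [indicator_of_mem hs, hJ, hφ, indicator_of_mem (by simpa using hs.2),
          indicator_of_mem (show s ∈ Ioc 0 T from ⟨hs.1, hs.2.le.trans ht.2⟩)]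
      · rw [indicator_of_notMem hs]
        by_cases h0 : 0 < s
        · have : t - s ∉ Ioi (0 : ℝ) := by
            intro h; exact hs ⟨h0, by simpa using h⟩
          rw [hJ, indicator_of_notMem this, zero_mul]
        · have : s ∉ Ioc (0 : ℝ) T := fun h => h0 h.1
          rw [hφ, indicator_of_notMem this, mul_zero]
    · simp only [indicator_of_notMem ht]
      rw [hφ, indicator_of_notMem ht]
      simp
  rwa [e1, e2] at key

/-! ### The velocity measure as a Gaussian law -/

theorem velMeasure_eq_gaussianReal :
    velMeasure = ProbabilityTheory.gaussianReal 0 (1 / 2) := by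
  rw [ProbabilityTheory.gaussianReal_of_var_ne_zero _ (by norm_num), velMeasure]
  congr 1
  ext v
  rw [ProbabilityTheory.gaussianPDF, ProbabilityTheory.gaussianPDFReal, w]
  congr 1
  have h2 : Real.sqrt 2 ≠ 0 := by positivity
  simp
  field_simp

instance : IsProbabilityMeasure velMeasure := by
  rw [velMeasure_eq_gaussianReal]; infer_instance

/-- The characteristic function of the Gaussian of variance `1/2`; at `x = ξ t` it is the memory
kernel of the density equation. -/
theorem integral_exp_velMeasure (x : ℝ) :
    ∫ v, Complex.exp (-(Complex.I * v * x)) ∂velMeasure = Complex.exp (-(x : ℂ) ^ 2 / 4) := by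
  have h := ProbabilityTheory.charFun_gaussianReal (μ := 0) (v := 1 / 2) (-x)
  rw [charFun_apply_real, ← velMeasure_eq_gaussianReal] at h
  convert h using 3
  · push_cast; ring_nf
  · push_cast; ring

/-! ### Dominated convergence and pointwise Bochner integrals in `L²` -/

section LpGeneral

variable {α E : Type*} [MeasurableSpace α] {μ : Measure α} [NormedAddCommGroup E]

/-- Dominated convergence in `L²`. -/
theorem tendsto_toLp_of_dominated {Z : Type*} {l : Filter Z} [l.IsCountablyGenerated]
    {G : Z → α → E} {g : α → E} (hG : ∀ z, MemLp (G z) 2 μ) (hg : MemLp g 2 μ) {b : α → ℝ}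
    (hb : MemLp b 2 μ) (hGb : ∀ᶠ z in l, ∀ᵐ a ∂μ, ‖G z a‖ ≤ b a) (hgb : ∀ᵐ a ∂μ, ‖g a‖ ≤ b a)
    (hlim : ∀ᵐ a ∂μ, Tendsto (fun z => G z a) l (𝓝 (g a))) :
    Tendsto (fun z => (hG z).toLp (G z)) l (𝓝 (hg.toLp g)) := by
  rw [Lp.tendsto_Lp_iff_tendsto_eLpNorm'']
  simp only [eLpNorm_eq_lintegral_rpow_enorm_toReal two_ne_zero ENNReal.ofNat_ne_top]
  have h0 : Tendsto (fun z => ∫⁻ a, ‖(G z - g) a‖ₑ ^ (2 : ENNReal).toReal ∂μ) l (𝓝 0) := by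
    have hz : (0 : ENNReal) = ∫⁻ a, (0 : ENNReal) ∂μ := by simp
    rw [hz]
    refine tendsto_lintegral_filter_of_dominated_convergence'
      (fun a => (ENNReal.ofReal (2 * b a)) ^ (2 : ENNReal).toReal)
      (Eventually.of_forall fun z =>
        ((hG z).1.sub hg.1).enorm.pow_const _) ?_ ?_ ?_
    · filter_upwards [hGb] with z hz
      filter_upwards [hz, hgb] with a h1 h2
      refine ENNReal.rpow_le_rpow ?_ (by simp)
      rw [← ofReal_norm]
      refine ENNReal.ofReal_le_ofReal ((norm_sub_le _ _).trans ?_)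
      linarith
    · have h2 := (hb.const_mul 2).2
      rw [eLpNorm_eq_lintegral_rpow_enorm_toReal two_ne_zero ENNReal.ofNat_ne_top] at h2
      have h3 := (ENNReal.rpow_lt_top_iff_of_pos (by norm_num)).1 h2
      refine ((lintegral_mono fun a => ENNReal.rpow_le_rpow ?_ (by simp)).trans_lt h3).ne
      rw [← ofReal_norm]
      exact ENNReal.ofReal_le_ofReal (le_abs_self _)
    · filter_upwards [hlim] with a ha
      have h1 : Tendsto (fun z => ‖(G z - g) a‖ₑ) l (𝓝 0) := by
        have : Tendsto (fun z => G z a - g a) l (𝓝 0) := by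
          simpa using ha.sub_const (g a)
        simpa using this.enorm
      have h2 := (ENNReal.continuous_rpow_const (y := (2 : ENNReal).toReal)).tendsto 0
      rw [ENNReal.zero_rpow_of_pos (by simp)] at h2
      exact h2.comp h1
  have h2 := (ENNReal.continuous_rpow_const (y := 1 / (2 : ENNReal).toReal)).tendsto 0
  rw [ENNReal.zero_rpow_of_pos (by simp)] at h2
  exact h2.comp h0

/-- The Bochner integral of a curve in `L²` is computed pointwise. -/
theorem intervalIntegral_Lp_ae_eq [InnerProductSpace ℂ E] [NormedSpace ℝ E] [CompleteSpace E]
    [SigmaFinite μ]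
    {F : ℝ → Lp E 2 μ} {G : ℝ → α → E} {t : ℝ} (ht : 0 ≤ t) (hF : ContinuousOn F (Icc 0 t))
    (hG : AEStronglyMeasurable (Function.uncurry G) ((volume.restrict (Ioc 0 t)).prod μ))
    (hFG : ∀ s ∈ Icc 0 t, F s =ᵐ[μ] G s) :
    (∫ s in (0 : ℝ)..t, F s : Lp E 2 μ) =ᵐ[μ] fun a => ∫ s in (0 : ℝ)..t, G s a := by
  have hFi : IntervalIntegrable F volume 0 t := by
    rw [← uIcc_of_le ht] at hF; exact hF.intervalIntegrable
  obtain ⟨B, hB⟩ := isCompact_Icc.exists_bound_of_continuousOn hF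
  -- integrability on finite pieces
  have hint : ∀ A : Set α, MeasurableSet A → μ A < ⊤ →
      Integrable (Function.uncurry G) ((volume.restrict (Ioc 0 t)).prod (μ.restrict A)) := by
    intro A hA hμA
    have hm : AEStronglyMeasurable (Function.uncurry G)
        ((volume.restrict (Ioc 0 t)).prod (μ.restrict A)) :=
      hG.mono_ac (Measure.AbsolutelyContinuous.prod Measure.AbsolutelyContinuous.rfl
        Measure.restrict_le_self.absolutelyContinuous)
    rw [integrable_prod_iff hm]
    have hfin : IsFiniteMeasure (μ.restrict A) := ⟨by simpa using hμA⟩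
    have hGs : ∀ s ∈ Icc 0 t, MemLp (G s) 2 μ := fun s hs =>
      (memLp_congr_ae (hFG s hs)).1 (Lp.memLp _)
    constructor
    · refine (ae_restrict_iff' measurableSet_Ioc).2 (Eventually.of_forall fun s hs => ?_)
      exact ((hGs s (Ioc_subset_Icc_self hs)).restrict A).integrable (by norm_num)
    · have hm2 := hm.norm.integral_prod_right'
      refine Integrable.of_bound hm2 (B * (μ A).toReal ^ (1 / 2 : ℝ)) ?_
      refine (ae_restrict_iff' measurableSet_Ioc).2 (Eventually.of_forall fun s hs => ?_)
      have hs' := Ioc_subset_Icc_self hs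
      rw [Real.norm_of_nonneg (by positivity)]
      have h1 : ∫ a in A, ‖G s a‖ ∂μ = (eLpNorm (G s) 1 (μ.restrict A)).toReal := by
        rw [eLpNorm_one_eq_lintegral_enorm, integral_norm_eq_lintegral_enorm (hGs s hs').1.restrict]
      -- Hölder on the finite-measure set `A` bounds the `L¹(A)` norm by the `L²` norm, uniformly in
      -- `s`; this is what Fubini needs.
      have h2 : eLpNorm (G s) 1 (μ.restrict A)
          ≤ eLpNorm (G s) 2 (μ.restrict A) * (μ A) ^ (1 / 2 : ℝ) := by
        have := eLpNorm_le_eLpNorm_mul_rpow_measure_univ (p := 1) (q := 2) (by norm_num)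
          (hGs s hs').1.restrict (μ := μ.restrict A)
        refine this.trans (le_of_eq ?_)
        rw [Measure.restrict_apply_univ]
        congr 2
        norm_num
      have h3 : eLpNorm (G s) 2 (μ.restrict A) ≤ ENNReal.ofReal ‖F s‖ := by
        rw [Lp.norm_def, ENNReal.ofReal_toReal (Lp.eLpNorm_ne_top _), eLpNorm_congr_ae (hFG s hs')]
        exact eLpNorm_mono_measure _ Measure.restrict_le_self
      change ∫ a in A, ‖G s a‖ ∂μ ≤ _
      rw [h1]
      refine ENNReal.toReal_le_of_le_ofReal ?_ ?_
      · have := (norm_nonneg _).trans (hB s hs'); positivity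
      refine h2.trans
        ((mul_le_mul_left (h3.trans (ENNReal.ofReal_le_ofReal (hB s hs'))) _).trans ?_)
      rw [ENNReal.ofReal_mul ((norm_nonneg _).trans (hB s hs')),
        ← ENNReal.ofReal_rpow_of_nonneg (by positivity) (by norm_num), ENNReal.ofReal_toReal hμA.ne]
  -- Compare integrals over sets of finite measure: pairing with an indicator commutes with the
  -- Bochner integral, and Fubini handles the pointwise integral.
  refine ae_eq_of_forall_setIntegral_eq_of_sigmaFinite ?_ ?_ ?_
  · intro A hA hμA
    have hfin : IsFiniteMeasure (μ.restrict A) := ⟨by simpa using hμA⟩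
    exact ((Lp.memLp _).restrict A).integrable (by norm_num)
  · intro A hA hμA
    simp only [intervalIntegral.integral_of_le ht]
    exact (hint A hA hμA).integral_prod_right
  · intro A hA hμA
    refine ext_inner_left ℂ fun c => ?_
    rw [← L2.inner_indicatorConstLp_eq_inner_setIntegral ℂ hA hμA.ne c]
    have e := (innerSL ℂ (indicatorConstLp 2 hA hμA.ne c : Lp E 2 μ)).intervalIntegral_comp_comm hFi
    simp only [innerSL_apply_apply] at e
    rw [← e]
    have e2 : ∫ a in A, (∫ s in (0 : ℝ)..t, G s a) ∂μ = ∫ s in (0 : ℝ)..t, ∫ a in A, G s a ∂μ := by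
      simp only [intervalIntegral.integral_of_le ht]
      exact (integral_integral_swap (hint A hA hμA)).symm
    rw [e2]
    have hI : IntervalIntegrable (fun s => ∫ a in A, G s a ∂μ) volume 0 t := by
      rw [intervalIntegrable_iff_integrableOn_Ioc_of_le ht]
      exact (hint A hA hμA).integral_prod_left
    have e3 := (innerSL ℂ c).intervalIntegral_comp_comm hI
    simp only [innerSL_apply_apply] at e3
    rw [← e3]
    refine intervalIntegral.integral_congr fun s hs => ?_
    rw [uIcc_of_le ht] at hs
    rw [L2.inner_indicatorConstLp_eq_inner_setIntegral ℂ hA hμA.ne c,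
      setIntegral_congr_ae hA ((hFG s hs).mono fun a h _ => h)]

end LpGeneral

/-! ### Multiplication operators, the moment and the free flow -/

theorem memLp_bounded_mul (φ : ℝ →ᵇ ℂ) (h : L2w) : MemLp (fun v => φ v * h v) 2 velMeasure :=
  (Lp.memLp h).of_le_mul (c := ‖φ‖)
    (φ.continuous.aestronglyMeasurable.mul (Lp.aestronglyMeasurable h))
    (Eventually.of_forall fun v => by
      rw [norm_mul]
      exact mul_le_mul_of_nonneg_right (φ.norm_coe_le_norm v) (norm_nonneg _))

/-- Multiplication by a bounded continuous function on `L²_w`. -/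
def mulOp (φ : ℝ →ᵇ ℂ) : L2w →L[ℂ] L2w :=
  LinearMap.mkContinuous
    { toFun := fun h => (memLp_bounded_mul φ h).toLp _
      map_add' := fun f g => by
        rw [← MemLp.toLp_add, MemLp.toLp_eq_toLp_iff]
        filter_upwards [Lp.coeFn_add f g] with v hv
        simp only [hv, Pi.add_apply, mul_add]
      map_smul' := fun c f => by
        rw [RingHom.id_apply, ← MemLp.toLp_const_smul, MemLp.toLp_eq_toLp_iff]
        filter_upwards [Lp.coeFn_smul c f] with v hv
        simp only [hv, Pi.smul_apply, smul_eq_mul]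
        ring } ‖φ‖
    (fun h => Lp.norm_le_mul_norm_of_ae_le_mul (by
      filter_upwards [(memLp_bounded_mul φ h).coeFn_toLp] with v hv
      simp only [LinearMap.coe_mk, AddHom.coe_mk]
      rw [hv, norm_mul]
      exact mul_le_mul_of_nonneg_right (φ.norm_coe_le_norm v) (norm_nonneg _)))

theorem coeFn_mulOp (φ : ℝ →ᵇ ℂ) (h : L2w) :
    mulOp φ h =ᵐ[velMeasure] fun v => φ v * h v := (memLp_bounded_mul φ h).coeFn_toLp

theorem norm_mulOp_apply_le {φ : ℝ →ᵇ ℂ} {C : ℝ} (hC : ∀ v, ‖φ v‖ ≤ C) (h : L2w) :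
    ‖mulOp φ h‖ ≤ C * ‖h‖ := by
  refine Lp.norm_le_mul_norm_of_ae_le_mul ?_
  filter_upwards [coeFn_mulOp φ h] with v hv
  rw [hv, norm_mul]
  exact mul_le_mul_of_nonneg_right (hC v) (norm_nonneg _)

theorem mulOp_mulOp (φ ψ : ℝ →ᵇ ℂ) (h : L2w) : mulOp φ (mulOp ψ h) = mulOp (φ * ψ) h := by
  refine Lp.ext ?_
  filter_upwards [coeFn_mulOp φ (mulOp ψ h), coeFn_mulOp ψ h, coeFn_mulOp (φ * ψ) h] with v h1 h2 h3
  rw [h1, h2, h3, BoundedContinuousFunction.mul_apply, mul_assoc]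

theorem mulOp_comm (φ ψ : ℝ →ᵇ ℂ) (h : L2w) : mulOp φ (mulOp ψ h) = mulOp ψ (mulOp φ h) := by
  rw [mulOp_mulOp, mulOp_mulOp, mul_comm]

/-- Only strong continuity can be expected, since phases are not norm continuous in their parameter.
For a fixed vector it is dominated convergence; the uniform bound `C` absorbs the motion of the
vector. -/
theorem continuous_mulOp_apply {Z : Type*} [TopologicalSpace Z] [FirstCountableTopology Z]
    {φ : Z → ℝ →ᵇ ℂ} {h : Z → L2w} {C : ℝ} (hC : ∀ z v, ‖φ z v‖ ≤ C)
    (hφ : ∀ v, Continuous fun z => φ z v) (hh : Continuous h) :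
    Continuous fun z => mulOp (φ z) (h z) := by
  have key : ∀ f : L2w, Continuous fun z => mulOp (φ z) f := by
    intro f
    rw [continuous_iff_continuousAt]
    intro z₀
    refine tendsto_toLp_of_dominated (b := fun v => C * ‖f v‖) (G := fun z v => φ z v * f v)
      (fun z => memLp_bounded_mul (φ z) f) (memLp_bounded_mul (φ z₀) f)
      ((Lp.memLp f).norm.const_mul C) (Eventually.of_forall fun z => Eventually.of_forall
        fun v => ?_) (Eventually.of_forall fun v => ?_) (Eventually.of_forall fun v => ?_)
    · rw [norm_mul]; exact mul_le_mul_of_nonneg_right (hC z v) (norm_nonneg _)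
    · rw [norm_mul]; exact mul_le_mul_of_nonneg_right (hC z₀ v) (norm_nonneg _)
    · exact ((hφ v).tendsto z₀).mul_const _
  rw [continuous_iff_continuousAt]
  intro z₀
  have e : (fun z => mulOp (φ z) (h z))
      = fun z => mulOp (φ z) (h z - h z₀) + mulOp (φ z) (h z₀) := by
    funext z; rw [← map_add, sub_add_cancel]
  rw [e]
  have h0 : Tendsto (fun z => mulOp (φ z) (h z - h z₀)) (𝓝 z₀) (𝓝 0) := by
    refine squeeze_zero_norm (fun z => norm_mulOp_apply_le (hC z) _) ?_
    have : Tendsto (fun z => h z - h z₀) (𝓝 z₀) (𝓝 0) := by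
      simpa using (hh.tendsto z₀).sub_const (h z₀)
    simpa using this.norm.const_mul C
  have h1 := h0.add ((key (h z₀)).tendsto z₀)
  unfold ContinuousAt
  simpa using h1

/-- The constant function `𝟙` in `L²_w`. -/
def oneL : L2w := Lp.const 2 velMeasure (1 : ℂ)

theorem coeFn_oneL : oneL =ᵐ[velMeasure] fun _ => (1 : ℂ) := Lp.coeFn_const _ _ _

/-- The moment as a continuous linear functional. -/
def momentL : L2w →L[ℂ] ℂ := innerSL ℂ oneL

theorem momentL_apply (h : L2w) : momentL h = moment h := by
  rw [momentL, innerSL_apply_apply, L2.inner_def, moment]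
  refine integral_congr_ae ?_
  filter_upwards [coeFn_oneL] with v hv
  rw [hv, RCLike.inner_apply]; simp

theorem norm_oneL : ‖oneL‖ = 1 := by
  have := Lp.norm_const (p := 2) (μ := velMeasure) (c := (1 : ℂ)) two_ne_zero
  simp only [norm_one, probReal_univ, Real.one_rpow, mul_one] at this
  exact this

theorem norm_momentL_apply_le (h : L2w) : ‖momentL h‖ ≤ ‖h‖ := by
  rw [momentL, innerSL_apply_apply]
  simpa [norm_oneL] using norm_inner_le_norm (𝕜 := ℂ) oneL h

theorem momentL_mulOp_oneL (φ : ℝ →ᵇ ℂ) : momentL (mulOp φ oneL) = ∫ v, φ v ∂velMeasure := by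
  rw [momentL_apply, moment]
  refine integral_congr_ae ?_
  filter_upwards [coeFn_mulOp φ oneL, coeFn_oneL] with v h1 h2
  rw [h1, h2, mul_one]

/-- Multiplication by `exp(-i v x)`. -/
def phase (x : ℝ) : ℝ →ᵇ ℂ :=
  BoundedContinuousFunction.ofNormedAddCommGroup (fun v : ℝ => Complex.exp (-(Complex.I * v * x)))
    (by fun_prop) 1 (fun v => by rw [Complex.norm_exp]; simp)

theorem phase_apply (x v : ℝ) : phase x v = Complex.exp (-(Complex.I * v * x)) := rfl

theorem norm_phase_apply (x v : ℝ) : ‖phase x v‖ = 1 := by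
  rw [phase_apply, Complex.norm_exp]; simp

theorem phase_mul (x y : ℝ) : phase x * phase y = phase (x + y) := by
  ext v
  rw [BoundedContinuousFunction.mul_apply, phase_apply, phase_apply, phase_apply,
    ← Complex.exp_add]
  congr 1; push_cast; ring

theorem phase_zero : phase 0 = 1 := by
  ext v; simp [phase_apply]

theorem mulOp_one (h : L2w) : mulOp 1 h = h := by
  refine Lp.ext ?_
  filter_upwards [coeFn_mulOp 1 h] with v hv
  rw [hv]; simp

theorem continuous_mulOp_phase {Z : Type*} [TopologicalSpace Z] [FirstCountableTopology Z]
    {x : Z → ℝ} {h : Z → L2w} (hx : Continuous x) (hh : Continuous h) :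
    Continuous fun z => mulOp (phase (x z)) (h z) :=
  continuous_mulOp_apply (C := 1) (fun z v => (norm_phase_apply _ _).le)
    (fun v => by simp only [phase_apply]; fun_prop) hh

theorem norm_mulOp_phase_le (x : ℝ) (h : L2w) : ‖mulOp (phase x) h‖ ≤ ‖h‖ := by
  simpa using norm_mulOp_apply_le (C := 1) (fun v => (norm_phase_apply x v).le) h

theorem momentL_mulOp_phase_oneL (x : ℝ) :
    momentL (mulOp (phase x) oneL) = Complex.exp (-(x : ℂ) ^ 2 / 4) := by
  rw [momentL_mulOp_oneL]; exact integral_exp_velMeasure x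

theorem inner_mulOp_phase (x : ℝ) (f h : L2w) :
    inner ℂ f (mulOp (phase x) h) = inner ℂ (mulOp (phase (-x)) f) h := by
  rw [L2.inner_def, L2.inner_def]
  refine integral_congr_ae ?_
  filter_upwards [coeFn_mulOp (phase x) h, coeFn_mulOp (phase (-x)) f] with v h1 h2
  rw [h1, h2, RCLike.inner_apply, RCLike.inner_apply, map_mul, phase_apply, phase_apply,
    ← Complex.exp_conj]
  simp
  ring

/-- The moment of `exp(-i v x) h`, as a functional of `h`. -/
def phaseMoment (x : ℝ) : L2w →L[ℂ] ℂ := innerSL ℂ (mulOp (phase (-x)) oneL)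

theorem phaseMoment_apply (x : ℝ) (h : L2w) : phaseMoment x h = momentL (mulOp (phase x) h) := by
  rw [phaseMoment, innerSL_apply_apply, momentL, innerSL_apply_apply, inner_mulOp_phase]

/-- Unlike for the flow itself, continuity here is in operator norm: the functional is the pairing
with a strongly continuous vector. This allows the density equation to be solved in the dual space.
-/
theorem continuous_phaseMoment : Continuous phaseMoment :=
  (innerSL ℂ).continuous.comp (continuous_mulOp_phase continuous_neg continuous_const)

theorem norm_phaseMoment_le (x : ℝ) : ‖phaseMoment x‖ ≤ 1 := by
  refine ContinuousLinearMap.opNorm_le_bound _ zero_le_one fun h => ?_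
  rw [phaseMoment_apply, one_mul]
  exact (norm_momentL_apply_le _).trans (norm_mulOp_phase_le _ _)

/-! ### The resolvent of free transport -/

theorem re_denom (ξ v : ℝ) (z : ℂ) : (Complex.I * v * ξ + z).re = z.re := by simp

theorem denom_ne_zero {ξ v : ℝ} {z : ℂ} (hz : 0 < z.re) : Complex.I * v * ξ + z ≠ 0 := by
  intro h
  have := congrArg Complex.re h
  rw [re_denom] at this
  simp at this
  exact hz.ne' this

theorem norm_inv_denom_le {ξ v : ℝ} {z : ℂ} (hz : 0 < z.re) :
    ‖(Complex.I * v * ξ + z)⁻¹‖ ≤ (z.re)⁻¹ := by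
  rw [norm_inv]
  refine inv_anti₀ hz ?_
  have := Complex.re_le_norm (Complex.I * v * ξ + z)
  rwa [re_denom] at this

open Classical in
/-- The function `1 / (i v ξ + z)` for `Re z > 0` (and `0` otherwise). -/
def invDenom (ξ : ℝ) (z : ℂ) : ℝ →ᵇ ℂ :=
  if hz : 0 < z.re then
    BoundedContinuousFunction.ofNormedAddCommGroup (fun v : ℝ => (Complex.I * v * ξ + z)⁻¹)
      (Continuous.inv₀ (by fun_prop) fun _ => denom_ne_zero hz) (z.re)⁻¹
      (fun _ => norm_inv_denom_le hz)
  else 0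

theorem invDenom_apply {ξ : ℝ} {z : ℂ} (hz : 0 < z.re) (v : ℝ) :
    invDenom ξ z v = (Complex.I * v * ξ + z)⁻¹ := by
  rw [invDenom, dif_pos hz]; rfl

/-- Multiplication by `1 / (i v ξ + z)`. -/
def resOp (ξ : ℝ) (z : ℂ) : L2w →L[ℂ] L2w := mulOp (invDenom ξ z)

theorem coeFn_resOp {ξ : ℝ} {z : ℂ} (hz : 0 < z.re) (h : L2w) :
    resOp ξ z h =ᵐ[velMeasure] fun v => (Complex.I * v * ξ + z)⁻¹ * h v := by
  filter_upwards [coeFn_mulOp (invDenom ξ z) h] with v hv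
  rw [resOp, hv, invDenom_apply hz]

theorem norm_resOp_le {ξ : ℝ} {z : ℂ} (hz : 0 < z.re) : ‖resOp ξ z‖ ≤ (z.re)⁻¹ := by
  refine ContinuousLinearMap.opNorm_le_bound _ (by positivity) fun h =>
    norm_mulOp_apply_le (fun v => ?_) h
  rw [invDenom_apply hz]
  exact norm_inv_denom_le hz

/-- The resolvent identity: it yields holomorphy in `z` and, later, the symbol of the deflated
kernel. -/
theorem resOp_sub {ξ : ℝ} {z z' : ℂ} (hz : 0 < z.re) (hz' : 0 < z'.re) :
    resOp ξ z - resOp ξ z' = (z' - z) • (resOp ξ z ∘L resOp ξ z') := by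
  ext1 h
  refine Lp.ext ?_
  simp only [sub_apply, smul_apply, ContinuousLinearMap.comp_apply]
  filter_upwards [Lp.coeFn_sub (resOp ξ z h) (resOp ξ z' h), coeFn_resOp (ξ := ξ) hz h,
    coeFn_resOp (ξ := ξ) hz' h, Lp.coeFn_smul (z' - z) (resOp ξ z (resOp ξ z' h)),
    coeFn_resOp (ξ := ξ) hz (resOp ξ z' h)] with v h1 h2 h3 h4 h5
  rw [h1, h4, Pi.sub_apply, Pi.smul_apply, h2, h3, h5, h3, smul_eq_mul]
  have := denom_ne_zero (ξ := ξ) (v := v) hz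
  have := denom_ne_zero (ξ := ξ) (v := v) hz'
  field_simp
  ring

theorem continuousAt_resOp {ξ : ℝ} {z : ℂ} (hz : 0 < z.re) : ContinuousAt (resOp ξ) z := by
  have hev : ∀ᶠ y in 𝓝 z, z.re / 2 < y.re :=
    Complex.continuous_re.continuousAt.eventually (lt_mem_nhds (by linarith))
  rw [ContinuousAt, tendsto_iff_norm_sub_tendsto_zero]
  refine squeeze_zero' (Eventually.of_forall fun _ => norm_nonneg _)
    (g := fun y => ‖z - y‖ * ((z.re / 2)⁻¹ * (z.re)⁻¹)) ?_ ?_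
  · filter_upwards [hev] with y hy
    have hy0 : 0 < y.re := by linarith
    rw [resOp_sub hy0 hz, norm_smul]
    refine mul_le_mul_of_nonneg_left ((ContinuousLinearMap.opNorm_comp_le _ _).trans ?_)
      (norm_nonneg _)
    refine mul_le_mul ((norm_resOp_le hy0).trans ?_) (norm_resOp_le hz) (norm_nonneg _)
      (by positivity)
    exact inv_anti₀ (by linarith) hy.le
  · have : Continuous fun y => ‖z - y‖ * ((z.re / 2)⁻¹ * (z.re)⁻¹) := by fun_prop
    simpa using this.tendsto z

theorem hasDerivAt_resOp {ξ : ℝ} {z : ℂ} (hz : 0 < z.re) :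
    HasDerivAt (resOp ξ) (-(resOp ξ z ∘L resOp ξ z)) z := by
  rw [hasDerivAt_iff_tendsto_slope]
  have hev : ∀ᶠ y in 𝓝[≠] z, 0 < y.re :=
    (Complex.continuous_re.continuousAt.eventually (lt_mem_nhds hz)).filter_mono nhdsWithin_le_nhds
  have h1 : Tendsto (fun y => -(resOp ξ y ∘L resOp ξ z)) (𝓝[≠] z)
      (𝓝 (-(resOp ξ z ∘L resOp ξ z))) := by
    have : Tendsto (resOp ξ) (𝓝[≠] z) (𝓝 (resOp ξ z)) :=
      (continuousAt_resOp hz).tendsto.mono_left nhdsWithin_le_nhds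
    exact (((ContinuousLinearMap.compL ℂ L2w L2w L2w).flip (resOp ξ z)).continuous.tendsto _
      |>.comp this).neg
  refine h1.congr' ?_
  filter_upwards [hev, self_mem_nhdsWithin] with y hy hyz
  rw [slope_def_module, resOp_sub hy hz, smul_smul, ← neg_sub y z, mul_neg,
    inv_mul_cancel₀ (sub_ne_zero.2 hyz), neg_one_smul]

/-- `∫ w(v) dv / (i v ξ + z)`. -/
def kHat (ξ : ℝ) (z : ℂ) : ℂ := ∫ v, (Complex.I * v * ξ + z)⁻¹ ∂velMeasure

theorem omega_eq (z : ℂ) (ξ : ℝ) : omega z ξ = 1 - kHat ξ (1 + z) := by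
  simp only [omega, kHat, add_assoc]

theorem momentL_resOp_oneL {ξ : ℝ} {z : ℂ} (hz : 0 < z.re) :
    momentL (resOp ξ z oneL) = kHat ξ z := by
  rw [resOp, momentL_mulOp_oneL, kHat]
  simp only [invDenom_apply hz]

/-- The rank one term enters only through the number `momentL u`. Applying `momentL` to the
right-hand side therefore reduces spectral questions for `L_ξ` to one scalar equation governed by
`kHat`. -/
theorem isL_xi_iff_resOp {ξ : ℝ} {z : ℂ} (hz : 0 < (1 + z).re) (u g : L2w) :
    IsL_xi ξ u (g + z • u) ↔ u = resOp ξ (1 + z) (momentL u • oneL - g) := by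
  rw [Lp.ext_iff, IsL_xi, momentL_apply]
  constructor
  · intro h
    filter_upwards [h, coeFn_resOp (ξ := ξ) hz (moment u • oneL - g),
      Lp.coeFn_sub (moment u • oneL) g, Lp.coeFn_smul (moment u) oneL, coeFn_oneL,
      Lp.coeFn_add g (z • u), Lp.coeFn_smul z u] with v h1 h2 h3 h4 h5 h6 h7
    rw [h2, h3, Pi.sub_apply, h4, Pi.smul_apply, h5, smul_eq_mul, mul_one]
    rw [h6, Pi.add_apply, h7, Pi.smul_apply, smul_eq_mul] at h1
    rw [eq_inv_mul_iff_mul_eq₀ (denom_ne_zero hz)]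
    linear_combination h1
  · intro h
    filter_upwards [h, coeFn_resOp (ξ := ξ) hz (moment u • oneL - g),
      Lp.coeFn_sub (moment u • oneL) g, Lp.coeFn_smul (moment u) oneL, coeFn_oneL,
      Lp.coeFn_add g (z • u), Lp.coeFn_smul z u] with v h1 h2 h3 h4 h5 h6 h7
    rw [h2, h3, Pi.sub_apply, h4, Pi.smul_apply, h5, smul_eq_mul, mul_one] at h1
    rw [h6, Pi.add_apply, h7, Pi.smul_apply, smul_eq_mul]
    rw [eq_inv_mul_iff_mul_eq₀ (denom_ne_zero hz)] at h1
    linear_combination h1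

/-! ### Dissipativity and uniqueness -/

/-- Transport is skew, and what remains is `-‖h‖² + |(h, 𝟙)|²`, nonpositive by Cauchy–Schwarz
because `𝟙` is a unit vector. -/
theorem re_inner_le_zero_of_isL_xi {ξ : ℝ} {h k : L2w} (hk : IsL_xi ξ h k) :
    (inner ℂ h k).re ≤ 0 := by
  have i1 := L2.integrable_inner (𝕜 := ℂ) h k
  have i2 := L2.integrable_inner (𝕜 := ℂ) h h
  have i3 := L2.integrable_inner (𝕜 := ℂ) h (moment h • oneL)
  have e : (inner ℂ h k).re = -(inner ℂ h h).re + (inner ℂ h (moment h • oneL)).re := by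
    rw [L2.inner_def, L2.inner_def, L2.inner_def]
    have r1 := integral_re i1
    have r2 := integral_re i2
    have r3 := integral_re i3
    simp only [RCLike.re_eq_complex_re] at r1 r2 r3
    have i2' : Integrable (fun v => -(inner ℂ (h v) (h v)).re) velMeasure := i2.re.neg
    have i3' : Integrable (fun v => (inner ℂ (h v) ((moment h • oneL : L2w) v)).re) velMeasure :=
      i3.re
    rw [← r1, ← r2, ← r3, ← integral_neg, ← integral_add i2' i3']
    refine integral_congr_ae ?_
    filter_upwards [hk, Lp.coeFn_smul (moment h) oneL, coeFn_oneL] with v h1 h2 h3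
    rw [h1, h2, Pi.smul_apply, h3]
    simp only [RCLike.inner_apply, smul_eq_mul, Complex.add_re, Complex.mul_re, Complex.sub_re,
      Complex.neg_re, Complex.I_re, Complex.I_im, Complex.ofReal_re, Complex.ofReal_im,
      Complex.neg_im, Complex.mul_im, Complex.sub_im, Complex.add_im, Complex.conj_re,
      Complex.conj_im, Complex.one_re, Complex.one_im]
    ring
  rw [e]
  have h1 : (inner ℂ h h).re = ‖h‖ ^ 2 := by
    have := inner_self_eq_norm_sq (𝕜 := ℂ) h
    simpa using this
  have h2 : (inner ℂ h (moment h • oneL)).re ≤ ‖h‖ ^ 2 := by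
    refine (Complex.re_le_norm _).trans ((norm_inner_le_norm _ _).trans ?_)
    rw [norm_smul, norm_oneL, mul_one, ← momentL_apply, sq]
    exact mul_le_mul_of_nonneg_left (norm_momentL_apply_le h) (norm_nonneg _)
  linarith

theorem re_inner_le_zero_of_isL {h k : L2L2w} (hk : IsL h k) : (inner ℂ h k).re ≤ 0 := by
  have i1 := L2.integrable_inner (𝕜 := ℂ) h k
  have r1 := integral_re i1
  simp only [RCLike.re_eq_complex_re] at r1
  rw [L2.inner_def, ← r1]
  refine integral_nonpos_of_ae ?_
  filter_upwards [hk] with ξ hξ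
  exact re_inner_le_zero_of_isL_xi hξ

/-- A continuous curve whose integral is dissipated by the curve itself vanishes. -/
theorem eq_zero_of_dissipative {H : Type*} [NormedAddCommGroup H] [InnerProductSpace ℂ H]
    [NormedSpace ℝ H] [CompleteSpace H] {f : ℝ → H} (hf : ContinuousOn f (Ici 0))
    (hd : ∀ t, 0 ≤ t → (inner ℂ (∫ s in (0 : ℝ)..t, f s) (f t)).re ≤ 0) :
    ∀ t, 0 ≤ t → f t = 0 := by
  -- A continuous extension to negative times, so that the primitive is differentiable on all of
  -- `ℝ`.
  set f' : ℝ → H := fun t => f (max t 0) with hf'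
  have hc : Continuous f' := by
    refine hf.comp_continuous (by fun_prop) fun t => mem_Ici.2 (le_max_right _ _)
  have hff : ∀ t, 0 ≤ t → f' t = f t := fun t ht => by simp only [hf', max_eq_left ht]
  set F : ℝ → H := fun t => ∫ s in (0 : ℝ)..t, f' s with hF
  have hFe : ∀ t, 0 ≤ t → F t = ∫ s in (0 : ℝ)..t, f s := by
    intro t ht
    refine intervalIntegral.integral_congr fun s hs => ?_
    rw [uIcc_of_le ht] at hs
    exact hff s hs.1
  have hFd : ∀ t, HasDerivAt F (f' t) t := fun t => hc.integral_hasStrictDerivAt 0 t |>.hasDerivAt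
  have hN : ∀ t, HasDerivAt (fun t => (inner ℂ (F t) (F t)).re)
      ((inner ℂ (F t) (f' t)).re + (inner ℂ (f' t) (F t)).re) t := by
    intro t
    have h1 := (hFd t).inner ℂ (hFd t)
    exact (Complex.reCLM.hasFDerivAt.comp_hasDerivAt t h1)
  -- The derivative of `‖F‖²` is `2 Re (F, f) ≤ 0`; as `F 0 = 0`, the primitive stays zero.
  have hanti : AntitoneOn (fun t => (inner ℂ (F t) (F t)).re) (Ici 0) := by
    refine antitoneOn_of_deriv_nonpos (convex_Ici 0)
      (fun t _ => (hN t).continuousAt.continuousWithinAt)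
      (fun t _ => (hN t).differentiableAt.differentiableWithinAt) ?_
    intro t ht
    rw [interior_Ici] at ht
    have ht0 : (0 : ℝ) ≤ t := le_of_lt ht
    have h1 := hd t ht0
    rw [← hFe t ht0, ← hff t ht0] at h1
    have h2 : (inner ℂ (f' t) (F t)).re = (inner ℂ (F t) (f' t)).re := by
      have := inner_re_symm (𝕜 := ℂ) (f' t) (F t)
      simpa using this
    rw [(hN t).deriv, h2]
    linarith
  have hF0 : F 0 = 0 := by simp [hF]
  have hFz : ∀ t, 0 ≤ t → F t = 0 := by
    intro t ht
    have h1 := hanti (mem_Ici.2 le_rfl) ht ht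
    simp only [hF0, inner_zero_left, Complex.zero_re] at h1
    have h2 := inner_self_eq_norm_sq (𝕜 := ℂ) (F t)
    simp only [RCLike.re_eq_complex_re] at h2
    rw [h2] at h1
    have : ‖F t‖ = 0 := by nlinarith [norm_nonneg (F t)]
    exact norm_eq_zero.1 this
  intro t ht
  rw [← hff t ht]
  -- The primitive is only known to vanish on `[0, ∞)`, hence a right derivative.
  have h1 : HasDerivWithinAt F (f' t) (Ici t) t := (hFd t).hasDerivWithinAt
  have h2 : HasDerivWithinAt F 0 (Ici t) t :=
    (hasDerivWithinAt_const t (Ici t) (0 : H)).congr (fun s hs => hFz s (ht.trans hs)) (hFz t ht)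
  exact (uniqueDiffWithinAt_Ici t).eq_deriv _ h1 h2

/-! ### The transform of the Gaussian kernel -/

theorem integrable_coe_L2w (h : L2w) : Integrable h velMeasure :=
  (Lp.memLp h).integrable (by norm_num)

theorem integrableOn_cexp_neg_mul {z : ℂ} (hz : 0 < z.re) :
    IntegrableOn (fun t : ℝ => Complex.exp (-(z * t))) (Ioi 0) := by
  have := integrableOn_exp_mul_complex_Ioi (a := -z) (by simpa using hz) 0
  simpa only [neg_mul] using this

/-- The Laplace transform of the moment of the free flow. -/
theorem integral_exp_mul_phaseMoment (ξ : ℝ) {z : ℂ} (hz : 0 < z.re) (h : L2w) :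
    ∫ t in Ioi (0 : ℝ), Complex.exp (-(z * t)) * phaseMoment (ξ * t) h
      = momentL (resOp ξ z h) := by
  have e1 : ∀ t : ℝ, Complex.exp (-(z * t)) * phaseMoment (ξ * t) h
      = ∫ v, Complex.exp (-(z * t)) * (phase (ξ * t) v * h v) ∂velMeasure := by
    intro t
    rw [phaseMoment_apply, momentL_apply, moment, integral_const_mul]
    congr 1
    exact integral_congr_ae (coeFn_mulOp _ _)
  have hint : Integrable (Function.uncurry fun (t v : ℝ) =>
      Complex.exp (-(z * t)) * (phase (ξ * t) v * h v))
      ((volume.restrict (Ioi 0)).prod velMeasure) := by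
    have h1 : Integrable (fun q : ℝ × ℝ => Complex.exp (-(z * q.1)) * h q.2)
      ((volume.restrict (Ioi 0)).prod velMeasure) :=
      (integrableOn_cexp_neg_mul hz).mul_prod (integrable_coe_L2w h)
    have hc : Continuous fun q : ℝ × ℝ => phase (ξ * q.1) q.2 := by
      simp only [phase_apply]; fun_prop
    refine (h1.bdd_mul (c := 1) (hc.aestronglyMeasurable) (Eventually.of_forall fun q =>
      (norm_phase_apply _ _).le)).congr (Eventually.of_forall fun q => ?_)
    simp only [Function.uncurry]
    ring
  simp only [e1]
  rw [integral_integral_swap hint, momentL_apply, moment]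
  refine integral_congr_ae ?_
  filter_upwards [coeFn_resOp (ξ := ξ) hz h] with v hv
  rw [hv]
  have e2 : ∀ t : ℝ, Complex.exp (-(z * t)) * (phase (ξ * t) v * h v)
      = Complex.exp (-(Complex.I * v * ξ + z) * t) * h v := by
    intro t
    rw [phase_apply, ← mul_assoc, ← Complex.exp_add]
    congr 2
    push_cast; ring
  simp only [e2]
  rw [integral_mul_const, integral_exp_mul_complex_Ioi (by simpa using hz)]
  congr 1
  simp only [Complex.ofReal_zero, mul_zero, Complex.exp_zero]
  rw [neg_div_neg_eq, one_div]

/-- The integrand `exp(-z t - ξ² t² / 4)`. -/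
def gk (ξ : ℝ) (z : ℂ) (t : ℝ) : ℂ := Complex.exp (-(z * t) - (ξ : ℂ) ^ 2 * t ^ 2 / 4)

theorem norm_gk (ξ : ℝ) (z : ℂ) (t : ℝ) :
    ‖gk ξ z t‖ = Real.exp (-(z.re * t) - ξ ^ 2 * t ^ 2 / 4) := by
  rw [gk, Complex.norm_exp]
  congr 1
  have : ((ξ : ℂ) ^ 2 * (t : ℂ) ^ 2 / 4) = ((ξ ^ 2 * t ^ 2 / 4 : ℝ) : ℂ) := by push_cast; ring
  rw [this, Complex.sub_re, Complex.neg_re, Complex.ofReal_re, Complex.re_mul_ofReal]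

theorem norm_gk_le (ξ : ℝ) (z : ℂ) (t : ℝ) : ‖gk ξ z t‖ ≤ Real.exp (-z.re * t) := by
  rw [norm_gk]
  refine Real.exp_le_exp.2 ?_
  have : 0 ≤ ξ ^ 2 * t ^ 2 / 4 := by positivity
  linarith

theorem continuous_gk (ξ : ℝ) (z : ℂ) : Continuous (gk ξ z) := by unfold gk; fun_prop

theorem integrableOn_gk (ξ : ℝ) {z : ℂ} (hz : 0 < z.re) : IntegrableOn (gk ξ z) (Ioi 0) :=
  (integrableOn_exp_mul_Ioi (a := -z.re) (by linarith) 0).mono'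
    (continuous_gk ξ z).aestronglyMeasurable (Eventually.of_forall fun t => norm_gk_le ξ z t)

theorem kHat_eq (ξ : ℝ) {z : ℂ} (hz : 0 < z.re) : kHat ξ z = ∫ t in Ioi (0 : ℝ), gk ξ z t := by
  rw [← momentL_resOp_oneL hz, ← integral_exp_mul_phaseMoment ξ hz]
  congr 1; ext t
  rw [phaseMoment_apply, momentL_mulOp_phase_oneL, ← Complex.exp_add, gk]
  congr 1; push_cast; ring

theorem integrableOn_mul_exp_neg {p : ℝ} (hp : 0 < p) :
    IntegrableOn (fun t : ℝ => t * Real.exp (-p * t)) (Ioi 0) := by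
  have := integrableOn_rpow_mul_exp_neg_mul_rpow (p := 1) (s := 1) (b := p) (by norm_num) one_pos hp
  simpa using this

theorem integrableOn_mul_gk (ξ : ℝ) {z : ℂ} (hz : 0 < z.re) :
    IntegrableOn (fun t : ℝ => t * gk ξ z t) (Ioi 0) := by
  refine (integrableOn_mul_exp_neg hz).mono'
    (Complex.continuous_ofReal.mul (continuous_gk ξ z)).aestronglyMeasurable
    ((ae_restrict_iff' measurableSet_Ioi).2 (Eventually.of_forall fun t ht => ?_))
  rw [norm_mul, Complex.norm_real, Real.norm_of_nonneg (le_of_lt ht)]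
  exact mul_le_mul_of_nonneg_left (norm_gk_le ξ z t) (le_of_lt ht)

/-- The integral `∫₀^∞ t exp(-z t - ξ² t² / 4) dt`. -/
def kHat1 (ξ : ℝ) (z : ℂ) : ℂ := ∫ t in Ioi (0 : ℝ), t * gk ξ z t

theorem hasDerivAt_kHat (ξ : ℝ) {z : ℂ} (hz : 0 < z.re) :
    HasDerivAt (kHat ξ) (-kHat1 ξ z) z := by
  have hs : {y : ℂ | z.re / 2 < y.re} ∈ 𝓝 z :=
    Complex.continuous_re.continuousAt.eventually (lt_mem_nhds (by linarith))
  have h := (hasDerivAt_integral_of_dominated_loc_of_deriv_le (μ := volume.restrict (Ioi (0 : ℝ)))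
    (F := fun y t => gk ξ y t) (F' := fun y t => -(t * gk ξ y t)) (x₀ := z) (𝕜 := ℂ)
    (bound := fun t => t * Real.exp (-(z.re / 2) * t)) hs
    (Eventually.of_forall fun y => (continuous_gk ξ y).aestronglyMeasurable)
    (integrableOn_gk ξ hz)
    (integrableOn_mul_gk ξ hz).neg.1
    ((ae_restrict_iff' measurableSet_Ioi).2 (Eventually.of_forall fun t ht y hy => ?_))
    (integrableOn_mul_exp_neg (by linarith))
    (Eventually.of_forall fun t y _ => ?_)).2
  · rw [integral_neg] at h
    refine h.congr_of_eventuallyEq ?_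
    filter_upwards [hs] with y hy
    exact kHat_eq ξ (lt_trans (by linarith) hy)
  · have ht0 : (0 : ℝ) ≤ t := le_of_lt ht
    rw [norm_neg, norm_mul, Complex.norm_real, Real.norm_of_nonneg ht0]
    refine mul_le_mul_of_nonneg_left ((norm_gk_le ξ y t).trans (Real.exp_le_exp.2 ?_)) ht0
    have : z.re / 2 < y.re := hy
    nlinarith
  · have h1 : HasDerivAt (fun y : ℂ => -(y * (t : ℂ)) - (ξ : ℂ) ^ 2 * (t : ℂ) ^ 2 / 4)
        (-(1 * (t : ℂ))) y :=
      (((hasDerivAt_id y).mul_const (t : ℂ)).neg).sub_const _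
    refine (HasDerivAt.congr_deriv (f := fun y => gk ξ y t) h1.cexp ?_)
    rw [gk]; ring

/-- Integrate the derivative of `gk ξ z` over the half-line; the boundary value at `0` is `1`. As
`kHat1` is `-k̂'`, this is a first order linear differential equation for `k̂`, from which the sign
information below is drawn. -/
theorem kHat_ode (ξ : ℝ) {z : ℂ} (hz : 0 < z.re) :
    (ξ : ℂ) ^ 2 / 2 * kHat1 ξ z = 1 - z * kHat ξ z := by
  have hd : ∀ t ∈ Ici (0 : ℝ), HasDerivAt (gk ξ z)
      (-(z * gk ξ z t) - (ξ : ℂ) ^ 2 / 2 * (t * gk ξ z t)) t := by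
    intro t _
    have h1 : HasDerivAt (fun t : ℝ => (t : ℂ)) 1 t := Complex.ofRealCLM.hasDerivAt
    have h2 := ((h1.const_mul z).neg.sub (((h1.pow 2).const_mul ((ξ : ℂ) ^ 2)).div_const 4)).cexp
    have e : (fun t : ℝ => Complex.exp (-(z * t) - (ξ : ℂ) ^ 2 * t ^ 2 / 4)) = gk ξ z := rfl
    refine (HasDerivAt.congr_deriv (f := gk ξ z) h2 ?_)
    simp only [gk, Pi.pow_apply, Pi.sub_apply, Pi.neg_apply]
    push_cast
    ring
  have hi1 := (integrableOn_gk ξ hz).const_mul z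
  have hi2 := (integrableOn_mul_gk ξ hz).const_mul ((ξ : ℂ) ^ 2 / 2)
  have hlim : Tendsto (gk ξ z) atTop (𝓝 0) := by
    refine squeeze_zero_norm (norm_gk_le ξ z) ?_
    refine Real.tendsto_exp_atBot.comp ?_
    exact tendsto_id.const_mul_atTop_of_neg (by linarith)
  have h := integral_Ioi_of_hasDerivAt_of_tendsto' hd (hi1.neg.sub hi2) hlim
  have e : ∫ t in Ioi (0 : ℝ), (-(z * gk ξ z t) - (ξ : ℂ) ^ 2 / 2 * (t * gk ξ z t))
      = -(z * kHat ξ z) - (ξ : ℂ) ^ 2 / 2 * kHat1 ξ z := by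
    have hi1' : IntegrableOn (fun t => -(z * gk ξ z t)) (Ioi 0) := hi1.neg
    rw [integral_sub hi1' hi2, integral_neg, integral_const_mul, integral_const_mul,
      ← kHat_eq ξ hz, kHat1]
  rw [e] at h
  simp only [gk, Complex.ofReal_zero] at h
  simp at h
  linear_combination -h

/-! ### Real arguments -/

/-- The real integrand `exp(-x t - ξ² t² / 4)`. -/
def gr (ξ x t : ℝ) : ℝ := Real.exp (-(x * t) - ξ ^ 2 * t ^ 2 / 4)

theorem gk_ofReal (ξ x t : ℝ) : gk ξ x t = (gr ξ x t : ℂ) := by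
  rw [gk, gr]; push_cast; ring_nf

theorem norm_gk_eq_gr (ξ : ℝ) (z : ℂ) (t : ℝ) : ‖gk ξ z t‖ = gr ξ z.re t := norm_gk ξ z t

theorem continuous_gr (ξ x : ℝ) : Continuous (gr ξ x) := by unfold gr; fun_prop

theorem gr_pos (ξ x t : ℝ) : 0 < gr ξ x t := Real.exp_pos _

theorem integrableOn_gr (ξ : ℝ) {x : ℝ} (hx : 0 < x) : IntegrableOn (gr ξ x) (Ioi 0) := by
  have := (integrableOn_gk ξ (z := x) (by simpa using hx)).norm
  simp only [norm_gk_eq_gr, Complex.ofReal_re] at this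
  exact this

/-- The integral `∫₀^∞ exp(-x t - ξ² t² / 4) dt`. -/
def kr (ξ x : ℝ) : ℝ := ∫ t in Ioi (0 : ℝ), gr ξ x t

theorem kHat_ofReal (ξ : ℝ) {x : ℝ} (hx : 0 < x) : kHat ξ x = (kr ξ x : ℂ) := by
  rw [kHat_eq ξ (by simpa using hx), kr]
  simp only [gk_ofReal]
  exact integral_ofReal

theorem kHat_ofReal_eq_one_iff (ξ : ℝ) {x : ℝ} (hx : 0 < x) : kHat ξ x = 1 ↔ kr ξ x = 1 := by
  rw [kHat_ofReal ξ hx]; exact_mod_cast Iff.rfl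

theorem kr_pos (ξ : ℝ) {x : ℝ} (hx : 0 < x) : 0 < kr ξ x := by
  refine setIntegral_pos_iff_support_of_nonneg_ae (Eventually.of_forall fun t => (gr_pos ξ x t).le)
    (integrableOn_gr ξ hx) |>.2 ?_
  have : Function.support (gr ξ x) = univ := by
    ext t; simp [(gr_pos ξ x t).ne']
  rw [this, univ_inter]; simp

theorem setIntegral_Ioi_pos {f : ℝ → ℝ} {a : ℝ} (ha : 0 < a) (hf : IntegrableOn f (Ioi 0))
    (h0 : ∀ t, 0 < t → 0 ≤ f t) (hpos : ∀ t, 0 < t → t < a → 0 < f t) :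
    0 < ∫ t in Ioi (0 : ℝ), f t := by
  refine (setIntegral_pos_iff_support_of_nonneg_ae ((ae_restrict_iff' measurableSet_Ioi).2
    (Eventually.of_forall fun t ht => h0 t ht)) hf).2 ?_
  refine lt_of_lt_of_le (b := volume (Ioo 0 a)) (by simpa using ha) (measure_mono fun t ht => ?_)
  exact ⟨(hpos t ht.1 ht.2).ne', ht.1⟩

theorem kr_lt_kr (ξ : ℝ) {x y : ℝ} (hx : 0 < x) (hxy : x < y) : kr ξ y < kr ξ x := by
  rw [← sub_pos, kr, kr, ← integral_sub (integrableOn_gr ξ hx) (integrableOn_gr ξ (hx.trans hxy))]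
  have : ∀ t, 0 < t → 0 < gr ξ x t - gr ξ y t := by
    intro t ht
    rw [sub_pos, gr, gr, Real.exp_lt_exp]
    nlinarith
  exact setIntegral_Ioi_pos one_pos ((integrableOn_gr ξ hx).sub (integrableOn_gr ξ (hx.trans hxy)))
    (fun t ht => (this t ht).le) (fun t ht _ => this t ht)

theorem gr_le_gr {ξ η : ℝ} (h : |η| ≤ |ξ|) (x t : ℝ) : gr ξ x t ≤ gr η x t := by
  rw [gr, gr, Real.exp_le_exp]
  have : η ^ 2 ≤ ξ ^ 2 := sq_le_sq.2 h
  nlinarith [sq_nonneg t]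

theorem kr_le_kr {ξ η x : ℝ} (h : |η| ≤ |ξ|) (hx : 0 < x) : kr ξ x ≤ kr η x :=
  integral_mono (integrableOn_gr ξ hx) (integrableOn_gr η hx) fun t => gr_le_gr h x t

theorem kr_zero {x : ℝ} (hx : 0 < x) : kr 0 x = x⁻¹ := by
  have h1 := integral_exp_mul_Ioi (a := -x) (by linarith) 0
  have : ∀ t, gr 0 x t = Real.exp (-x * t) := by intro t; rw [gr]; congr 1; ring
  simp only [kr, this, h1]
  simp

theorem kr_lt_kr_zero {ξ x : ℝ} (hξ : ξ ≠ 0) (hx : 0 < x) : kr ξ x < kr 0 x := by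
  rw [← sub_pos, kr, kr, ← integral_sub (integrableOn_gr 0 hx) (integrableOn_gr ξ hx)]
  have : ∀ t, 0 < t → 0 < gr 0 x t - gr ξ x t := by
    intro t ht
    rw [sub_pos, gr, gr, Real.exp_lt_exp]
    have : 0 < ξ ^ 2 * t ^ 2 / 4 := by positivity
    linarith
  exact setIntegral_Ioi_pos one_pos ((integrableOn_gr 0 hx).sub (integrableOn_gr ξ hx))
    (fun t ht => (this t ht).le) (fun t ht _ => this t ht)

theorem kr_injOn (ξ : ℝ) {x y : ℝ} (hx : 0 < x) (hy : 0 < y) (h : kr ξ x = kr ξ y) : x = y := by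
  rcases lt_trichotomy x y with h1 | h1 | h1
  · exact absurd h (kr_lt_kr ξ hx h1).ne'
  · exact h1
  · exact absurd h (kr_lt_kr ξ hy h1).ne

/-- Intermediate values on `[0, 1]`. The threshold `√π` enters because the Gaussian integral gives
`kr ξ 0 = √π / |ξ|` for `ξ ≠ 0`, which has to exceed `1`. -/
theorem exists_kr_eq_one {ξ : ℝ} (hξ : |ξ| < Real.sqrt Real.pi) :
    ∃ x, 0 < x ∧ x ≤ 1 ∧ kr ξ x = 1 := by
  rcases eq_or_ne ξ 0 with rfl | h0
  · exact ⟨1, one_pos, le_rfl, by rw [kr_zero one_pos, inv_one]⟩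
  have hi0 : IntegrableOn (gr ξ 0) (Ioi 0) := by
    have := (integrable_exp_neg_mul_sq (b := ξ ^ 2 / 4) (by positivity)).integrableOn (s := Ioi 0)
    refine this.congr_fun (fun t _ => ?_) measurableSet_Ioi
    simp only [gr]; congr 1; ring
  have hk0 : kr ξ 0 = Real.sqrt Real.pi / |ξ| := by
    have := integral_gaussian_Ioi (ξ ^ 2 / 4)
    have e : ∀ t, gr ξ 0 t = Real.exp (-(ξ ^ 2 / 4) * t ^ 2) := by
      intro t; rw [gr]; congr 1; ring
    simp only [kr, e, this]
    rw [show Real.pi / (ξ ^ 2 / 4) = Real.pi / (|ξ| / 2) ^ 2 by rw [div_pow, sq_abs]; norm_num,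
      Real.sqrt_div' _ (by positivity), Real.sqrt_sq (by positivity)]
    field_simp
  have hcont : ContinuousOn (kr ξ) (Icc 0 1) := by
    refine continuousOn_of_dominated (bound := gr ξ 0)
      (fun x _ => (continuous_gr ξ x).aestronglyMeasurable) (fun x hx => ?_) hi0
      (Eventually.of_forall fun t => ?_)
    · refine (ae_restrict_iff' measurableSet_Ioi).2 (Eventually.of_forall fun t ht => ?_)
      rw [Real.norm_of_nonneg (gr_pos _ _ _).le, gr, gr, Real.exp_le_exp]
      have : 0 ≤ x * t := mul_nonneg hx.1 (le_of_lt ht)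
      linarith
    · unfold gr; fun_prop
  have h1 : 1 ∈ Icc (kr ξ 1) (kr ξ 0) := by
    constructor
    · have := kr_lt_kr_zero h0 one_pos
      rw [kr_zero one_pos, inv_one] at this
      exact this.le
    · rw [hk0, le_div_iff₀ (abs_pos.2 h0), one_mul]; exact hξ.le
  obtain ⟨x, hx, hx1⟩ := intermediate_value_Icc' zero_le_one hcont h1
  refine ⟨x, lt_of_le_of_ne hx.1 ?_, hx.2, hx1⟩
  rintro rfl
  rw [hk0, div_eq_one_iff_eq (abs_pos.2 h0).ne'] at hx1
  exact hξ.ne' hx1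

/-- The decay of the transform of a probability kernel bounded by `1`, uniformly in the kernel. -/
theorem kr_add_le {η δ ε : ℝ} (hδ : 0 < δ) (hε : 0 < ε) (h1 : kr η δ = 1) :
    kr η (δ + ε) ≤ 1 - (1 - Real.exp (-(ε / 2))) / 2 := by
  have hi1 := integrableOn_gr η hδ
  have hi2 := integrableOn_gr η (add_pos hδ hε)
  set c := 1 - Real.exp (-(ε / 2)) with hc
  have hc0 : 0 ≤ c := by
    rw [hc, sub_nonneg, Real.exp_le_one_iff]; linarith
  have hi3 : IntegrableOn (fun t =>
      c * (gr η δ t - (Ioc (0 : ℝ) (1 / 2)).indicator (fun _ => (1 : ℝ)) t))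
      (Ioi 0) := by
    refine (hi1.sub ?_).const_mul c
    exact ((integrableOn_const (by simp)).integrable_indicator measurableSet_Ioc).integrableOn
  -- Bound the lost mass from below: for `t > 1/2` at least the fraction `c` of `gr η δ t` is lost,
  -- and for `t ≤ 1/2` the comparison function is nonpositive since `gr ≤ 1`. As `gr` has mass `1`
  -- and at most `1/2` of it lies in `(0, 1/2]`, the loss is at least `c/2`, whatever `η` and `δ`
  -- are.
  have h2 : ∫ t in Ioi (0 : ℝ),
      c * (gr η δ t - (Ioc (0 : ℝ) (1 / 2)).indicator (fun _ => (1 : ℝ)) t)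
      ≤ ∫ t in Ioi (0 : ℝ), (gr η δ t - gr η (δ + ε) t) := by
    refine setIntegral_mono_on hi3 (hi1.sub hi2) measurableSet_Ioi fun t ht => ?_
    have ht0 : (0 : ℝ) < t := ht
    have e : gr η (δ + ε) t = gr η δ t * Real.exp (-(ε * t)) := by
      rw [gr, gr, ← Real.exp_add]; congr 1; ring
    have hg1 : gr η δ t ≤ 1 := by
      rw [gr, Real.exp_le_one_iff]
      have : 0 ≤ η ^ 2 * t ^ 2 / 4 := by positivity
      nlinarith
    have hg0 := gr_pos η δ t
    rw [e]
    by_cases htt : t ≤ 1 / 2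
    · rw [indicator_of_mem (show t ∈ Ioc (0 : ℝ) (1 / 2) from ⟨ht0, htt⟩)]
      have : Real.exp (-(ε * t)) ≤ 1 := by rw [Real.exp_le_one_iff]; nlinarith
      nlinarith
    · rw [indicator_of_notMem (fun h => htt h.2), sub_zero]
      have : Real.exp (-(ε * t)) ≤ Real.exp (-(ε / 2)) := by
        rw [Real.exp_le_exp]; push Not at htt; nlinarith
      rw [hc]
      nlinarith
  rw [integral_const_mul, integral_sub hi1
    ((integrableOn_const (by simp)).integrable_indicator measurableSet_Ioc).integrableOn,
    integral_sub hi1 hi2, setIntegral_indicator measurableSet_Ioc] at h2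
  have e3 : Ioi (0 : ℝ) ∩ Ioc 0 (1 / 2) = Ioc 0 (1 / 2) :=
    inter_eq_right.2 Ioc_subset_Ioi_self
  rw [e3] at h2
  simp only [integral_const, smul_eq_mul, mul_one] at h2
  have e4 : ∫ t in Ioi (0 : ℝ), gr η δ t = 1 := h1
  have e5 : (volume.restrict (Ioc (0 : ℝ) (1 / 2))).real univ = 1 / 2 := by
    simp [measureReal_def]
  rw [e4, e5] at h2
  change c * (1 - 1 / 2) ≤ 1 - kr η (δ + ε) at h2
  linarith

/-! ### The eigenvalue -/

theorem omega_lamStar_aux {ξ : ℝ} (hξ : |ξ| < Real.sqrt Real.pi) :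
    -1 < lamStar ξ ∧ lamStar ξ ≤ 0 ∧ omega (lamStar ξ) ξ = 0 := by
  obtain ⟨x, hx0, hx1, hx⟩ := exists_kr_eq_one hξ
  refine Classical.epsilon_spec (p := fun l : ℝ => -1 < l ∧ l ≤ 0 ∧ omega l ξ = 0)
    ⟨x - 1, by linarith, by linarith, ?_⟩
  rw [omega_eq, sub_eq_zero, eq_comm]
  have : (1 + ((x - 1 : ℝ) : ℂ)) = (x : ℂ) := by push_cast; ring
  rw [this, kHat_ofReal_eq_one_iff ξ hx0, hx]

/-- The shifted eigenvalue `1 + λ*(ξ)`. -/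
def del (ξ : ℝ) : ℝ := 1 + lamStar ξ

theorem del_pos {ξ : ℝ} (hξ : |ξ| < Real.sqrt Real.pi) : 0 < del ξ := by
  have := (omega_lamStar_aux hξ).1
  rw [del]; linarith

theorem del_le_one {ξ : ℝ} (hξ : |ξ| < Real.sqrt Real.pi) : del ξ ≤ 1 := by
  have := (omega_lamStar_aux hξ).2.1
  rw [del]; linarith

theorem kHat_del {ξ : ℝ} (hξ : |ξ| < Real.sqrt Real.pi) : kHat ξ (del ξ) = 1 := by
  have := (omega_lamStar_aux hξ).2.2
  rw [omega_eq, sub_eq_zero, eq_comm] at this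
  rw [del]; push_cast; exact this

theorem kr_del {ξ : ℝ} (hξ : |ξ| < Real.sqrt Real.pi) : kr ξ (del ξ) = 1 :=
  (kHat_ofReal_eq_one_iff ξ (del_pos hξ)).1 (kHat_del hξ)

/-- `kr` decreases strictly in its second argument and weakly in `|ξ|`, so its level-one point moves
left as `|ξ|` grows. -/
theorem del_anti {ξ η : ℝ} (h : |η| ≤ |ξ|) (hξ : |ξ| < Real.sqrt Real.pi) : del ξ ≤ del η := by
  by_contra! hc
  have h1 := kr_lt_kr η (del_pos (h.trans_lt hξ)) hc
  rw [kr_del (h.trans_lt hξ)] at h1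
  have h2 := kr_le_kr h (del_pos hξ)
  rw [kr_del hξ] at h2
  linarith

/-- The value `0` would force `kr ξ 1 = 1 = kr 0 1`, against strict comparison with zero frequency.
This makes the final rate negative. -/
theorem lamStar_neg {ξ : ℝ} (h0 : ξ ≠ 0) (hξ : |ξ| < Real.sqrt Real.pi) : lamStar ξ < 0 := by
  refine lt_of_le_of_ne (omega_lamStar_aux hξ).2.1 fun h => ?_
  have h1 := kr_del hξ
  rw [del, h, add_zero] at h1
  have h2 := kr_lt_kr_zero h0 one_pos
  rw [kr_zero one_pos, inv_one] at h2
  linarith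

/-! ### Positivity of the deflated symbol -/

theorem re_gk (ξ p β t : ℝ) :
    (gk ξ (p + Complex.I * β) t).re = gr ξ p t * Real.cos (β * t) := by
  have : gk ξ (p + Complex.I * β) t
      = (gr ξ p t : ℂ) * Complex.exp (((-(β * t) : ℝ) : ℂ) * Complex.I) := by
    rw [gk, gr, Complex.ofReal_exp, ← Complex.exp_add]
    congr 1; push_cast; ring
  rw [this, Complex.re_ofReal_mul, Complex.exp_ofReal_mul_I_re, Real.cos_neg]

theorem re_kHat (ξ : ℝ) {p : ℝ} (hp : 0 < p) (β : ℝ) :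
    (kHat ξ (p + Complex.I * β)).re = ∫ t in Ioi (0 : ℝ), gr ξ p t * Real.cos (β * t) := by
  have hz : 0 < ((p : ℂ) + Complex.I * β).re := by simpa using hp
  rw [kHat_eq ξ hz]
  have := integral_re (integrableOn_gk ξ hz)
  simp only [RCLike.re_eq_complex_re, re_gk] at this
  exact this.symm

theorem re_kHat1 (ξ : ℝ) {p : ℝ} (hp : 0 < p) (β : ℝ) :
    (kHat1 ξ (p + Complex.I * β)).re
      = ∫ t in Ioi (0 : ℝ), t * (gr ξ p t * Real.cos (β * t)) := by
  have hz : 0 < ((p : ℂ) + Complex.I * β).re := by simpa using hp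
  rw [kHat1]
  have := integral_re (integrableOn_mul_gk ξ hz)
  simp only [RCLike.re_eq_complex_re, Complex.re_ofReal_mul, re_gk] at this
  exact this.symm

theorem integrableOn_mul_gr (ξ : ℝ) {p : ℝ} (hp : 0 < p) :
    IntegrableOn (fun t => t * gr ξ p t) (Ioi 0) := by
  have := (integrableOn_mul_gk ξ (z := p) (by simpa using hp)).re
  simp only [gk_ofReal, RCLike.re_eq_complex_re, Complex.re_ofReal_mul, Complex.ofReal_re] at this
  exact this

theorem integrableOn_gr_cos (ξ : ℝ) {p : ℝ} (hp : 0 < p) (β : ℝ) :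
    IntegrableOn (fun t => gr ξ p t * Real.cos (β * t)) (Ioi 0) :=
  (integrableOn_gr ξ hp).mul_bdd (c := 1) (by fun_prop)
    (Eventually.of_forall fun t => by simpa using Real.abs_cos_le_one _)

theorem integrableOn_mul_gr_cos (ξ : ℝ) {p : ℝ} (hp : 0 < p) (β : ℝ) :
    IntegrableOn (fun t => t * (gr ξ p t * Real.cos (β * t))) (Ioi 0) := by
  have := (integrableOn_mul_gr ξ hp).mul_bdd (c := 1) (g := fun t => Real.cos (β * t)) (by fun_prop)
    (Eventually.of_forall fun t => by simpa using Real.abs_cos_le_one _)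
  simp only [mul_assoc] at this
  exact this

theorem kHat_ode_re (ξ : ℝ) {p : ℝ} (hp : 0 < p) (β : ℝ) :
    ξ ^ 2 / 2 * (kHat1 ξ (p + Complex.I * β)).re
      = 1 - p * (kHat ξ (p + Complex.I * β)).re + β * (kHat ξ (p + Complex.I * β)).im := by
  have h := congrArg Complex.re (kHat_ode ξ (z := p + Complex.I * β) (by simpa using hp))
  have e : (ξ : ℂ) ^ 2 / 2 = ((ξ ^ 2 / 2 : ℝ) : ℂ) := by push_cast; ring
  rw [e, Complex.re_ofReal_mul] at h
  simp at h
  linarith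

theorem kHat_ode_im (ξ : ℝ) {p : ℝ} (hp : 0 < p) (β : ℝ) :
    ξ ^ 2 / 2 * (kHat1 ξ (p + Complex.I * β)).im
      = - (p * (kHat ξ (p + Complex.I * β)).im) - β * (kHat ξ (p + Complex.I * β)).re := by
  have h := congrArg Complex.im (kHat_ode ξ (z := p + Complex.I * β) (by simpa using hp))
  have e : (ξ : ℂ) ^ 2 / 2 = ((ξ ^ 2 / 2 : ℝ) : ℂ) := by push_cast; ring
  rw [e, Complex.im_ofReal_mul] at h
  simp at h
  linarith

/-- Subtract the real part of `kHat_ode` at `p` from the one at `p + iβ`. What remains are integrals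
of `1 - cos(β t)` against positive weights, one of them strictly positive. -/
theorem neg_mul_im_kHat_pos (ξ : ℝ) {p β : ℝ} (hp : 0 < p) (hβ : β ≠ 0) :
    0 < -(β * (kHat ξ (p + Complex.I * β)).im) := by
  have h1 := kHat_ode_re ξ hp β
  have h0 := kHat_ode_re ξ hp 0
  rw [re_kHat1 ξ hp, re_kHat ξ hp] at h1 h0
  simp only [zero_mul, Real.cos_zero, mul_one, add_zero] at h0
  have d0 : 0 < ∫ t in Ioi (0 : ℝ), (gr ξ p t - gr ξ p t * Real.cos (β * t)) := by
    have hb : 0 < |β| := abs_pos.2 hβ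
    refine setIntegral_Ioi_pos (a := Real.pi / |β|) (by positivity)
      ((integrableOn_gr ξ hp).sub (integrableOn_gr_cos ξ hp β)) (fun t _ => ?_) (fun t ht hta => ?_)
    · have := Real.cos_le_one (β * t)
      have := gr_pos ξ p t
      nlinarith
    · have h2 : Real.cos (β * t) < 1 := by
        rw [← Real.cos_abs, abs_mul, abs_of_pos ht, ← Real.cos_zero]
        refine Real.cos_lt_cos_of_nonneg_of_le_pi le_rfl ?_ (by positivity)
        rw [lt_div_iff₀ hb] at hta
        linarith
      have := gr_pos ξ p t
      nlinarith
  have d1 : 0 ≤ ∫ t in Ioi (0 : ℝ), (t * gr ξ p t - t * (gr ξ p t * Real.cos (β * t))) := by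
    refine setIntegral_nonneg measurableSet_Ioi fun t ht => ?_
    have h2 := Real.cos_le_one (β * t)
    have h3 := gr_pos ξ p t
    have h4 : (0 : ℝ) < t := ht
    have := mul_le_mul_of_nonneg_left h2 (mul_pos h4 h3).le
    linarith
  rw [integral_sub (integrableOn_gr ξ hp) (integrableOn_gr_cos ξ hp β)] at d0
  rw [integral_sub (integrableOn_mul_gr ξ hp) (integrableOn_mul_gr_cos ξ hp β)] at d1
  have := mul_pos hp d0
  have := mul_nonneg (show 0 ≤ ξ ^ 2 / 2 by positivity) d1
  nlinarith

theorem kHat_ne_one_of_im_ne_zero (ξ : ℝ) {z : ℂ} (hz : 0 < z.re) (hi : z.im ≠ 0) :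
    kHat ξ z ≠ 1 := by
  intro h
  have h1 := neg_mul_im_kHat_pos ξ hz hi
  have : ((z.re : ℂ) + Complex.I * z.im) = z := by rw [mul_comm]; exact Complex.re_add_im z
  rw [this, h] at h1
  simp at h1

/-- Off the real axis `k̂` is not real, and on it `kr` is injective. -/
theorem kHat_eq_one_imp {ξ : ℝ} (hξ : |ξ| < Real.sqrt Real.pi) {z : ℂ} (hz : 0 < z.re)
    (h : kHat ξ z = 1) : z = del ξ := by
  have hi : z.im = 0 := by
    by_contra hi
    exact kHat_ne_one_of_im_ne_zero ξ hz hi h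
  have e : z = (z.re : ℂ) := Complex.ext rfl (by simpa using hi)
  rw [e] at h ⊢
  rw [kHat_ofReal_eq_one_iff ξ hz] at h
  rw [kr_injOn ξ hz (del_pos hξ) (h.trans (kr_del hξ).symm)]

/-- By `kHat_ode`, `z k̂(z) = 1 - (ξ²/2) kHat1(z)`, and `|kHat1(z)|` is at most its value at `Re z`,
where the same identity bounds the last term by `1`. The bound does not involve `ξ`, which controls
the symbol at large `|Im z|`. -/
theorem norm_mul_kHat_le (ξ : ℝ) {z : ℂ} (hz : 0 < z.re) : ‖z * kHat ξ z‖ ≤ 2 := by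
  have h := kHat_ode ξ hz
  have h0 := kHat_ode_re ξ hz 0
  simp only [zero_mul, add_zero, Complex.ofReal_zero, mul_zero] at h0
  have h1 : ‖kHat1 ξ z‖ ≤ (kHat1 ξ z.re).re := by
    have := re_kHat1 ξ hz 0
    simp only [Complex.ofReal_zero, mul_zero, add_zero, zero_mul, Real.cos_zero, mul_one] at this
    rw [this]
    refine norm_integral_le_of_norm_le (integrableOn_mul_gr ξ hz)
      ((ae_restrict_iff' measurableSet_Ioi).2 (Eventually.of_forall fun t ht => ?_))
    rw [norm_mul, norm_gk_eq_gr, Complex.norm_real, Real.norm_of_nonneg (le_of_lt ht)]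
  have h2 : (kHat ξ z.re).re = kr ξ z.re := by rw [kHat_ofReal ξ hz, Complex.ofReal_re]
  rw [h2] at h0
  have h3 := mul_pos hz (kr_pos ξ hz)
  have h4 : z * kHat ξ z = 1 - (ξ : ℂ) ^ 2 / 2 * kHat1 ξ z := by rw [h]; ring
  rw [h4]
  have h5 : ‖(ξ : ℂ) ^ 2 / 2 * kHat1 ξ z‖ ≤ 1 := by
    rw [norm_mul]
    have : ‖(ξ : ℂ) ^ 2 / 2‖ = ξ ^ 2 / 2 := by simp
    rw [this]
    have := mul_le_mul_of_nonneg_left h1 (show 0 ≤ ξ ^ 2 / 2 by positivity)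
    linarith
  calc _ ≤ ‖(1 : ℂ)‖ + ‖(ξ : ℂ) ^ 2 / 2 * kHat1 ξ z‖ := norm_sub_le _ _
    _ ≤ 2 := by rw [norm_one]; linarith

theorem hasDerivAt_kHat_line (ξ : ℝ) {p : ℝ} (hp : 0 < p) (β : ℝ) :
    HasDerivAt (fun β : ℝ => kHat ξ (p + Complex.I * β))
      (-kHat1 ξ (p + Complex.I * β) * Complex.I) β := by
  have h1 : HasDerivAt (fun β : ℝ => (p : ℂ) + Complex.I * β) (Complex.I * 1) β :=
    (Complex.ofRealCLM.hasDerivAt.const_mul Complex.I).const_add _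
  rw [mul_one] at h1
  exact (hasDerivAt_kHat ξ (z := p + Complex.I * β) (by simpa using hp)).comp β h1

/-- Positivity of `Re [(1 - k̂(z)) conj(z - δ)]` on the line `Re z = p`, `0 < p < δ ≤ 1`,
when `k̂(δ) = 1`. -/
theorem symbol_pos (ξ : ℝ) {p δ : ℝ} (hp : 0 < p) (hpδ : p < δ) (hδ : δ ≤ 1) (hk : kHat ξ δ = 1)
    (β : ℝ) : 0 < (δ - p) * ((kHat ξ (p + Complex.I * β)).re - 1)
      - β * (kHat ξ (p + Complex.I * β)).im := by
  set A : ℝ → ℝ := fun β => (kHat ξ (p + Complex.I * β)).re with hA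
  set D : ℝ → ℝ := fun β => (kHat ξ (p + Complex.I * β)).im with hD
  set E : ℝ → ℝ := fun β => (δ - p) * (A β - 1) - β * D β with hE
  have hAd : ∀ β : ℝ, HasDerivAt A (kHat1 ξ (p + Complex.I * β)).im β := by
    intro β
    have := Complex.reCLM.hasFDerivAt.comp_hasDerivAt β (hasDerivAt_kHat_line ξ hp β)
    refine this.congr_deriv ?_
    simp
  have hDd : ∀ β : ℝ, HasDerivAt D (-(kHat1 ξ (p + Complex.I * β)).re) β := by
    intro β
    have := Complex.imCLM.hasFDerivAt.comp_hasDerivAt β (hasDerivAt_kHat_line ξ hp β)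
    refine this.congr_deriv ?_
    simp
  have hEd : ∀ β : ℝ, HasDerivAt E ((δ - p) * (kHat1 ξ (p + Complex.I * β)).im
      - (1 * D β + β * (-(kHat1 ξ (p + Complex.I * β)).re))) β := fun β =>
    (((hAd β).sub_const 1).const_mul (δ - p)).sub ((hasDerivAt_id β).mul (hDd β))
  have hEc : Continuous E := continuous_iff_continuousAt.2 fun β => (hEd β).continuousAt
  -- Where `A ≥ 1` both terms of `E` are nonnegative: the second is positive for `β ≠ 0`, the first
  -- at `β = 0`.
  have hpos : ∀ β, 1 ≤ A β → 0 < E β := by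
    intro β hβ
    rcases eq_or_ne β 0 with rfl | h0
    · have : 1 < A 0 := by
        have h1 : kr ξ δ = 1 := (kHat_ofReal_eq_one_iff ξ (hp.trans hpδ)).1 hk
        have h2 := kr_lt_kr ξ hp hpδ
        simp only [hA, Complex.ofReal_zero, mul_zero, add_zero, kHat_ofReal ξ hp, Complex.ofReal_re]
        linarith
      have := mul_pos (sub_pos.2 hpδ) (sub_pos.2 this)
      simpa only [hE, zero_mul, sub_zero] using this
    · have h1 := neg_mul_im_kHat_pos ξ hp h0
      have h2 := mul_nonneg (sub_pos.2 hpδ).le (sub_nonneg.2 hβ)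
      simp only [hE, hD]
      linarith
  have heven : ∀ β, E (-β) = E β := by
    have h1 : ∀ β, β * D β = ξ ^ 2 / 2 * (∫ t in Ioi (0 : ℝ), t * (gr ξ p t * Real.cos (β * t)))
        - 1 + p * ∫ t in Ioi (0 : ℝ), gr ξ p t * Real.cos (β * t) := by
      intro β
      have := kHat_ode_re ξ hp β
      rw [re_kHat1 ξ hp] at this
      rw [this, re_kHat ξ hp]
      ring
    intro β
    simp only [hE, h1, hA, re_kHat ξ hp, neg_mul, Real.cos_neg]
  -- a nonpositive minimum on `[0, b]` is impossible
  have main : ∀ b, 0 ≤ b → 0 < E b := by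
    intro b hb
    by_contra! hneg
    obtain ⟨c, hc, hmin⟩ := isCompact_Icc.exists_isMinOn (nonempty_Icc.2 hb) hEc.continuousOn
    have hEc0 : E c ≤ 0 := (hmin (right_mem_Icc.2 hb)).trans hneg
    have hAc : A c < 1 := by
      by_contra! h
      exact absurd (hpos c h) (not_lt.2 hEc0)
    have hE0 : 0 < E 0 := by
      refine hpos 0 ?_
      have h1 : kr ξ δ = 1 := (kHat_ofReal_eq_one_iff ξ (hp.trans hpδ)).1 hk
      have h2 := kr_lt_kr ξ hp hpδ
      simp only [hA, Complex.ofReal_zero, mul_zero, add_zero, kHat_ofReal ξ hp, Complex.ofReal_re]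
      linarith
    have hcpos : 0 < c := by
      refine lt_of_le_of_ne hc.1 ?_
      rintro rfl
      linarith
    -- The minimum may sit at the right endpoint `b`, so only slopes from the left are used.
    have hder : (δ - p) * (kHat1 ξ (p + Complex.I * c)).im
      - (1 * D c + c * (-(kHat1 ξ (p + Complex.I * c)).re)) ≤ 0 := by
      have h1 := (hasDerivAt_iff_tendsto_slope.1 (hEd c)).mono_left
        (nhdsWithin_mono c (fun s (hs : s ∈ Iio c) => (ne_of_lt hs : s ≠ c)))
      refine le_of_tendsto h1 ?_
      have hev : ∀ᶠ s in 𝓝[<] c, 0 < s := (lt_mem_nhds hcpos).filter_mono nhdsWithin_le_nhds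
      filter_upwards [hev, self_mem_nhdsWithin] with s hs hsc
      have hsc' : s < c := hsc
      rw [slope_def_field]
      refine div_nonpos_of_nonneg_of_nonpos ?_ (by linarith)
      exact sub_nonneg.2 (hmin ⟨hs.le, hsc'.le.trans hc.2⟩)
    have i1 := kHat_ode_re ξ hp c
    have i2 := kHat_ode_im ξ hp c
    have hDc : 0 < -D c := by
      have := neg_mul_im_kHat_pos ξ hp hcpos.ne'
      simp only [hD]
      by_contra! h
      have := mul_nonneg_of_nonpos_of_nonpos (show -(kHat ξ (p + Complex.I * c)).im ≤ 0 from h)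
        (show -c ≤ 0 by linarith)
      nlinarith
    change ξ ^ 2 / 2 * _ = 1 - p * A c + c * D c at i1
    change ξ ^ 2 / 2 * _ = -(p * D c) - c * A c at i2
    -- With the real and imaginary parts of `kHat_ode`, the combination `(ξ²/2) E' + c E` loses all
    -- derivatives of `k̂`. At the minimum the left side is nonpositive, while `δ ≤ 1`, `A c < 1`
    -- and `D c < 0` make the right side positive.
    have key : ξ ^ 2 / 2 * ((δ - p) * (kHat1 ξ (p + Complex.I * c)).im
        - (1 * D c + c * (-(kHat1 ξ (p + Complex.I * c)).re))) + c * E c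
        = c * ((1 - δ) + p * (1 - A c)) + (-D c) * ((δ - p) * p + ξ ^ 2 / 2) := by
      simp only [hE]
      linear_combination (δ - p) * i2 + c * i1
    have t1 := mul_nonneg (show 0 ≤ ξ ^ 2 / 2 by positivity) (neg_nonneg.2 hder)
    have t2 := mul_nonneg hcpos.le (neg_nonneg.2 hEc0)
    have t3 : 0 < c * ((1 - δ) + p * (1 - A c)) :=
      mul_pos hcpos (by have := mul_pos hp (sub_pos.2 hAc); linarith)
    have t4 : 0 ≤ (-D c) * ((δ - p) * p + ξ ^ 2 / 2) :=
      mul_nonneg hDc.le (by have := mul_pos (sub_pos.2 hpδ) hp; positivity)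
    linarith
  change 0 < E β
  rcases le_total 0 β with h | h
  · exact main β h
  · rw [← heven]; exact main (-β) (by linarith)

/-- The symbol `(1 - k̂(z)) / (z - δ)`. -/
def deflated (ξ δ : ℝ) (z : ℂ) : ℂ := (1 - kHat ξ z) / (z - δ)

theorem re_deflated_pos (ξ : ℝ) {p δ : ℝ} (hp : 0 < p) (hpδ : p < δ) (hδ : δ ≤ 1)
    (hk : kHat ξ δ = 1) (β : ℝ) : 0 < (deflated ξ δ (p + Complex.I * β)).re := by
  have hne : ((p : ℂ) + Complex.I * β - δ) ≠ 0 := by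
    intro h
    have := congrArg Complex.re h
    simp at this
    linarith
  rw [deflated, Complex.div_re, ← add_div]
  refine div_pos ?_ (Complex.normSq_pos.2 hne)
  have := symbol_pos ξ hp hpδ hδ hk β
  simp
  linarith

theorem continuous_kHat_param {Z : Type*} [TopologicalSpace Z] [FirstCountableTopology Z]
    {x : Z → ℝ} {y : Z → ℂ} {r : ℝ} (hr : 0 < r) (hx : Continuous x) (hy : Continuous y)
    (hyr : ∀ q, r ≤ (y q).re) : Continuous fun q => kHat (x q) (y q) := by
  unfold kHat
  refine continuous_of_dominated (bound := fun _ => r⁻¹) (fun q => ?_) (fun q => ?_)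
    (integrable_const _) ?_
  · have : Continuous fun v : ℝ => (Complex.I * v * x q + y q)⁻¹ :=
      Continuous.inv₀ (by fun_prop) fun _ => denom_ne_zero (hr.trans_le (hyr q))
    exact this.aestronglyMeasurable
  · exact Eventually.of_forall fun v => (norm_inv_denom_le (hr.trans_le (hyr q))).trans
      (inv_anti₀ hr (hyr q))
  · exact Eventually.of_forall fun v =>
      Continuous.inv₀ (by fun_prop) fun q => denom_ne_zero (hr.trans_le (hyr q))

/-- A uniform lower bound for `Re [(z + c) (1 - k̂(z)) / (z - δ)]` on the line `Re z = p`. -/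
theorem exists_coercive_symbol {p δ₀ : ℝ} (hp : 0 < p) (hpδ : p < δ₀) :
    ∃ c : ℝ, 0 < c ∧ ∀ ξ δ : ℝ, |ξ| ≤ 2 → δ₀ ≤ δ → δ ≤ 1 → kHat ξ δ = 1 → ∀ β : ℝ,
      1 / 2 ≤ (((p + Complex.I * β) + c) * deflated ξ δ (p + Complex.I * β)).re := by
  -- The maximum with `δ₀` keeps `k̂` continuous in all parameters, so the constraint is closed and
  -- `S` compact; on `S` it changes nothing.
  set S : Set (ℝ × ℝ × ℝ) := {q | q ∈ Icc (-2 : ℝ) 2 ×ˢ (Icc δ₀ 1 ×ˢ Icc (-6 : ℝ) 6) ∧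
    kHat q.1 ((max q.2.1 δ₀ : ℝ) : ℂ) = 1} with hS
  have hδ0 : 0 < δ₀ := hp.trans hpδ
  have hSc : IsCompact S := by
    refine (isCompact_Icc.prod (isCompact_Icc.prod isCompact_Icc)).inter_right ?_
    refine isClosed_eq (continuous_kHat_param hδ0 continuous_fst (by fun_prop) fun q => ?_)
      continuous_const
    rw [Complex.ofReal_re]; exact le_max_right _ _
  have hmem : ∀ q ∈ S, δ₀ ≤ q.2.1 ∧ q.2.1 ≤ 1 ∧ kHat q.1 (q.2.1 : ℂ) = 1 := by
    rintro ⟨ξ, δ, β⟩ ⟨⟨_, hδ, _⟩, hk⟩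
    refine ⟨hδ.1, hδ.2, ?_⟩
    simpa only [max_eq_left hδ.1] using hk
  have hdc : ContinuousOn (fun q : ℝ × ℝ × ℝ => deflated q.1 q.2.1 (p + Complex.I * q.2.2)) S := by
    have h1 : Continuous fun q : ℝ × ℝ × ℝ => kHat q.1 (p + Complex.I * q.2.2) :=
      continuous_kHat_param hp continuous_fst (by fun_prop) fun q => by simp
    refine ContinuousOn.div (continuous_const.sub h1).continuousOn (by fun_prop) fun q hq h => ?_
    have := congrArg Complex.re h
    have := (hmem q hq).1
    simp at *
    linarith
  obtain ⟨κ, hκ0, hκ⟩ := hSc.exists_forall_le' (a := 0)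
    (Complex.continuous_re.comp_continuousOn hdc)
    fun q hq => re_deflated_pos q.1 hp (hpδ.trans_le (hmem q hq).1) (hmem q hq).2.1
      (hmem q hq).2.2 q.2.2
  have hzc : ContinuousOn (fun q : ℝ × ℝ × ℝ => (p + Complex.I * q.2.2)
      * deflated q.1 q.2.1 (p + Complex.I * q.2.2)) S := ContinuousOn.mul (by fun_prop) hdc
  obtain ⟨Λ, hΛ⟩ := hSc.exists_bound_of_continuousOn hzc
  -- For `|β| ≤ 6` the term `z · deflated` has real part at least `-|Λ|`, and `c` times the lower
  -- bound `κ` contributes `|Λ| + 1`.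
  refine ⟨(|Λ| + 1) / κ, by positivity, fun ξ δ hξ hδ hδ1 hk β => ?_⟩
  have hpos := re_deflated_pos ξ hp (hpδ.trans_le hδ) hδ1 hk β
  have e : (((p + Complex.I * β) + (((|Λ| + 1) / κ : ℝ) : ℂ)) * deflated ξ δ (p + Complex.I * β)).re
      = ((p + Complex.I * β) * deflated ξ δ (p + Complex.I * β)).re
        + (|Λ| + 1) / κ * (deflated ξ δ (p + Complex.I * β)).re := by
    rw [add_mul, Complex.add_re, Complex.re_ofReal_mul]
  rw [e]
  by_cases hβ : |β| ≤ 6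
  · have hq : (ξ, δ, β) ∈ S := by
      refine ⟨⟨abs_le.1 hξ, ⟨hδ, hδ1⟩, abs_le.1 hβ⟩, ?_⟩
      simpa only [max_eq_left hδ] using hk
    have h1 := hκ _ hq
    have h2 := (neg_le_abs _).trans ((Complex.abs_re_le_norm _).trans (hΛ _ hq))
    simp only [Function.comp] at h1 h2
    have h3 : |Λ| + 1 ≤ (|Λ| + 1) / κ * (deflated ξ δ (p + Complex.I * β)).re := by
      rw [div_mul_eq_mul_div, le_div_iff₀ hκ0]
      exact mul_le_mul_of_nonneg_left h1 (by positivity)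
    have := le_abs_self Λ
    linarith
  · push Not at hβ
    set z : ℂ := p + Complex.I * β with hz
    have hzre : z.re = p := by simp [hz]
    have hzim : z.im = β := by simp [hz]
    have hnorm : 6 ≤ ‖z - δ‖ := by
      have := Complex.abs_im_le_norm (z - δ)
      simp only [Complex.sub_im, Complex.ofReal_im, sub_zero, hzim] at this
      linarith
    have hne : z - δ ≠ 0 := by
      intro h; rw [h, norm_zero] at hnorm; linarith
    -- For `|β| > 6` the product is close to `1`: the numerator is at most `1 + 2` and the
    -- denominator at least `6`, an error of at most `1/2`.
    have e2 : z * deflated ξ δ z = 1 + (δ - z * kHat ξ z) / (z - δ) := by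
      rw [deflated]; field_simp; ring
    have h3 : ‖(δ - z * kHat ξ z) / (z - δ)‖ ≤ 1 / 2 := by
      rw [norm_div, div_le_iff₀ (by linarith)]
      have h4 : ‖(δ : ℂ)‖ ≤ 1 := by
        rw [Complex.norm_real, Real.norm_of_nonneg (hδ0.le.trans hδ)]; exact hδ1
      have h5 := norm_mul_kHat_le ξ (z := z) (by rw [hzre]; exact hp)
      have := norm_sub_le (δ : ℂ) (z * kHat ξ z)
      linarith
    have h6 := (neg_le_abs _).trans ((Complex.abs_re_le_norm _).trans h3)
    rw [e2, Complex.add_re, Complex.one_re]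
    have : 0 ≤ (|Λ| + 1) / κ * (deflated ξ δ z).re := by positivity
    linarith

/-! ### Volterra equations with parameters -/

section Volterra

variable {E : Type*} [NormedAddCommGroup E] [NormedSpace ℝ E]

theorem integral_exp_two_mul_sub (τ : ℝ) :
    ∫ s in (0 : ℝ)..τ, Real.exp (-(2 * (τ - s))) = (1 - Real.exp (-(2 * τ))) / 2 := by
  have hd : ∀ s ∈ uIcc 0 τ, HasDerivAt (fun s => Real.exp (-(2 * (τ - s))) / 2)
      (Real.exp (-(2 * (τ - s)))) s := by
    intro s _
    have h1 : HasDerivAt (fun s : ℝ => -(2 * (τ - s))) (-(2 * (0 - 1))) s :=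
      (((hasDerivAt_const s τ).sub (hasDerivAt_id s)).const_mul 2).neg
    refine (h1.exp.div_const 2).congr_deriv ?_
    ring
  rw [intervalIntegral.integral_eq_sub_of_hasDerivAt hd
    (by apply Continuous.intervalIntegrable; fun_prop)]
  simp
  ring

theorem norm_volterra_integral_le {κ : ℝ → ℝ} (hκ1 : ∀ t, |κ t| ≤ 1)
    {y : ℝ → E} {M : ℝ} (hy : ∀ s, ‖y s‖ ≤ M) {τ : ℝ} (hτ : 0 ≤ τ) :
    ‖∫ s in (0 : ℝ)..τ, (Real.exp (-(2 * (τ - s))) * κ (τ - s)) • y s‖ ≤ M / 2 := by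
  have hM : 0 ≤ M := (norm_nonneg _).trans (hy 0)
  have h1 : ‖∫ s in (0 : ℝ)..τ, (Real.exp (-(2 * (τ - s))) * κ (τ - s)) • y s‖
      ≤ ∫ s in (0 : ℝ)..τ, Real.exp (-(2 * (τ - s))) * M := by
    refine intervalIntegral.norm_integral_le_of_norm_le hτ (Eventually.of_forall fun s _ => ?_)
      (by apply Continuous.intervalIntegrable; fun_prop)
    rw [norm_smul, norm_mul, Real.norm_of_nonneg (Real.exp_pos _).le, Real.norm_eq_abs]
    have := mul_le_mul (hκ1 (τ - s)) (hy s) (norm_nonneg _) zero_le_one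
    rw [mul_assoc]
    exact mul_le_mul_of_nonneg_left (by linarith) (Real.exp_pos _).le
  refine h1.trans ?_
  rw [intervalIntegral.integral_mul_const, integral_exp_two_mul_sub]
  have := Real.exp_pos (-(2 * τ))
  nlinarith

variable [CompleteSpace E]

/-- Picard iteration with the weight `exp(-2t)`, under which a kernel bounded by `1` has mass at
most `1/2`. The frequency is part of the argument of the unknown, so the fixed point is jointly
continuous. -/
theorem exists_volterra {k : ℝ → ℝ → ℝ} (hk : Continuous (Function.uncurry k))
    (hk1 : ∀ ξ t, |k ξ t| ≤ 1) {m : ℝ → ℝ → E} (hm : Continuous (Function.uncurry m)) {B : ℝ}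
    (hB : ∀ ξ t, ‖m ξ t‖ ≤ B) :
    ∃ ρ : ℝ → ℝ → E, Continuous (Function.uncurry ρ) ∧
      (∀ ξ t, 0 ≤ t → ρ ξ t = m ξ t + ∫ s in (0 : ℝ)..t, k ξ (t - s) • ρ ξ s) ∧
      ∃ C, 0 ≤ C ∧ ∀ ξ t, 0 ≤ t → ‖ρ ξ t‖ ≤ C * Real.exp (2 * t) := by
  have hint : ∀ y : (ℝ × ℝ) →ᵇ E, Continuous fun q : ℝ × ℝ =>
      ∫ s in (0 : ℝ)..|q.2|, (Real.exp (-(2 * (|q.2| - s))) * k q.1 (|q.2| - s)) • y (q.1, s) := by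
    intro y
    refine intervalIntegral.continuous_parametric_intervalIntegral_of_continuous
      (f := fun (q : ℝ × ℝ) s =>
        (Real.exp (-(2 * (|q.2| - s))) * k q.1 (|q.2| - s)) • y (q.1, s)) ?_ (by fun_prop)
    refine Continuous.smul (Continuous.mul (by fun_prop) ?_) (y.continuous.comp (by fun_prop))
    exact hk.comp (f := fun q : (ℝ × ℝ) × ℝ => (q.1.1, |q.1.2| - q.2)) (by fun_prop)
  have hmc : Continuous fun q : ℝ × ℝ => Real.exp (-(2 * |q.2|)) • m q.1 |q.2| :=
    Continuous.smul (by fun_prop)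
      (hm.comp (f := fun q : ℝ × ℝ => (q.1, |q.2|)) (by fun_prop))
  -- Replacing `t` by `|t|` only serves to work on the whole plane; negative times play no role.
  let Φ : ((ℝ × ℝ) →ᵇ E) → ((ℝ × ℝ) →ᵇ E) := fun y =>
    BoundedContinuousFunction.ofNormedAddCommGroup
      (fun q : ℝ × ℝ => Real.exp (-(2 * |q.2|)) • m q.1 |q.2| +
        ∫ s in (0 : ℝ)..|q.2|, (Real.exp (-(2 * (|q.2| - s))) * k q.1 (|q.2| - s)) • y (q.1, s))
      (hmc.add (hint y)) (B + ‖y‖ / 2) (fun q => by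
        refine (norm_add_le _ _).trans (add_le_add ?_ ?_)
        · rw [norm_smul, Real.norm_of_nonneg (Real.exp_pos _).le]
          have h1 : Real.exp (-(2 * |q.2|)) ≤ 1 := by
            rw [Real.exp_le_one_iff]; have := abs_nonneg q.2; linarith
          have := mul_le_mul h1 (hB q.1 |q.2|) (norm_nonneg _) zero_le_one
          linarith
        · exact norm_volterra_integral_le (κ := k q.1) (hk1 q.1)
            (fun s => y.norm_coe_le_norm (q.1, s)) (abs_nonneg _))
  have hΦ : ∀ y q, Φ y q = Real.exp (-(2 * |q.2|)) • m q.1 |q.2| +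
        ∫ s in (0 : ℝ)..|q.2|, (Real.exp (-(2 * (|q.2| - s))) * k q.1 (|q.2| - s)) • y (q.1, s) :=
    fun y q => rfl
  have hii : ∀ (y : (ℝ × ℝ) →ᵇ E) (q : ℝ × ℝ), IntervalIntegrable (fun s =>
      (Real.exp (-(2 * (|q.2| - s))) * k q.1 (|q.2| - s)) • y (q.1, s)) volume 0 |q.2| := by
    intro y q
    refine Continuous.intervalIntegrable ?_ _ _
    refine Continuous.smul (Continuous.mul (by fun_prop) ?_) (y.continuous.comp (by fun_prop))
    exact hk.comp (f := fun s : ℝ => (q.1, |q.2| - s)) (by fun_prop)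
  have hcontr : ContractingWith (1 / 2) Φ := by
    refine ⟨by norm_num, LipschitzWith.of_dist_le_mul fun y y' => ?_⟩
    rw [BoundedContinuousFunction.dist_le (by positivity)]
    intro q
    rw [hΦ, hΦ, dist_add_left, dist_eq_norm, ← intervalIntegral.integral_sub (hii y q) (hii y' q)]
    simp only [← smul_sub]
    refine (norm_volterra_integral_le (κ := k q.1) (hk1 q.1)
      (y := fun s => y (q.1, s) - y' (q.1, s))
      (M := dist y y') (fun s => ?_) (abs_nonneg _)).trans (le_of_eq ?_)
    · rw [← dist_eq_norm]; exact BoundedContinuousFunction.dist_coe_le_dist _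
    · push_cast; ring
  obtain ⟨y, hy⟩ : ∃ y, Φ y = y := ⟨_, hcontr.fixedPoint_isFixedPt⟩
  refine ⟨fun ξ t => Real.exp (2 * t) • y (ξ, t), ?_, ?_, ‖y‖, norm_nonneg _, ?_⟩
  · have : Continuous fun q : ℝ × ℝ => Real.exp (2 * q.2) • y q :=
      Continuous.smul (by fun_prop) y.continuous
    exact this
  · intro ξ t ht
    have h1 : y (ξ, t) = Φ y (ξ, t) := by rw [hy]
    rw [hΦ] at h1
    simp only [abs_of_nonneg ht] at h1
    simp only
    rw [h1, smul_add, smul_smul, ← Real.exp_add, add_neg_cancel, Real.exp_zero, one_smul,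
      ← intervalIntegral.integral_smul]
    congr 1
    refine intervalIntegral.integral_congr fun s _ => ?_
    simp only [smul_smul]
    congr 1
    rw [← mul_assoc, ← Real.exp_add, mul_comm]
    congr 2
    ring
  · intro ξ t _
    simp only
    rw [norm_smul, Real.norm_of_nonneg (Real.exp_pos _).le, mul_comm]
    exact mul_le_mul_of_nonneg_right (y.norm_coe_le_norm _) (Real.exp_pos _).le

end Volterra

/-! ### The solution at a fixed frequency -/

/-- The kernel `exp(-ξ² t² / 4)`. -/
def gauss (ξ t : ℝ) : ℝ := Real.exp (-(ξ * t) ^ 2 / 4)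

theorem gauss_pos (ξ t : ℝ) : 0 < gauss ξ t := Real.exp_pos _

theorem abs_gauss_le (ξ t : ℝ) : |gauss ξ t| ≤ 1 := by
  rw [abs_of_pos (gauss_pos ξ t), gauss, Real.exp_le_one_iff]
  have := sq_nonneg (ξ * t)
  linarith

theorem momentL_phase_eq_gauss (ξ t : ℝ) :
    momentL (mulOp (phase (ξ * t)) oneL) = (gauss ξ t : ℂ) := by
  rw [momentL_mulOp_phase_oneL, gauss]
  push_cast
  rfl

/-- The unknown takes values in the dual of `L²_w`: linearity in the datum is then automatic, and
joint continuity in `(ξ, t)` later provides measurability in `ξ`. -/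
theorem exists_density : ∃ ρ : ℝ → ℝ → L2w →L[ℂ] ℂ, Continuous (Function.uncurry ρ) ∧
      (∀ ξ t, 0 ≤ t → ρ ξ t = phaseMoment (ξ * t) + ∫ s in (0 : ℝ)..t, gauss ξ (t - s) • ρ ξ s) ∧
      ∃ C, 0 ≤ C ∧ ∀ ξ t, 0 ≤ t → ‖ρ ξ t‖ ≤ C * Real.exp (2 * t) := by
  refine exists_volterra (m := fun ξ t => phaseMoment (ξ * t)) (B := 1) ?_ abs_gauss_le ?_
    (fun ξ t => norm_phaseMoment_le _)
  · simp only [Function.uncurry_def, gauss]; fun_prop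
  · exact continuous_phaseMoment.comp (continuous_fst.mul continuous_snd)

/-- The density (moment) of the solution, up to the factor `exp(-t)`, as a functional of the
initial value. -/
def density : ℝ → ℝ → L2w →L[ℂ] ℂ := exists_density.choose

theorem continuous_density : Continuous (Function.uncurry density) :=
  exists_density.choose_spec.1

theorem density_eq {ξ t : ℝ} (ht : 0 ≤ t) (h : L2w) :
    density ξ t h = phaseMoment (ξ * t) h
      + ∫ s in (0 : ℝ)..t, (gauss ξ (t - s) : ℂ) * density ξ s h := by
  have h1 := exists_density.choose_spec.2.1 ξ t ht
  change density ξ t = _ + ∫ s in (0 : ℝ)..t, gauss ξ (t - s) • density ξ s at h1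
  have hi : IntervalIntegrable (fun s => gauss ξ (t - s) • density ξ s) volume 0 t := by
    have hg : Continuous fun s => gauss ξ (t - s) := by unfold gauss; fun_prop
    refine Continuous.intervalIntegrable (hg.smul ?_) _ _
    exact continuous_density.comp (f := fun s : ℝ => (ξ, s)) (by fun_prop)
  conv_lhs => rw [h1]
  rw [add_apply, ContinuousLinearMap.intervalIntegral_apply hi]
  simp only [smul_apply, Complex.real_smul]

theorem exists_norm_density_le :
    ∃ C, 0 ≤ C ∧ ∀ ξ t, 0 ≤ t → ‖density ξ t‖ ≤ C * Real.exp (2 * t) :=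
  exists_density.choose_spec.2.2

theorem continuous_density_apply {Z : Type*} [TopologicalSpace Z] {x t : Z → ℝ} {h : Z → L2w}
    (hx : Continuous x) (ht : Continuous t) (hh : Continuous h) :
    Continuous fun z => density (x z) (t z) (h z) :=
  (continuous_density.comp (hx.prodMk ht)).clm_apply hh

/-- The forcing term of the Duhamel formula at frequency `ξ`, in the moving frame. -/
def source (ξ s : ℝ) (h : L2w) : L2w := density ξ s h • mulOp (phase (-(ξ * s))) oneL

theorem continuous_source {Z : Type*} [TopologicalSpace Z] [FirstCountableTopology Z]
    {x t : Z → ℝ} {h : Z → L2w} (hx : Continuous x) (ht : Continuous t) (hh : Continuous h) :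
    Continuous fun z => source (x z) (t z) (h z) :=
  (continuous_density_apply hx ht hh).smul
    (continuous_mulOp_phase (hx.mul ht).neg continuous_const)

/-- The solution at time `t` of `∂ₜ u = L_ξ u`, `u(0) = h`. -/
def fiberSol (ξ t : ℝ) (h : L2w) : L2w :=
  ((Real.exp (-t) : ℝ) : ℂ) • mulOp (phase (ξ * t)) (h + ∫ s in (0 : ℝ)..t, source ξ s h)

theorem continuous_fiberSol {Z : Type*} [TopologicalSpace Z] [FirstCountableTopology Z]
    {x t : Z → ℝ} {h : Z → L2w} (hx : Continuous x) (ht : Continuous t) (hh : Continuous h) :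
    Continuous fun z => fiberSol (x z) (t z) (h z) := by
  unfold fiberSol
  refine (Complex.continuous_ofReal.comp (Real.continuous_exp.comp ht.neg)).smul
    (continuous_mulOp_phase (hx.mul ht) (hh.add ?_))
  refine intervalIntegral.continuous_parametric_intervalIntegral_of_continuous
    (f := fun z s => source (x z) s (h z)) ?_ ht
  exact continuous_source (hx.comp continuous_fst) continuous_snd (hh.comp continuous_fst)

theorem continuous_fiberSol_time (ξ : ℝ) (h : L2w) : Continuous fun t => fiberSol ξ t h :=
  continuous_fiberSol continuous_const continuous_id continuous_const

theorem fiberSol_zero (ξ : ℝ) (h : L2w) : fiberSol ξ 0 h = h := by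
  simp [fiberSol, phase_zero, mulOp_one]

theorem fiberSol_eq (ξ t : ℝ) (h : L2w) :
    fiberSol ξ t h = ((Real.exp (-t) : ℝ) : ℂ) • (mulOp (phase (ξ * t)) h
      + ∫ s in (0 : ℝ)..t, density ξ s h • mulOp (phase (ξ * (t - s))) oneL) := by
  have hi : IntervalIntegrable (fun s => source ξ s h) volume 0 t :=
    (continuous_source continuous_const continuous_id continuous_const).intervalIntegrable _ _
  rw [fiberSol, map_add, ← (mulOp (phase (ξ * t))).intervalIntegral_comp_comm hi]
  congr 2
  refine intervalIntegral.integral_congr fun s _ => ?_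
  simp only [source, map_smul, mulOp_mulOp, phase_mul]
  congr 3
  ring_nf

theorem intervalIntegrable_duhamel (ξ t : ℝ) (h : L2w) : IntervalIntegrable
    (fun s => density ξ s h • mulOp (phase (ξ * (t - s))) oneL) volume 0 t := by
  refine Continuous.intervalIntegrable ?_ _ _
  exact (continuous_density_apply continuous_const continuous_id continuous_const).smul
    (continuous_mulOp_phase (by fun_prop) continuous_const)

/-- A functional that commutes with the free flow, applied to the solution. -/
theorem apply_fiberSol (ℓ : L2w →L[ℂ] ℂ) (ξ t : ℝ) (h : L2w) :
    ℓ (fiberSol ξ t h) = ((Real.exp (-t) : ℝ) : ℂ) * (ℓ (mulOp (phase (ξ * t)) h)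
      + ∫ s in (0 : ℝ)..t, density ξ s h * ℓ (mulOp (phase (ξ * (t - s))) oneL)) := by
  rw [fiberSol_eq, map_smul, map_add, smul_eq_mul,
    ← ℓ.intervalIntegral_comp_comm (intervalIntegrable_duhamel ξ t h)]
  simp only [map_smul, smul_eq_mul]

/-- The Volterra equation for the density is exactly the moment of Duhamel's formula, so the formula
is self-consistent. -/
theorem momentL_fiberSol {ξ t : ℝ} (ht : 0 ≤ t) (h : L2w) :
    momentL (fiberSol ξ t h) = ((Real.exp (-t) : ℝ) : ℂ) * density ξ t h := by
  rw [apply_fiberSol, density_eq ht, phaseMoment_apply]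
  simp only [momentL_phase_eq_gauss, mul_comm]

theorem norm_fiberSol_le {ξ t : ℝ} (ht : 0 ≤ t) (h : L2w) :
    ‖fiberSol ξ t h‖ ≤ Real.exp (-t) * (‖h‖ + ∫ s in (0 : ℝ)..t, ‖density ξ s h‖) := by
  rw [fiberSol_eq, norm_smul, Complex.norm_real, Real.norm_of_nonneg (Real.exp_pos _).le]
  refine mul_le_mul_of_nonneg_left ((norm_add_le _ _).trans (add_le_add
    (norm_mulOp_phase_le _ _) ?_)) (Real.exp_pos _).le
  refine intervalIntegral.norm_integral_le_of_norm_le ht (Eventually.of_forall fun s _ => ?_)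
    ((continuous_density_apply continuous_const continuous_id
      continuous_const).norm.intervalIntegrable _ _)
  rw [norm_smul]
  refine mul_le_of_le_one_right (norm_nonneg _) ?_
  simpa [norm_oneL] using norm_mulOp_phase_le (ξ * (t - s)) oneL

/-- Crude in time but uniform in `ξ`; it places the solution in `L²(ℝ, L²_w)` and supplies the
dominating function for continuity in `t`. -/
theorem exists_norm_fiberSol_le (T : ℝ) :
    ∃ C, 0 ≤ C ∧ ∀ ξ t, 0 ≤ t → t ≤ T → ∀ h : L2w, ‖fiberSol ξ t h‖ ≤ C * ‖h‖ := by
  obtain ⟨C, hC0, hC⟩ := exists_norm_density_le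
  refine ⟨1 + |T| * (C * Real.exp (2 * T)), by positivity, fun ξ t ht htT h => ?_⟩
  refine (norm_fiberSol_le ht h).trans ?_
  have h1 : ∫ s in (0 : ℝ)..t, ‖density ξ s h‖ ≤ |T| * (C * Real.exp (2 * T)) * ‖h‖ := by
    have h2 : ∫ s in (0 : ℝ)..t, ‖density ξ s h‖
        ≤ ∫ s in (0 : ℝ)..t, C * Real.exp (2 * T) * ‖h‖ := by
      refine intervalIntegral.integral_mono_on ht ((continuous_density_apply continuous_const
        continuous_id continuous_const).norm.intervalIntegrable _ _)
        (by simp) fun s hs => ?_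
      refine ((density ξ s).le_opNorm h).trans (mul_le_mul_of_nonneg_right ?_ (norm_nonneg _))
      refine (hC ξ s hs.1).trans (mul_le_mul_of_nonneg_left (Real.exp_le_exp.2 ?_) hC0)
      linarith [hs.2]
    refine h2.trans ?_
    rw [intervalIntegral.integral_const, sub_zero, smul_eq_mul, ← mul_assoc]
    have : t ≤ |T| := htT.trans (le_abs_self T)
    gcongr
  have h3 : Real.exp (-t) ≤ 1 := by rw [Real.exp_le_one_iff]; linarith
  have h4 : 0 ≤ ∫ s in (0 : ℝ)..t, ‖density ξ s h‖ :=
    intervalIntegral.integral_nonneg ht fun _ _ => norm_nonneg _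
  have := norm_nonneg h
  calc _ ≤ 1 * (‖h‖ + ∫ s in (0 : ℝ)..t, ‖density ξ s h‖) :=
        mul_le_mul_of_nonneg_right h3 (by positivity)
    _ ≤ _ := by linarith

/-- Multiplication by `v` is unbounded, so the equation is verified pointwise in `v`: the
representative `G · v` solves a scalar linear differential equation, which is integrated over `[0,
t]`. -/
theorem isL_xi_fiberSol {ξ t : ℝ} (ht : 0 ≤ t) (h : L2w) :
    IsL_xi ξ (∫ s in (0 : ℝ)..t, fiberSol ξ s h) (fiberSol ξ t h - h) := by
  set d : ℝ → ℂ := fun s => density ξ s h with hd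
  have hdc : Continuous d :=
    continuous_density_apply continuous_const continuous_id continuous_const
  set Q : ℝ → ℝ → ℂ := fun s v => ∫ r in (0 : ℝ)..s, d r * phase (-(ξ * r)) v with hQ
  have hQc : Continuous (Function.uncurry Q) := by
    refine intervalIntegral.continuous_parametric_intervalIntegral_of_continuous
      (f := fun (q : ℝ × ℝ) r => d r * phase (-(ξ * r)) q.2) ?_ continuous_fst
    simp only [phase_apply]
    exact (hdc.comp continuous_snd).mul (by fun_prop)
  have hy : ∀ s, 0 ≤ s → (∫ r in (0 : ℝ)..s, source ξ r h : L2w) =ᵐ[velMeasure] Q s := by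
    intro s hs
    refine intervalIntegral_Lp_ae_eq (G := fun r v => d r * phase (-(ξ * r)) v) hs
      (continuous_source continuous_const continuous_id continuous_const).continuousOn ?_ ?_
    · refine Continuous.aestronglyMeasurable ?_
      simp only [Function.uncurry_def, phase_apply]
      exact (hdc.comp continuous_fst).mul (by fun_prop)
    · intro r _
      filter_upwards [Lp.coeFn_smul (density ξ r h) (mulOp (phase (-(ξ * r))) oneL),
        coeFn_mulOp (phase (-(ξ * r))) oneL, coeFn_oneL] with v h1 h2 h3
      rw [source, h1, Pi.smul_apply, h2, h3, mul_one, smul_eq_mul]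
  set G : ℝ → ℝ → ℂ := fun s v =>
    ((Real.exp (-s) : ℝ) : ℂ) * (phase (ξ * s) v * (h v + Q s v)) with hG
  have hu : ∀ s, 0 ≤ s → fiberSol ξ s h =ᵐ[velMeasure] G s := by
    intro s hs
    filter_upwards [hy s hs, Lp.coeFn_add h (∫ r in (0 : ℝ)..s, source ξ r h),
      coeFn_mulOp (phase (ξ * s)) (h + ∫ r in (0 : ℝ)..s, source ξ r h),
      Lp.coeFn_smul ((Real.exp (-s) : ℝ) : ℂ)
        (mulOp (phase (ξ * s)) (h + ∫ r in (0 : ℝ)..s, source ξ r h))] with v h1 h2 h3 h4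
    rw [fiberSol, h4, Pi.smul_apply, h3, h2, Pi.add_apply, h1, smul_eq_mul]
  have hU : (∫ s in (0 : ℝ)..t, fiberSol ξ s h : L2w) =ᵐ[velMeasure]
      fun v => ∫ s in (0 : ℝ)..t, G s v := by
    refine intervalIntegral_Lp_ae_eq ht (continuous_fiberSol_time ξ h).continuousOn ?_
      fun s hs => hu s hs.1
    have h1 : StronglyMeasurable fun q : ℝ × ℝ => h q.2 :=
      (Lp.stronglyMeasurable h).comp_measurable measurable_snd
    have h2 : Continuous fun q : ℝ × ℝ => ((Real.exp (-q.1) : ℝ) : ℂ) := by fun_prop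
    have h3 : Continuous fun q : ℝ × ℝ => phase (ξ * q.1) q.2 := by
      simp only [phase_apply]; fun_prop
    exact (h2.stronglyMeasurable.mul (h3.stronglyMeasurable.mul
      (h1.add hQc.stronglyMeasurable))).aestronglyMeasurable
  have hmom : moment (∫ s in (0 : ℝ)..t, fiberSol ξ s h)
      = ∫ s in (0 : ℝ)..t, ((Real.exp (-s) : ℝ) : ℂ) * d s := by
    rw [← momentL_apply, ← momentL.intervalIntegral_comp_comm
      ((continuous_fiberSol_time ξ h).intervalIntegrable _ _)]
    refine intervalIntegral.integral_congr fun s hs => ?_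
    rw [uIcc_of_le ht] at hs
    exact momentL_fiberSol hs.1 h
  filter_upwards [hU, hu t ht, Lp.coeFn_sub (fiberSol ξ t h) h] with v h1 h2 h3
  rw [h3, Pi.sub_apply, h2, h1, hmom]
  have hGd : ∀ s, HasDerivAt (fun s => G s v)
      (-(1 + Complex.I * v * ξ) * G s v + ((Real.exp (-s) : ℝ) : ℂ) * d s) s := by
    intro s
    have e1 : HasDerivAt (fun s => Q s v) (d s * phase (-(ξ * s)) v) s := by
      refine (Continuous.integral_hasStrictDerivAt ?_ 0 s).hasDerivAt
      simp only [phase_apply]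
      exact hdc.mul (by fun_prop)
    have e2 : HasDerivAt (fun s : ℝ => -((1 + Complex.I * v * ξ) * (s : ℂ)))
        (-((1 + Complex.I * v * ξ) * 1)) s := (Complex.ofRealCLM.hasDerivAt.const_mul _).neg
    have e3 := e2.cexp.mul (e1.const_add (h v))
    have e4 : (fun s => G s v) = (fun s : ℝ => Complex.exp (-((1 + Complex.I * v * ξ) * (s : ℂ))))
        * fun s => h v + Q s v := by
      funext s
      simp only [hG, Pi.mul_apply, phase_apply]
      rw [← mul_assoc, Complex.ofReal_exp, ← Complex.exp_add]
      congr 2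
      push_cast; ring
    have e5 : Complex.exp (-((1 + Complex.I * v * ξ) * (s : ℂ))) * (d s * phase (-(ξ * s)) v)
        = ((Real.exp (-s) : ℝ) : ℂ) * d s := by
      rw [phase_apply, mul_left_comm, Complex.ofReal_exp, ← Complex.exp_add, mul_comm]
      congr 2
      push_cast; ring
    have e6 := congrFun e4 s
    simp only [Pi.mul_apply] at e6
    rw [e4]
    refine e3.congr_deriv ?_
    rw [e5, e6]
    ring
  have hGc : Continuous fun s => G s v :=
      continuous_iff_continuousAt.2 fun s => (hGd s).continuousAt
  have hdc' : Continuous fun s : ℝ => ((Real.exp (-s) : ℝ) : ℂ) * d s := by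
    exact Continuous.mul (by fun_prop) hdc
  have hGc' : Continuous fun s => -(1 + Complex.I * v * ξ) * G s v := continuous_const.mul hGc
  have hFTC := intervalIntegral.integral_eq_sub_of_hasDerivAt (a := 0) (b := t)
    (fun s _ => hGd s)
    ((hGc'.add hdc').intervalIntegrable _ _)
  rw [intervalIntegral.integral_add (hGc'.intervalIntegrable _ _)
    (hdc'.intervalIntegrable _ _), intervalIntegral.integral_const_mul] at hFTC
  have hG0 : G 0 v = h v := by simp [hG, hQ, phase_apply]
  rw [hG0] at hFTC
  rw [← hFTC]
  ring

/-! ### Linearity of `IsL_xi` -/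

theorem IsL_xi.sub {ξ : ℝ} {h k h' k' : L2w} (H : IsL_xi ξ h k) (H' : IsL_xi ξ h' k') :
    IsL_xi ξ (h - h') (k - k') := by
  filter_upwards [H, H', Lp.coeFn_sub h h', Lp.coeFn_sub k k'] with v h1 h2 h3 h4
  rw [h4, Pi.sub_apply, h1, h2, h3, Pi.sub_apply, ← momentL_apply, ← momentL_apply,
    ← momentL_apply, map_sub]
  ring

theorem IsL_xi.smul {ξ : ℝ} {h k : L2w} (H : IsL_xi ξ h k) (c : ℂ) :
    IsL_xi ξ (c • h) (c • k) := by
  filter_upwards [H, Lp.coeFn_smul c h, Lp.coeFn_smul c k] with v h1 h2 h3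
  rw [h3, Pi.smul_apply, h1, h2, Pi.smul_apply, ← momentL_apply, ← momentL_apply, map_smul]
  simp only [smul_eq_mul]
  ring

theorem IsL.sub {h k h' k' : L2L2w} (H : IsL h k) (H' : IsL h' k') : IsL (h - h') (k - k') := by
  filter_upwards [H, H', Lp.coeFn_sub h h', Lp.coeFn_sub k k'] with ξ h1 h2 h3 h4
  rw [h3, h4]
  exact h1.sub h2

/-- Uniqueness at a fixed frequency. -/
theorem eq_fiberSol {ξ : ℝ} {h : L2w} {f : ℝ → L2w} (hf : Continuous f)
    (heq : ∀ t, 0 ≤ t → IsL_xi ξ (∫ s in (0 : ℝ)..t, f s) (f t - h)) {t : ℝ} (ht : 0 ≤ t) :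
    f t = fiberSol ξ t h := by
  have hu := continuous_fiberSol_time ξ h
  refine sub_eq_zero.1 (eq_zero_of_dissipative (f := fun s => f s - fiberSol ξ s h)
    (hf.sub hu).continuousOn (fun s hs => ?_) t ht)
  rw [intervalIntegral.integral_sub (hf.intervalIntegrable _ _) (hu.intervalIntegrable _ _)]
  have := (heq s hs).sub (isL_xi_fiberSol hs h)
  rw [sub_sub_sub_cancel_right] at this
  exact re_inner_le_zero_of_isL_xi this

/-! ### The spectral functional and the eigenvector -/

/-- The functional `h ↦ ∫ h(v) w(v) / (i v ξ + 1 + λ*(ξ)) dv`. -/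
def spectralL (ξ : ℝ) : L2w →L[ℂ] ℂ := momentL ∘L resOp ξ (del ξ)

theorem spectralL_apply (ξ : ℝ) (h : L2w) : spectralL ξ h = momentL (resOp ξ (del ξ) h) := rfl

/-- The eigenvector `1 / (i v ξ + 1 + λ*(ξ))`. -/
def eigvec (ξ : ℝ) : L2w := resOp ξ (del ξ) oneL

theorem del_re_pos {ξ : ℝ} (hξ : |ξ| < Real.sqrt Real.pi) : 0 < ((del ξ : ℝ) : ℂ).re := by
  rw [Complex.ofReal_re]; exact del_pos hξ

theorem one_add_lamStar (ξ : ℝ) : (1 : ℂ) + ((lamStar ξ : ℝ) : ℂ) = ((del ξ : ℝ) : ℂ) := by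
  rw [del]; push_cast; rfl

theorem momentL_eigvec {ξ : ℝ} (hξ : |ξ| < Real.sqrt Real.pi) : momentL (eigvec ξ) = 1 := by
  rw [eigvec, momentL_resOp_oneL (del_re_pos hξ), kHat_del hξ]

/-- Take the moment of the resolvent form of the equation at `λ*`. Since `k̂(δ) = 1`, the moments of
`h` cancel, leaving a left eigenfunctional. -/
theorem spectralL_of_isL_xi {ξ : ℝ} (hξ : |ξ| < Real.sqrt Real.pi) {h k : L2w}
    (H : IsL_xi ξ h k) : spectralL ξ k = lamStar ξ * spectralL ξ h := by
  have hz : 0 < ((1 : ℂ) + ((lamStar ξ : ℝ) : ℂ)).re := by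
    rw [one_add_lamStar]; exact del_re_pos hξ
  have h1 := (isL_xi_iff_resOp (ξ := ξ) hz h (k - (lamStar ξ : ℂ) • h)).1 (by
    rwa [sub_add_cancel])
  rw [one_add_lamStar] at h1
  have h2 := congrArg momentL h1
  simp only [map_sub, map_smul, smul_eq_mul] at h2
  rw [momentL_resOp_oneL (del_re_pos hξ), kHat_del hξ, mul_one, ← spectralL_apply,
    ← spectralL_apply] at h2
  linear_combination h2

theorem spectralL_fiberSol {ξ : ℝ} (hξ : |ξ| < Real.sqrt Real.pi) {t : ℝ} (ht : 0 ≤ t) (h : L2w) :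
    spectralL ξ (fiberSol ξ t h) = Real.exp (lamStar ξ * t) * spectralL ξ h := by
  set l := lamStar ξ with hl
  set y : ℝ → ℂ := fun s => spectralL ξ (fiberSol ξ s h) with hy
  have hyc : Continuous y := (spectralL ξ).continuous.comp (continuous_fiberSol_time ξ h)
  have hY : ∀ s, 0 ≤ s → y s = spectralL ξ h + l * ∫ r in (0 : ℝ)..s, y r := by
    intro s hs
    have h1 := spectralL_of_isL_xi hξ (isL_xi_fiberSol (ξ := ξ) hs h)
    rw [← (spectralL ξ).intervalIntegral_comp_comm
      ((continuous_fiberSol_time ξ h).intervalIntegrable _ _), map_sub] at h1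
    linear_combination h1
  -- Integrating factor for `y = y(0) + λ* ∫ y`: this product is constant on `[0, t]`.
  set F : ℝ → ℂ := fun s => ((Real.exp (-(l * s)) : ℝ) : ℂ) *
    (spectralL ξ h + l * ∫ r in (0 : ℝ)..s, y r) with hF
  have hFd : ∀ s, HasDerivAt F (((Real.exp (-(l * s)) * (-(l * 1)) : ℝ) : ℂ) *
      (spectralL ξ h + l * ∫ r in (0 : ℝ)..s, y r) +
      ((Real.exp (-(l * s)) : ℝ) : ℂ) * (l * y s)) s := by
    intro s
    have e1 : HasDerivAt (fun s => Real.exp (-(l * s))) (Real.exp (-(l * s)) * (-(l * 1))) s :=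
      ((hasDerivAt_id s).const_mul l).neg.exp
    have e2 : HasDerivAt (fun s => ∫ r in (0 : ℝ)..s, y r) (y s) s :=
      (hyc.integral_hasStrictDerivAt 0 s).hasDerivAt
    exact e1.ofReal_comp.mul ((e2.const_mul (l : ℂ)).const_add (spectralL ξ h))
  have hconst := constant_of_has_deriv_right_zero (f := F) (a := 0) (b := t)
    (fun s _ => (hFd s).continuousAt.continuousWithinAt) (fun s hs => by
      refine ((hFd s).congr_deriv ?_).hasDerivWithinAt
      rw [hY s hs.1]
      push_cast
      ring) t ⟨ht, le_rfl⟩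
  have e0 : F 0 = spectralL ξ h := by simp [hF]
  rw [e0] at hconst
  have e1 : F t = ((Real.exp (-(l * t)) : ℝ) : ℂ) * y t := by rw [hY t ht]
  rw [e1] at hconst
  rw [← hconst, ← mul_assoc, ← Complex.ofReal_mul, ← Real.exp_add, add_neg_cancel, Real.exp_zero,
    Complex.ofReal_one, one_mul]

theorem isL_xi_eigvec {ξ : ℝ} (hξ : |ξ| < Real.sqrt Real.pi) :
    IsL_xi ξ (eigvec ξ) ((lamStar ξ : ℂ) • eigvec ξ) := by
  have hz : 0 < ((1 : ℂ) + ((lamStar ξ : ℝ) : ℂ)).re := by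
    rw [one_add_lamStar]; exact del_re_pos hξ
  have h1 := (isL_xi_iff_resOp (ξ := ξ) hz (eigvec ξ) 0).2 (by
    rw [momentL_eigvec hξ, one_smul, sub_zero, one_add_lamStar, eigvec])
  rwa [zero_add] at h1

theorem fiberSol_smul_eigvec {ξ : ℝ} (hξ : |ξ| < Real.sqrt Real.pi) (c : ℂ) {t : ℝ} (ht : 0 ≤ t) :
    fiberSol ξ t (c • eigvec ξ) = ((Real.exp (lamStar ξ * t) : ℝ) : ℂ) • c • eigvec ξ := by
  set l := lamStar ξ with hl
  have hc : Continuous fun s : ℝ => ((Real.exp (l * s) : ℝ) : ℂ) := by fun_prop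
  refine (eq_fiberSol (f := fun s => ((Real.exp (l * s) : ℝ) : ℂ) • c • eigvec ξ)
    (hc.smul continuous_const) (fun s hs => ?_) ht).symm
  have e1 : ∫ r in (0 : ℝ)..s, ((Real.exp (l * r) : ℝ) : ℂ) • c • eigvec ξ
      = (∫ r in (0 : ℝ)..s, ((Real.exp (l * r) : ℝ) : ℂ)) • c • eigvec ξ :=
    intervalIntegral.integral_smul_const _ _
  have e2 : (l : ℂ) * ∫ r in (0 : ℝ)..s, ((Real.exp (l * r) : ℝ) : ℂ)
      = ((Real.exp (l * s) : ℝ) : ℂ) - 1 := by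
    have hd : ∀ r ∈ uIcc 0 s, HasDerivAt (fun r : ℝ => ((Real.exp (l * r) : ℝ) : ℂ))
        (l * ((Real.exp (l * r) : ℝ) : ℂ)) r := by
      intro r _
      have := (((hasDerivAt_id r).const_mul l).exp).ofReal_comp
      refine this.congr_deriv ?_
      push_cast
      simp
      ring
    have := intervalIntegral.integral_eq_sub_of_hasDerivAt hd
      ((continuous_const.mul hc).intervalIntegrable _ _)
    rw [intervalIntegral.integral_const_mul] at this
    rw [this]; simp
  rw [e1]
  have h1 := ((isL_xi_eigvec hξ).smul c).smul (∫ r in (0 : ℝ)..s, ((Real.exp (l * r) : ℝ) : ℂ))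
  have e3 : (∫ r in (0 : ℝ)..s, ((Real.exp (l * r) : ℝ) : ℂ)) • c • (l : ℂ) • eigvec ξ
      = ((Real.exp (l * s) : ℝ) : ℂ) • c • eigvec ξ - c • eigvec ξ := by
    rw [smul_smul, smul_smul, smul_smul, ← sub_smul]
    congr 1
    linear_combination c * e2
  rwa [e3] at h1

/-! ### Decay at a fixed frequency -/

theorem integral_exp_mul {c : ℝ} (hc : c ≠ 0) (t : ℝ) :
    ∫ s in (0 : ℝ)..t, Real.exp (c * s) = (Real.exp (c * t) - 1) / c := by
  rw [intervalIntegral.integral_comp_mul_left (fun s => Real.exp s) hc, integral_exp, mul_zero,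
    Real.exp_zero, smul_eq_mul]
  ring

theorem norm_phaseMoment_apply_le (x : ℝ) (h : L2w) : ‖phaseMoment x h‖ ≤ ‖h‖ := by
  simpa using (phaseMoment x).le_of_opNorm_le (norm_phaseMoment_le x) h

theorem continuous_density_time (ξ : ℝ) (h : L2w) : Continuous fun s => density ξ s h :=
  continuous_density_apply continuous_const continuous_id continuous_const

theorem gauss_mul_exp (ξ x t : ℝ) : Real.exp (-(x * t)) * gauss ξ t = gr ξ x t := by
  rw [gauss, gr, ← Real.exp_add]; congr 1; ring

theorem integral_gr_sub_le (ξ : ℝ) {x t : ℝ} (hx : 0 < x) (ht : 0 ≤ t) :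
    ∫ s in (0 : ℝ)..t, gr ξ x (t - s) ≤ kr ξ x := by
  rw [intervalIntegral.integral_comp_sub_left (fun s => gr ξ x s), sub_self, sub_zero,
    intervalIntegral.integral_of_le ht, kr]
  exact setIntegral_mono_set (integrableOn_gr ξ hx)
    (Eventually.of_forall fun s => (gr_pos ξ x s).le)
    (Eventually.of_forall Ioc_subset_Ioi_self)

/-- At a maximum point of `exp(-r s) |ρ(s)|` on `[0, t]`, the Volterra integral is at most `1 - q`
times that maximum and can be absorbed. -/
theorem norm_density_le_of_kr_lt {ξ r q : ℝ} (hr : 0 < r) (hq : kr ξ r ≤ 1 - q) (hq0 : 0 < q)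
    (h : L2w) {t : ℝ} (ht : 0 ≤ t) : ‖density ξ t h‖ ≤ ‖h‖ / q * Real.exp (r * t) := by
  set φ : ℝ → ℝ := fun s => Real.exp (-(r * s)) * ‖density ξ s h‖ with hφ
  have hφc : Continuous φ := Continuous.mul (by fun_prop) (continuous_density_time ξ h).norm
  obtain ⟨c, hc, hmax⟩ := isCompact_Icc.exists_isMaxOn (nonempty_Icc.2 ht) hφc.continuousOn
  have hφ0 : 0 ≤ φ c := by positivity
  have h1 : φ c ≤ ‖h‖ + φ c * (1 - q) := by
    have e1 : ‖density ξ c h‖ ≤ ‖h‖ + ∫ s in (0 : ℝ)..c, gauss ξ (c - s) * ‖density ξ s h‖ := by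
      rw [density_eq hc.1]
      refine (norm_add_le _ _).trans (add_le_add (norm_phaseMoment_apply_le _ _) ?_)
      refine intervalIntegral.norm_integral_le_of_norm_le hc.1 (Eventually.of_forall fun s _ => ?_)
        (Continuous.intervalIntegrable (Continuous.mul (by unfold gauss; fun_prop)
          (continuous_density_time ξ h).norm) _ _)
      rw [norm_mul, Complex.norm_real, Real.norm_of_nonneg (gauss_pos _ _).le]
    have e2 : Real.exp (-(r * c)) * ∫ s in (0 : ℝ)..c, gauss ξ (c - s) * ‖density ξ s h‖
        ≤ φ c * (1 - q) := by
      rw [← intervalIntegral.integral_const_mul]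
      have e3 : ∫ s in (0 : ℝ)..c, Real.exp (-(r * c)) * (gauss ξ (c - s) * ‖density ξ s h‖)
          ≤ ∫ s in (0 : ℝ)..c, φ c * gr ξ r (c - s) := by
        refine intervalIntegral.integral_mono_on hc.1 ?_ ?_ fun s hs => ?_
        · refine Continuous.intervalIntegrable (continuous_const.mul (Continuous.mul
            (by unfold gauss; fun_prop) (continuous_density_time ξ h).norm)) _ _
        · refine Continuous.intervalIntegrable (continuous_const.mul
            ((continuous_gr ξ r).comp (by fun_prop))) _ _
        · have e4 : Real.exp (-(r * c)) * (gauss ξ (c - s) * ‖density ξ s h‖)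
              = gr ξ r (c - s) * φ s := by
            rw [← gauss_mul_exp, hφ]
            have : Real.exp (-(r * c)) = Real.exp (-(r * (c - s))) * Real.exp (-(r * s)) := by
              rw [← Real.exp_add]; congr 1; ring
            rw [this]; ring
          rw [e4, mul_comm]
          exact mul_le_mul_of_nonneg_right (hmax ⟨hs.1, hs.2.trans hc.2⟩) (gr_pos _ _ _).le
      refine e3.trans ?_
      rw [intervalIntegral.integral_const_mul]
      exact mul_le_mul_of_nonneg_left ((integral_gr_sub_le ξ hr hc.1).trans hq) hφ0
    have e5 : Real.exp (-(r * c)) ≤ 1 := by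
      rw [Real.exp_le_one_iff]; have := mul_nonneg hr.le hc.1; linarith
    have e6 := mul_le_mul_of_nonneg_left e1 (Real.exp_pos (-(r * c))).le
    have e7 := mul_le_mul_of_nonneg_right e5 (norm_nonneg h)
    simp only [hφ] at e2 ⊢
    linarith
  have h2 : φ c ≤ ‖h‖ / q := by rw [le_div_iff₀ hq0]; linarith
  have h3 : φ t ≤ ‖h‖ / q := (hmax ⟨ht, le_rfl⟩).trans h2
  have h4 : ‖density ξ t h‖ = φ t * Real.exp (r * t) := by
    simp only [hφ]
    rw [mul_right_comm, ← Real.exp_add, neg_add_cancel, Real.exp_zero, one_mul]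
  rw [h4]
  exact mul_le_mul_of_nonneg_right h3 (Real.exp_pos _).le

/-- Decay of all solutions, with a constant depending on `ε` only. -/
theorem exists_fiberSol_decay {ε : ℝ} (hε : 0 < ε) : ∃ C : ℝ, 0 < C ∧
    ∀ ξ η δ : ℝ, |η| ≤ |ξ| → 0 < δ → kr η δ = 1 → ∀ (h : L2w) (t : ℝ), 0 ≤ t →
      ‖fiberSol ξ t h‖ ≤ C * Real.exp ((δ - 1 + ε) * t) * ‖h‖ := by
  -- The mass gap from `kr_add_le`. The constant below avoids `δ` because `1/(δ + ε) ≤ 1/ε`.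
  set q := (1 - Real.exp (-(ε / 2))) / 2 with hq
  have hq0 : 0 < q := by
    have : Real.exp (-(ε / 2)) < 1 := by rw [Real.exp_lt_one_iff]; linarith
    rw [hq]; linarith
  refine ⟨1 + 1 / (q * ε), by positivity, fun ξ η δ hηξ hδ hk h t ht => ?_⟩
  set r := δ + ε with hr
  have hr0 : 0 < r := by positivity
  have hkr : kr ξ r ≤ 1 - q := (kr_le_kr hηξ hr0).trans (kr_add_le hδ hε hk)
  have h1 : ∫ s in (0 : ℝ)..t, ‖density ξ s h‖ ≤ ‖h‖ / (q * ε) * Real.exp (r * t) := by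
    have h2 : ∫ s in (0 : ℝ)..t, ‖density ξ s h‖ ≤ ∫ s in (0 : ℝ)..t, ‖h‖ / q * Real.exp (r * s) :=
      intervalIntegral.integral_mono_on ht
        ((continuous_density_time ξ h).norm.intervalIntegrable _ _)
        (Continuous.intervalIntegrable (by fun_prop) _ _)
        fun s hs => norm_density_le_of_kr_lt hr0 hkr hq0 h hs.1
    refine h2.trans ?_
    rw [intervalIntegral.integral_const_mul, integral_exp_mul hr0.ne']
    have h3 : (Real.exp (r * t) - 1) / r ≤ Real.exp (r * t) / ε :=
      div_le_div₀ (Real.exp_pos _).le (by linarith) hε (by rw [hr]; linarith)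
    refine (mul_le_mul_of_nonneg_left h3 (by positivity)).trans (le_of_eq ?_)
    field_simp
  refine (norm_fiberSol_le ht h).trans ?_
  have e1 : Real.exp ((δ - 1 + ε) * t) = Real.exp (-t) * Real.exp (r * t) := by
    rw [← Real.exp_add, hr]; congr 1; ring
  have e2 : 1 ≤ Real.exp (r * t) := Real.one_le_exp (by positivity)
  rw [e1]
  have e3 : ‖h‖ ≤ ‖h‖ * Real.exp (r * t) := le_mul_of_one_le_right (norm_nonneg _) e2
  have e4 : (1 + 1 / (q * ε)) * (Real.exp (-t) * Real.exp (r * t)) * ‖h‖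
      = Real.exp (-t) * (‖h‖ * Real.exp (r * t) + ‖h‖ / (q * ε) * Real.exp (r * t)) := by
    ring
  rw [e4]
  exact mul_le_mul_of_nonneg_left (add_le_add e3 h1) (Real.exp_pos _).le

/-- The kernel `∫ w(v) exp(-i v ξ t) / (i v ξ + δ) dv`. -/
def resKernel (ξ δ t : ℝ) : ℂ := phaseMoment (ξ * t) (resOp ξ δ oneL)

theorem norm_phaseMoment_resOp_le {ξ δ x : ℝ} (hδ : 0 < δ) (h : L2w) :
    ‖phaseMoment x (resOp ξ δ h)‖ ≤ δ⁻¹ * ‖h‖ := by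
  refine (norm_phaseMoment_apply_le _ _).trans ((resOp ξ δ).le_of_opNorm_le ?_ h)
  have := norm_resOp_le (ξ := ξ) (z := (δ : ℂ)) (by simpa using hδ)
  simpa using this

theorem continuous_resKernel (ξ δ : ℝ) : Continuous (resKernel ξ δ) :=
  (continuous_phaseMoment.comp (continuous_const.mul continuous_id)).clm_apply continuous_const

theorem phaseMoment_resOp_eq (ξ δ x : ℝ) (h : L2w) :
    momentL (resOp ξ δ (mulOp (phase x) h)) = phaseMoment x (resOp ξ δ h) := by
  rw [phaseMoment_apply, resOp, mulOp_comm]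

theorem gauss_eq_phaseMoment (ξ t : ℝ) : (gauss ξ t : ℂ) = phaseMoment (ξ * t) oneL := by
  rw [phaseMoment_apply, momentL_phase_eq_gauss]

/-- The moment of the resolvent identity at `z` and `δ`, applied to `𝟙`, with `k̂(δ) = 1`. Division
by `z - δ` removes the root of `1 - k̂`. -/
theorem integral_exp_mul_resKernel {ξ δ : ℝ} (hδ : 0 < δ) (hk : kHat ξ δ = 1) {z : ℂ}
    (hz : 0 < z.re) (hne : z - δ ≠ 0) :
    ∫ t in Ioi (0 : ℝ), Complex.exp (-(z * t)) * resKernel ξ δ t = deflated ξ δ z := by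
  have hδ' : 0 < ((δ : ℝ) : ℂ).re := by simpa using hδ
  simp only [resKernel]
  rw [integral_exp_mul_phaseMoment ξ hz, deflated, eq_div_iff hne]
  have h1 := congrArg (fun T : L2w →L[ℂ] L2w => momentL (T oneL)) (resOp_sub (ξ := ξ) hz hδ')
  simp only [sub_apply, smul_apply, ContinuousLinearMap.comp_apply, map_sub, map_smul,
    smul_eq_mul, momentL_resOp_oneL hz, momentL_resOp_oneL hδ', hk] at h1
  linear_combination h1

theorem integral_exp_mul_gauss (ξ : ℝ) {z : ℂ} (hz : 0 < z.re) :
    ∫ t in Ioi (0 : ℝ), Complex.exp (-(z * t)) * (gauss ξ t : ℂ) = kHat ξ z := by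
  simp only [gauss_eq_phaseMoment]
  rw [integral_exp_mul_phaseMoment ξ hz, momentL_resOp_oneL hz]

/-- The spectral functional stays zero along the flow; evaluating it on Duhamel's formula gives a
Volterra equation of the first kind. -/
theorem density_resKernel {ξ : ℝ} (hξ : |ξ| < Real.sqrt Real.pi) {h : L2w}
    (hh : spectralL ξ h = 0) {t : ℝ} (ht : 0 ≤ t) :
    phaseMoment (ξ * t) (resOp ξ (del ξ) h)
      + ∫ s in (0 : ℝ)..t, resKernel ξ (del ξ) (t - s) * density ξ s h = 0 := by
  have h1 := spectralL_fiberSol hξ ht h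
  rw [hh, mul_zero, apply_fiberSol] at h1
  have h2 := (mul_eq_zero.1 h1).resolve_left
    (by exact_mod_cast (Real.exp_pos (-t)).ne')
  simp only [spectralL_apply, phaseMoment_resOp_eq] at h2
  rw [← h2]
  congr 1
  refine intervalIntegral.integral_congr fun s _ => ?_
  simp only [resKernel]
  rw [mul_comm]

/-- The weighted density satisfies a Volterra equation with a coercive kernel. -/
theorem weighted_density_eq {ξ : ℝ} (hξ : |ξ| < Real.sqrt Real.pi) {h : L2w}
    (hh : spectralL ξ h = 0) (c p : ℝ) {t : ℝ} (ht : 0 ≤ t) :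
    ((Real.exp (-(p * t)) : ℝ) : ℂ) * density ξ t h + ∫ s in (0 : ℝ)..t,
      (((Real.exp (-(p * (t - s))) : ℝ) : ℂ) *
        ((c + del ξ) * resKernel ξ (del ξ) (t - s) - gauss ξ (t - s))) *
        (((Real.exp (-(p * s)) : ℝ) : ℂ) * density ξ s h)
      = ((Real.exp (-(p * t)) : ℝ) : ℂ) * (phaseMoment (ξ * t) h
        - (c + del ξ) * phaseMoment (ξ * t) (resOp ξ (del ξ) h)) := by
  have h1 := density_eq (ξ := ξ) ht h
  have h2 := density_resKernel hξ hh ht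
  have i1 : IntervalIntegrable (fun s => resKernel ξ (del ξ) (t - s) * density ξ s h) volume 0 t :=
    Continuous.intervalIntegrable (((continuous_resKernel _ _).comp (by fun_prop)).mul
      (continuous_density_time ξ h)) _ _
  have hg : Continuous fun s => ((gauss ξ (t - s) : ℝ) : ℂ) := by unfold gauss; fun_prop
  have i2 : IntervalIntegrable (fun s => (gauss ξ (t - s) : ℂ) * density ξ s h) volume 0 t :=
    Continuous.intervalIntegrable (hg.mul (continuous_density_time ξ h)) _ _
  have e : ∫ s in (0 : ℝ)..t, (((Real.exp (-(p * (t - s))) : ℝ) : ℂ) *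
        ((c + del ξ) * resKernel ξ (del ξ) (t - s) - gauss ξ (t - s))) *
        (((Real.exp (-(p * s)) : ℝ) : ℂ) * density ξ s h)
      = ((Real.exp (-(p * t)) : ℝ) : ℂ) *
        ((c + del ξ) * (∫ s in (0 : ℝ)..t, resKernel ξ (del ξ) (t - s) * density ξ s h)
          - ∫ s in (0 : ℝ)..t, (gauss ξ (t - s) : ℂ) * density ξ s h) := by
    rw [← intervalIntegral.integral_const_mul, ← intervalIntegral.integral_sub (i1.const_mul _) i2,
      ← intervalIntegral.integral_const_mul]
    refine intervalIntegral.integral_congr fun s _ => ?_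
    have : Real.exp (-(p * t)) = Real.exp (-(p * (t - s))) * Real.exp (-(p * s)) := by
      rw [← Real.exp_add]; congr 1; ring
    rw [this]
    push_cast
    ring
  rw [e, h1]
  -- The original equation plus `c + δ` times the first kind one, both weighted by `exp(-p t)`.
  linear_combination ((Real.exp (-(p * t)) : ℝ) : ℂ) * (c + del ξ) * h2

theorem norm_weighted_forcing_le {ξ δ₀ : ℝ} (hξ : |ξ| < Real.sqrt Real.pi) (hδ₀ : 0 < δ₀)
    (hδ : δ₀ ≤ del ξ) {c : ℝ} (hc : 0 < c) (p t : ℝ) (h : L2w) :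
    ‖((Real.exp (-(p * t)) : ℝ) : ℂ) * (phaseMoment (ξ * t) h
        - (c + del ξ) * phaseMoment (ξ * t) (resOp ξ (del ξ) h))‖
      ≤ Real.exp (-(p * t)) * ((2 + c / δ₀) * ‖h‖) := by
  rw [norm_mul, Complex.norm_real, Real.norm_of_nonneg (Real.exp_pos _).le]
  refine mul_le_mul_of_nonneg_left ?_ (Real.exp_pos _).le
  have hd := del_pos hξ
  have e : (c : ℂ) + ((del ξ : ℝ) : ℂ) = ((c + del ξ : ℝ) : ℂ) := by push_cast; rfl
  refine (norm_sub_le _ _).trans ?_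
  rw [norm_mul, e, Complex.norm_real, Real.norm_of_nonneg (by positivity)]
  have h1 := norm_phaseMoment_apply_le (ξ * t) h
  have h2 := norm_phaseMoment_resOp_le (ξ := ξ) (x := ξ * t) hd h
  have h3 : (c + del ξ) * ‖phaseMoment (ξ * t) (resOp ξ (del ξ) h)‖
      ≤ (c + del ξ) * ((del ξ)⁻¹ * ‖h‖) := mul_le_mul_of_nonneg_left h2 (by positivity)
  have h4 : (c + del ξ) * ((del ξ)⁻¹ * ‖h‖) = (c / del ξ + 1) * ‖h‖ := by
    field_simp
  have h5 : c / del ξ ≤ c / δ₀ := div_le_div_of_nonneg_left hc.le hδ₀ hδ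
  have h6 := mul_le_mul_of_nonneg_right h5 (norm_nonneg h)
  nlinarith

/-- Coercivity bounds half the square integral by the pairing with the forcing, and Young's
inequality absorbs half of that. The remaining `∫ b² exp(-2pt) ≤ b²/(2p)`, times `4`, is the stated
bound. -/
theorem integral_sq_weighted_density_le {p δ₀ c : ℝ} (hp : 0 < p) (hpδ : p < δ₀) (hc : 0 < c)
    (hcoer : ∀ ξ δ : ℝ, |ξ| ≤ 2 → δ₀ ≤ δ → δ ≤ 1 → kHat ξ δ = 1 → ∀ β : ℝ,
      1 / 2 ≤ (((p + Complex.I * β) + c) * deflated ξ δ (p + Complex.I * β)).re)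
    {ξ : ℝ} (hξ : |ξ| < Real.sqrt Real.pi) (hδ : δ₀ ≤ del ξ) {h : L2w} (hh : spectralL ξ h = 0)
    {T : ℝ} (hT : 0 ≤ T) :
    ∫ t in (0 : ℝ)..T, (Real.exp (-(p * t)) * ‖density ξ t h‖) ^ 2
      ≤ 2 * ((2 + c / δ₀) * ‖h‖) ^ 2 / p := by
  have hδ₀ : 0 < δ₀ := hp.trans hpδ
  set b := (2 + c / δ₀) * ‖h‖ with hb
  set ρ : ℝ → ℂ := fun t => ((Real.exp (-(p * t)) : ℝ) : ℂ) * density ξ t h with hρ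
  have hρc : Continuous ρ := Continuous.mul (by fun_prop) (continuous_density_time ξ h)
  have hρn : ∀ t, ‖ρ t‖ = Real.exp (-(p * t)) * ‖density ξ t h‖ := by
    intro t
    rw [hρ, norm_mul, Complex.norm_real, Real.norm_of_nonneg (Real.exp_pos _).le]
  set j : ℝ → ℂ := fun t => ((Real.exp (-(p * t)) : ℝ) : ℂ) *
    ((c + del ξ) * resKernel ξ (del ξ) t - gauss ξ t) with hj
  have hgc : Continuous fun s => ((gauss ξ s : ℝ) : ℂ) := by unfold gauss; fun_prop
  have hexpI : ∀ f : ℝ → ℂ, Continuous f → (∃ B, ∀ t, ‖f t‖ ≤ B) → ∀ z : ℂ, 0 < z.re →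
      IntegrableOn (fun t : ℝ => Complex.exp (-(z * t)) * f t) (Ioi 0) := by
    rintro f hf ⟨B, hB⟩ z hz
    exact (integrableOn_cexp_neg_mul hz).mul_bdd (c := B) hf.aestronglyMeasurable
      (Eventually.of_forall hB)
  have hKb : ∃ B, ∀ t, ‖resKernel ξ (del ξ) t‖ ≤ B := ⟨_, fun t =>
    norm_phaseMoment_resOp_le (del_pos hξ) oneL⟩
  have hgb : ∃ B, ∀ t, ‖((gauss ξ t : ℝ) : ℂ)‖ ≤ B := ⟨1, fun t => by
    rw [Complex.norm_real]; exact abs_gauss_le ξ t⟩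
  have hjI : IntegrableOn j (Ioi 0) := by
    have h1 := (hexpI _ (continuous_resKernel ξ (del ξ)) hKb p (by simpa using hp)).const_mul
      ((c : ℂ) + del ξ)
    have h2 := hexpI _ hgc hgb p (by simpa using hp)
    refine (h1.sub h2).congr (Eventually.of_forall fun t => ?_)
    simp only [hj, Pi.sub_apply]
    push_cast
    ring
  have hsym : ∀ x : ℝ, 1 / 2 ≤ (1 + ∫ s in Ioi (0 : ℝ),
      j s * Complex.exp (-(Complex.I * x * s))).re := by
    intro x
    set z : ℂ := p + Complex.I * x with hz
    have hzre : 0 < z.re := by simpa [hz] using hp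
    have hne : z - del ξ ≠ 0 := by
      intro h0
      have := congrArg Complex.re h0
      simp [hz] at this
      linarith
    have e1 : ∀ s : ℝ, j s * Complex.exp (-(Complex.I * x * s))
        = ((c : ℂ) + del ξ) * (Complex.exp (-(z * s)) * resKernel ξ (del ξ) s)
          - Complex.exp (-(z * s)) * (gauss ξ s : ℂ) := by
      intro s
      have : Complex.exp (-(z * s)) = ((Real.exp (-(p * s)) : ℝ) : ℂ)
          * Complex.exp (-(Complex.I * x * s)) := by
        rw [Complex.ofReal_exp, ← Complex.exp_add, hz]
        congr 1; push_cast; ring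
      rw [this]
      simp only [hj]
      ring
    simp only [e1]
    rw [integral_sub ((hexpI _ (continuous_resKernel ξ (del ξ)) hKb z hzre).const_mul _)
      (hexpI _ hgc hgb z hzre), integral_const_mul,
      integral_exp_mul_resKernel (del_pos hξ) (kHat_del hξ) hzre hne,
      integral_exp_mul_gauss ξ hzre]
    -- Since `1 - k̂ = (z - δ) · deflated`, the full symbol factors.
    have e2 : 1 + (((c : ℂ) + del ξ) * deflated ξ (del ξ) z - kHat ξ z)
        = (z + c) * deflated ξ (del ξ) z := by
      have : deflated ξ (del ξ) z * (z - del ξ) = 1 - kHat ξ z := div_mul_cancel₀ _ hne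
      linear_combination -this
    rw [e2]
    refine hcoer ξ (del ξ) (hξ.le.trans ?_) hδ (del_le_one hξ) (kHat_del hξ) x
    rw [Real.sqrt_le_left (by norm_num)]
    linarith [Real.pi_lt_four]
  have key := coercive_volterra hT hρc hjI hsym
  have hN : ∀ t ∈ Icc 0 T, ρ t + ∫ s in (0 : ℝ)..t, j (t - s) * ρ s
      = ((Real.exp (-(p * t)) : ℝ) : ℂ) * (phaseMoment (ξ * t) h
        - (c + del ξ) * phaseMoment (ξ * t) (resOp ξ (del ξ) h)) := fun t ht =>
    weighted_density_eq hξ hh c p ht.1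
  have hbd : (∫ t in (0 : ℝ)..T, (starRingEnd ℂ) (ρ t) *
        (ρ t + ∫ s in (0 : ℝ)..t, j (t - s) * ρ s)).re
      ≤ ∫ t in (0 : ℝ)..T, (1 / 4 * ‖ρ t‖ ^ 2 + b ^ 2 * Real.exp (-(2 * p) * t)) := by
    refine (Complex.re_le_norm _).trans (intervalIntegral.norm_integral_le_of_norm_le hT
      (Eventually.of_forall fun t ht => ?_) (Continuous.intervalIntegrable (by fun_prop) _ _))
    rw [hN t (Ioc_subset_Icc_self ht), norm_mul, RCLike.norm_conj]
    have h1 := norm_weighted_forcing_le hξ hδ₀ hδ hc p t h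
    rw [← hb] at h1
    have h2 : Real.exp (-(2 * p) * t) = Real.exp (-(p * t)) ^ 2 := by
      rw [← Real.exp_nat_mul]; congr 1; push_cast; ring
    rw [h2]
    have h3 := mul_le_mul_of_nonneg_left h1 (norm_nonneg (ρ t))
    nlinarith [sq_nonneg (1 / 2 * ‖ρ t‖ - Real.exp (-(p * t)) * b)]
  rw [intervalIntegral.integral_add (Continuous.intervalIntegrable (by fun_prop) _ _)
    (Continuous.intervalIntegrable (by fun_prop) _ _), intervalIntegral.integral_const_mul,
    intervalIntegral.integral_const_mul, integral_exp_mul (by linarith)] at hbd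
  have h4 : (Real.exp (-(2 * p) * T) - 1) / (-(2 * p)) ≤ 1 / (2 * p) := by
    rw [div_neg, ← neg_div]
    refine div_le_div_of_nonneg_right ?_ (by positivity)
    have := Real.exp_pos (-(2 * p) * T)
    linarith
  have h5 := mul_le_mul_of_nonneg_left h4 (sq_nonneg b)
  simp only [← hρn]
  have h6 : b ^ 2 * (1 / (2 * p)) = (2 * b ^ 2 / p) / 4 := by field_simp; norm_num
  linarith

theorem exists_fiberSol_decay_of_spectralL_eq_zero {p δ₀ : ℝ} (hp : 0 < p) (hpδ : p < δ₀) :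
    ∃ C : ℝ, 0 < C ∧ ∀ ξ : ℝ, |ξ| < Real.sqrt Real.pi → δ₀ ≤ del ξ → ∀ h : L2w,
      spectralL ξ h = 0 → ∀ t : ℝ, 0 ≤ t →
        ‖fiberSol ξ t h‖ ≤ C * Real.exp ((p - 1) * t) * ‖h‖ := by
  obtain ⟨c, hc, hcoer⟩ := exists_coercive_symbol hp hpδ
  have hδ₀ : 0 < δ₀ := hp.trans hpδ
  refine ⟨1 + 5 / (4 * p) * (2 + c / δ₀), by positivity, fun ξ hξ hδ h hh t ht => ?_⟩
  rcases eq_or_ne h 0 with rfl | hne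
  · rw [fiberSol_eq]; simp
  set b := (2 + c / δ₀) * ‖h‖ with hb
  have hh0 : 0 < ‖h‖ := norm_pos_iff.2 hne
  have hb0 : 0 < b := by positivity
  have h1 := integral_sq_weighted_density_le hp hpδ hc hcoer hξ hδ hh ht
  rw [← hb] at h1
  have hdc := continuous_density_time ξ h
  have h2 : ∫ s in (0 : ℝ)..t, ‖density ξ s h‖ ≤ 5 / (4 * p) * b * Real.exp (p * t) := by
    -- Young's inequality for `exp(p s) · r`, with weights that make both integrals of order `b
    -- exp(p t) / p`: they contribute `1/4` and `1`, hence `5/(4p)`.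
    have h3 : ∫ s in (0 : ℝ)..t, ‖density ξ s h‖ ≤ ∫ s in (0 : ℝ)..t,
        (b * Real.exp (-(p * t)) / 2 * Real.exp (2 * p * s)
          + Real.exp (p * t) / (2 * b) * (Real.exp (-(p * s)) * ‖density ξ s h‖) ^ 2) := by
      refine intervalIntegral.integral_mono_on ht (hdc.norm.intervalIntegrable _ _)
        (Continuous.intervalIntegrable (by fun_prop) _ _) fun s _ => ?_
      set r := Real.exp (-(p * s)) * ‖density ξ s h‖ with hr
      have e1 : ‖density ξ s h‖ = Real.exp (p * s) * r := by
        rw [hr, ← mul_assoc, ← Real.exp_add, add_neg_cancel, Real.exp_zero, one_mul]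
      have e2 : Real.exp (2 * p * s) = Real.exp (p * s) ^ 2 := by
        rw [← Real.exp_nat_mul]; congr 1; push_cast; ring
      have e3 : Real.exp (-(p * t)) = (Real.exp (p * t))⁻¹ := Real.exp_neg _
      rw [e1, e2, e3]
      set X := Real.exp (p * s)
      set Y := Real.exp (p * t) with hY
      have hY0 : 0 < Y := Real.exp_pos _
      have : b * Y⁻¹ / 2 * X ^ 2 + Y / (2 * b) * r ^ 2 - X * r
          = (b * X - Y * r) ^ 2 / (2 * b * Y) := by
        field_simp
        ring
      have : 0 ≤ (b * X - Y * r) ^ 2 / (2 * b * Y) := by positivity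
      linarith
    refine h3.trans ?_
    rw [intervalIntegral.integral_add (Continuous.intervalIntegrable (by fun_prop) _ _)
      (Continuous.intervalIntegrable (by fun_prop) _ _), intervalIntegral.integral_const_mul,
      intervalIntegral.integral_const_mul, integral_exp_mul (by positivity)]
    have e2 : Real.exp (2 * p * t) = Real.exp (p * t) ^ 2 := by
      rw [← Real.exp_nat_mul]; congr 1; push_cast; ring
    have e3 : Real.exp (-(p * t)) = (Real.exp (p * t))⁻¹ := Real.exp_neg _
    rw [e2, e3]
    set Y := Real.exp (p * t) with hY
    have hY0 : 0 < Y := Real.exp_pos _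
    have h4 : b * Y⁻¹ / 2 * ((Y ^ 2 - 1) / (2 * p)) ≤ b * Y / (4 * p) := by
      have : b * Y⁻¹ / 2 * ((Y ^ 2 - 1) / (2 * p)) = b * Y / (4 * p) - b * Y⁻¹ / (4 * p) := by
        field_simp
        ring
      have : 0 ≤ b * Y⁻¹ / (4 * p) := by positivity
      linarith
    have h5 := mul_le_mul_of_nonneg_left h1 (show 0 ≤ Y / (2 * b) by positivity)
    have h6 : Y / (2 * b) * (2 * b ^ 2 / p) = b * Y / p := by field_simp
    have h7 : b * Y / (4 * p) + b * Y / p = 5 / (4 * p) * b * Y := by field_simp; ring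
    linarith
  refine (norm_fiberSol_le ht h).trans ?_
  have e1 : Real.exp ((p - 1) * t) = Real.exp (-t) * Real.exp (p * t) := by
    rw [← Real.exp_add]; congr 1; ring
  have e2 : 1 ≤ Real.exp (p * t) := Real.one_le_exp (by positivity)
  have e3 : ‖h‖ ≤ ‖h‖ * Real.exp (p * t) := le_mul_of_one_le_right (norm_nonneg _) e2
  rw [e1]
  have e4 : (1 + 5 / (4 * p) * (2 + c / δ₀)) * (Real.exp (-t) * Real.exp (p * t)) * ‖h‖
      = Real.exp (-t) * (‖h‖ * Real.exp (p * t) + 5 / (4 * p) * b * Real.exp (p * t)) := by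
    rw [hb]; ring
  rw [e4]
  exact mul_le_mul_of_nonneg_left (add_le_add e3 h2) (Real.exp_pos _).le

/-- The decay estimate used for the remainder `f - g`, at a fixed frequency. -/
theorem exists_remainder_decay {ε : ℝ} (hε : 0 < ε) : ∃ C : ℝ, 0 < C ∧
    ∀ ξ₀ : ℝ, 0 < ξ₀ → ξ₀ < Real.sqrt Real.pi → ∀ (ξ : ℝ) (h : L2w),
      (|ξ| ≤ ξ₀ → spectralL ξ h = 0) → ∀ t : ℝ, 0 ≤ t →
        ‖fiberSol ξ t h‖ ≤ C * Real.exp ((lamStar ξ₀ + ε) * t) * ‖h‖ := by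
  -- Three regimes. Beyond `ξ₀`, compare with the eigenvalue at `ξ₀`. Inside, if `δ(ξ) < ε/2`, the
  -- unprojected rate `δ - 1 + ε/2` is already below `-1 + ε < λ*(ξ₀) + ε`. Otherwise `δ(ξ) ≥ ε/2`,
  -- and deflation on the line `p = ε/4` applies. None of the constants involves `ξ₀`.
  obtain ⟨C₁, hC₁, H₁⟩ := exists_fiberSol_decay hε
  obtain ⟨C₂, hC₂, H₂⟩ := exists_fiberSol_decay (half_pos hε)
  obtain ⟨C₃, hC₃, H₃⟩ := exists_fiberSol_decay_of_spectralL_eq_zero (p := ε / 4) (δ₀ := ε / 2)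
    (by linarith) (by linarith)
  refine ⟨C₁ + C₂ + C₃, by positivity, fun ξ₀ h0 hπ ξ h hh t ht => ?_⟩
  have hπ' : |ξ₀| < Real.sqrt Real.pi := by rwa [abs_of_pos h0]
  have hl : lamStar ξ₀ = del ξ₀ - 1 := by rw [del]; ring
  have hd0 := del_pos hπ'
  have step : ∀ (C r : ℝ), 0 < C → C ≤ C₁ + C₂ + C₃ → r ≤ lamStar ξ₀ + ε →
      ‖fiberSol ξ t h‖ ≤ C * Real.exp (r * t) * ‖h‖ →
      ‖fiberSol ξ t h‖ ≤ (C₁ + C₂ + C₃) * Real.exp ((lamStar ξ₀ + ε) * t) * ‖h‖ := by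
    intro C r hC hCC hr H
    refine H.trans (mul_le_mul_of_nonneg_right ?_ (norm_nonneg _))
    exact mul_le_mul hCC (Real.exp_le_exp.2 (mul_le_mul_of_nonneg_right hr ht))
      (Real.exp_pos _).le (hC.le.trans hCC)
  by_cases hξ : |ξ| ≤ ξ₀
  · have hξπ : |ξ| < Real.sqrt Real.pi := hξ.trans_lt hπ
    by_cases hd : ε / 2 ≤ del ξ
    · exact step C₃ _ hC₃ (by linarith) (by linarith) (H₃ ξ hξπ hd h (hh hξ) t ht)
    · push Not at hd
      exact step C₂ _ hC₂ (by linarith) (by linarith)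
        (H₂ ξ ξ (del ξ) le_rfl (del_pos hξπ) (kr_del hξπ) h t ht)
  · push Not at hξ
    exact step C₁ _ hC₁ (by linarith) (by linarith)
      (H₁ ξ ξ₀ (del ξ₀) (by rw [abs_of_pos h0]; exact hξ.le) hd0 (kr_del hπ') h t ht)

/-! ### The resolvent and the Riesz projection -/

/-- The moment of a solution obeys a scalar equation with coefficient `1 - k̂(1 + z)`. When this is
nonzero the solution exists and is unique, which pins down the value of `Classical.epsilon`. -/
theorem resolventL_eq {ξ : ℝ} {z : ℂ} (hz : 0 < (1 + z).re) (hk : kHat ξ (1 + z) ≠ 1) (g : L2w) :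
    resolventL ξ z g = resOp ξ (1 + z)
      ((-(momentL (resOp ξ (1 + z) g) / (1 - kHat ξ (1 + z)))) • oneL - g) := by
  have hk' : 1 - kHat ξ (1 + z) ≠ 0 := sub_ne_zero.2 hk.symm
  set μ := -(momentL (resOp ξ (1 + z) g) / (1 - kHat ξ (1 + z))) with hμ
  have huniq : ∀ u, IsL_xi ξ u (g + z • u) → u = resOp ξ (1 + z) (μ • oneL - g) := by
    intro u hu
    have h1 := (isL_xi_iff_resOp hz u g).1 hu
    have h2 := congrArg momentL h1
    rw [map_sub, map_sub, map_smul, map_smul, momentL_resOp_oneL hz, smul_eq_mul] at h2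
    have h3 : momentL u = μ := by
      rw [hμ, ← neg_div, eq_div_iff hk']
      linear_combination h2
    rw [← h3]; exact h1
  have hex : IsL_xi ξ (resOp ξ (1 + z) (μ • oneL - g))
      (g + z • resOp ξ (1 + z) (μ • oneL - g)) := by
    rw [isL_xi_iff_resOp hz]
    congr 3
    rw [map_sub, map_sub, map_smul, map_smul, momentL_resOp_oneL hz, smul_eq_mul, hμ]
    field_simp
    ring
  exact huniq _ (Classical.epsilon_spec (p := fun u => IsL_xi ξ u (g + z • u)) ⟨_, hex⟩)

theorem kHat1_eq (ξ : ℝ) {z : ℂ} (hz : 0 < z.re) :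
    kHat1 ξ z = momentL (resOp ξ z (resOp ξ z oneL)) := by
  have h1 : HasDerivAt (fun y => momentL (resOp ξ y oneL))
      (momentL ((-(resOp ξ z ∘L resOp ξ z)) oneL)) z := by
    have := (hasDerivAt_resOp (ξ := ξ) hz).clm_apply (hasDerivAt_const z oneL)
    simp only [map_zero, add_zero] at this
    exact momentL.hasFDerivAt.comp_hasDerivAt z this
  have h2 : HasDerivAt (fun y => momentL (resOp ξ y oneL)) (-kHat1 ξ z) z := by
    refine (hasDerivAt_kHat ξ hz).congr_of_eventuallyEq ?_
    filter_upwards [Complex.continuous_re.continuousAt.eventually (lt_mem_nhds hz)] with y hy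
    exact momentL_resOp_oneL hy
  have h3 := h1.unique h2
  rw [neg_apply, map_neg, neg_inj] at h3
  exact h3.symm

theorem kHat1_ofReal (ξ : ℝ) (x : ℝ) :
    kHat1 ξ x = ((∫ t in Ioi (0 : ℝ), t * gr ξ x t : ℝ) : ℂ) := by
  rw [kHat1]
  simp only [gk_ofReal, ← Complex.ofReal_mul]
  exact integral_ofReal

/-- Pointwise comparison of integrands, using `|ξ| < √π < 2` and `δ ≤ 1`. The bound controls the
denominator of the Riesz projection. -/
theorem exists_norm_kHat1_ge : ∃ κ : ℝ, 0 < κ ∧ ∀ ξ : ℝ, |ξ| < Real.sqrt Real.pi →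
    κ ≤ ‖kHat1 ξ (del ξ)‖ := by
  refine ⟨∫ t in Ioi (0 : ℝ), t * gr 2 1 t, ?_, fun ξ hξ => ?_⟩
  · exact setIntegral_Ioi_pos one_pos (integrableOn_mul_gr 2 one_pos)
      (fun t ht => (mul_pos ht (gr_pos _ _ _)).le) (fun t ht _ => mul_pos ht (gr_pos _ _ _))
  · rw [kHat1_ofReal, Complex.norm_real]
    refine le_trans ?_ (le_abs_self _)
    refine setIntegral_mono_on (integrableOn_mul_gr 2 one_pos)
      (integrableOn_mul_gr ξ (del_pos hξ)) measurableSet_Ioi fun t ht => ?_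
    have ht0 : (0 : ℝ) < t := ht
    refine mul_le_mul_of_nonneg_left ?_ ht0.le
    have hξ2 : |ξ| ≤ |(2 : ℝ)| := by
      rw [abs_of_pos (show (0 : ℝ) < 2 by norm_num)]
      refine hξ.le.trans ?_
      rw [Real.sqrt_le_left (by norm_num)]
      linarith [Real.pi_lt_four]
    refine (gr_le_gr hξ2 1 t).trans ?_
    rw [gr, gr, Real.exp_le_exp]
    have := del_le_one hξ
    nlinarith

theorem kHat1_del_ne_zero {ξ : ℝ} (hξ : |ξ| < Real.sqrt Real.pi) : kHat1 ξ (del ξ) ≠ 0 := by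
  obtain ⟨κ, h0, h1⟩ := exists_norm_kHat1_ge
  exact norm_pos_iff.1 (h0.trans_le (h1 ξ hξ))

/-- The Riesz projection is the rank one spectral projection. -/
theorem rieszProj_eq {ξ : ℝ} (hξ : |ξ| < Real.sqrt Real.pi) (h : L2w) :
    rieszProj ξ h = (spectralL ξ h / kHat1 ξ (del ξ)) • eigvec ξ := by
  set c : ℂ := ((lamStar ξ : ℝ) : ℂ) with hc
  have hd := del_pos hξ
  have hcd : 1 + c = ((del ξ : ℝ) : ℂ) := one_add_lamStar ξ
  set R := (1 + lamStar ξ) / 2 with hR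
  have hRd : R = del ξ / 2 := rfl
  have hR0 : 0 < R := by rw [hRd]; positivity
  set V : Set ℂ := {z | 0 < (1 + z).re} with hV
  have hVo : IsOpen V := isOpen_lt continuous_const (by fun_prop)
  have hcV : c ∈ V := by
    change 0 < (1 + c).re
    rw [hcd]
    exact del_re_pos hξ
  have hball : Metric.closedBall c R ⊆ V := by
    intro z hz
    rw [Metric.mem_closedBall, dist_eq_norm] at hz
    have h1 := (neg_le_abs _).trans ((Complex.abs_re_le_norm _).trans hz)
    have h2 : (1 + z).re = del ξ + (z - c).re := by
      rw [del, hc]; simp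
    change 0 < (1 + z).re
    rw [h2]
    linarith
  set φ : ℂ → ℂ := fun z => 1 - kHat ξ (1 + z) with hφ
  have hφd : ∀ z ∈ V, HasDerivAt φ (kHat1 ξ (1 + z)) z := by
    intro z hz
    have h1 : HasDerivAt (fun z : ℂ => 1 + z) 1 z := (hasDerivAt_id z).const_add 1
    have h2 := ((hasDerivAt_kHat ξ hz).comp z h1).const_sub 1
    refine h2.congr_deriv ?_
    ring
  have hφc : φ c = 0 := by simp only [hφ]; rw [hcd, kHat_del hξ, sub_self]
  have hφne : ∀ z ∈ V, z ≠ c → φ z ≠ 0 := by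
    intro z hz hzc h0
    have h1 := kHat_eq_one_imp hξ hz (sub_eq_zero.1 h0).symm
    rw [← hcd] at h1
    exact hzc (add_left_cancel h1)
  -- The divided difference of `1 - k̂(1 + z)` at its zero. It has no zeros in the half-plane
  -- because that zero is unique and simple.
  set D : ℂ → ℂ := dslope φ c with hD
  have hDd : DifferentiableOn ℂ D V :=
    (Complex.differentiableOn_dslope (hVo.mem_nhds hcV)).2
      fun z hz => (hφd z hz).differentiableAt.differentiableWithinAt
  have hDc : D c = kHat1 ξ (del ξ) := by
    rw [hD, dslope_same, (hφd c hcV).deriv, hcd]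
  have hDne : ∀ z ∈ V, D z ≠ 0 := by
    intro z hz
    rcases eq_or_ne z c with rfl | hzc
    · rw [hDc]; exact kHat1_del_ne_zero hξ
    · rw [hD, dslope_of_ne _ hzc, slope_def_field, hφc, sub_zero]
      exact div_ne_zero (hφne z hz hzc) (sub_ne_zero.2 hzc)
  -- The resolvent applied to `h`, multiplied by `z - c`, with the singularity at `c` removed;
  -- Cauchy's formula then evaluates it at the center.
  set F : ℂ → L2w := fun z => resOp ξ (1 + z)
    ((-(momentL (resOp ξ (1 + z) h) / D z)) • oneL - (z - c) • h) with hF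
  have hFd : ∀ z ∈ V, DifferentiableAt ℂ F z := by
    intro z hz
    have h1 : DifferentiableAt ℂ (fun z => resOp ξ (1 + z)) z :=
      ((hasDerivAt_resOp hz).differentiableAt).comp z (by fun_prop)
    have h2 : DifferentiableAt ℂ (fun z => momentL (resOp ξ (1 + z) h)) z :=
      momentL.differentiableAt.comp z (h1.clm_apply (differentiableAt_const h))
    have h3 : DifferentiableAt ℂ D z := hDd.differentiableAt (hVo.mem_nhds hz)
    exact h1.clm_apply ((((h2.div h3 (hDne z hz)).neg).smul_const oneL).sub
      ((by fun_prop : DifferentiableAt ℂ (fun z => z - c) z).smul_const h))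
  have hcauchy := Complex.circleIntegral_sub_inv_smul_of_differentiable_on_off_countable
    (s := ∅) (f := F) (R := R) (c := c) (w := c) countable_empty (Metric.mem_ball_self hR0)
    (fun z hz => (hFd z (hball hz)).continuousAt.continuousWithinAt)
    (fun z hz => hFd z (hball (Metric.ball_subset_closedBall hz.1)))
  have hcongr : (∮ z in C(c, R), resolventL ξ z h) = ∮ z in C(c, R), (z - c)⁻¹ • F z := by
    refine circleIntegral.integral_congr hR0.le fun z hz => ?_
    have hzc : z ≠ c := by
      rintro rfl
      rw [Metric.mem_sphere, dist_self] at hz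
      exact hR0.ne hz
    have hzV : z ∈ V := hball (Metric.sphere_subset_closedBall hz)
    have hzc' : z - c ≠ 0 := sub_ne_zero.2 hzc
    have hp := hφne z hzV hzc
    have hk : kHat ξ (1 + z) ≠ 1 := fun h0 => hp (by simp only [hφ]; rw [h0, sub_self])
    rw [resolventL_eq hzV hk, hF, ← map_smul]
    congr 1
    rw [smul_sub, smul_smul, smul_smul, inv_mul_cancel₀ hzc', one_smul]
    congr 2
    rw [hD, dslope_of_ne _ hzc, slope_def_field, hφc, sub_zero]
    have : φ z = 1 - kHat ξ (1 + z) := rfl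
    rw [← this]
    field_simp
  have hpi : (2 * Real.pi * Complex.I : ℂ) ≠ 0 := Complex.two_pi_I_ne_zero
  rw [rieszProj, hcongr, hcauchy, smul_smul, inv_mul_cancel₀ hpi, one_smul, hF]
  simp only [sub_self, zero_smul, sub_zero]
  rw [hDc, hcd, map_smul, neg_smul, neg_neg, spectralL_apply, eigvec]

/-! ### The truncated projection -/

theorem abs_lt_of_mem {ξ₀ ξ : ℝ} (hπ : ξ₀ < Real.sqrt Real.pi) (hξ : ξ ∈ Icc (-ξ₀) ξ₀) :
    |ξ| < Real.sqrt Real.pi := (abs_le.2 hξ).trans_lt hπ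

theorem truncProj_of_mem {ξ₀ ξ : ℝ} (hπ : ξ₀ < Real.sqrt Real.pi) (hξ : ξ ∈ Icc (-ξ₀) ξ₀)
    (h : L2w) : truncProj ξ₀ ξ h = (spectralL ξ h / kHat1 ξ (del ξ)) • eigvec ξ := by
  rw [truncProj, if_pos hξ, rieszProj_eq (abs_lt_of_mem hπ hξ)]

theorem truncProj_of_notMem {ξ₀ ξ : ℝ} (hξ : ξ ∉ Icc (-ξ₀) ξ₀) (h : L2w) :
    truncProj ξ₀ ξ h = 0 := by rw [truncProj, if_neg hξ]

theorem spectralL_eigvec {ξ : ℝ} (hξ : |ξ| < Real.sqrt Real.pi) :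
    spectralL ξ (eigvec ξ) = kHat1 ξ (del ξ) := by
  rw [kHat1_eq ξ (del_re_pos hξ), spectralL_apply, eigvec]

theorem spectralL_sub_truncProj {ξ₀ ξ : ℝ} (hπ : ξ₀ < Real.sqrt Real.pi) (hξ : ξ ∈ Icc (-ξ₀) ξ₀)
    (h : L2w) : spectralL ξ (h - truncProj ξ₀ ξ h) = 0 := by
  have hξ' := abs_lt_of_mem hπ hξ
  rw [truncProj_of_mem hπ hξ, map_sub, map_smul, spectralL_eigvec hξ', smul_eq_mul,
    div_mul_cancel₀ _ (kHat1_del_ne_zero hξ'), sub_self]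

/-- On `[-ξ₀, ξ₀]` both the spectral functional and the eigenvector pick up the same factor `exp(λ*
t)`, so projection and flow commute. -/
theorem fiberSol_truncProj {ξ₀ ξ : ℝ} (hπ : ξ₀ < Real.sqrt Real.pi) (h : L2w) {t : ℝ}
    (ht : 0 ≤ t) : fiberSol ξ t (truncProj ξ₀ ξ h) = truncProj ξ₀ ξ (fiberSol ξ t h) := by
  by_cases hξ : ξ ∈ Icc (-ξ₀) ξ₀
  · have hξ' := abs_lt_of_mem hπ hξ
    rw [truncProj_of_mem hπ hξ, truncProj_of_mem hπ hξ, fiberSol_smul_eigvec hξ' _ ht,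
      spectralL_fiberSol hξ' ht, smul_smul, mul_div_assoc]
  · rw [truncProj_of_notMem hξ, truncProj_of_notMem hξ, fiberSol_eq]
    simp

theorem fiberSol_sub (ξ t : ℝ) (h h' : L2w) :
    fiberSol ξ t (h - h') = fiberSol ξ t h - fiberSol ξ t h' := by
  simp only [fiberSol_eq]
  rw [← smul_sub, add_sub_add_comm, ← map_sub,
    ← intervalIntegral.integral_sub (intervalIntegrable_duhamel ξ t h)
      (intervalIntegrable_duhamel ξ t h')]
  simp only [map_sub, sub_smul]

theorem norm_spectralL_le {ξ : ℝ} (hξ : |ξ| < Real.sqrt Real.pi) (h : L2w) :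
    ‖spectralL ξ h‖ ≤ (del ξ)⁻¹ * ‖h‖ := by
  rw [spectralL_apply]
  refine (norm_momentL_apply_le _).trans ((resOp ξ (del ξ)).le_of_opNorm_le ?_ h)
  simpa using norm_resOp_le (ξ := ξ) (del_re_pos hξ)

theorem norm_eigvec_le {ξ : ℝ} (hξ : |ξ| < Real.sqrt Real.pi) : ‖eigvec ξ‖ ≤ (del ξ)⁻¹ := by
  have := (resOp ξ (del ξ)).le_of_opNorm_le (norm_resOp_le (ξ := ξ) (del_re_pos hξ)) oneL
  simpa [norm_oneL, eigvec] using this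

/-- The bound `δ(ξ₀)⁻² / κ` comes from the functional, the eigenvector and the normalization. This
is why `C₂` is allowed to depend on `ξ₀`. -/
theorem exists_norm_truncProj_le {ξ₀ : ℝ} (h0 : 0 < ξ₀) (hπ : ξ₀ < Real.sqrt Real.pi) :
    ∃ C : ℝ, 0 < C ∧ ∀ (ξ : ℝ) (h : L2w), ‖truncProj ξ₀ ξ h‖ ≤ C * ‖h‖ := by
  obtain ⟨κ, hκ0, hκ⟩ := exists_norm_kHat1_ge
  have hπ' : |ξ₀| < Real.sqrt Real.pi := by rwa [abs_of_pos h0]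
  have hd := del_pos hπ'
  refine ⟨(del ξ₀)⁻¹ * (del ξ₀)⁻¹ / κ, by positivity, fun ξ h => ?_⟩
  by_cases hξ : ξ ∈ Icc (-ξ₀) ξ₀
  · have hξ' := abs_lt_of_mem hπ hξ
    have hdd : (del ξ)⁻¹ ≤ (del ξ₀)⁻¹ := inv_anti₀ hd
      (del_anti (by rw [abs_of_pos h0]; exact abs_le.2 hξ) hπ')
    rw [truncProj_of_mem hπ hξ, norm_smul, norm_div]
    have h1 := (norm_spectralL_le hξ' h).trans (mul_le_mul_of_nonneg_right hdd (norm_nonneg h))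
    have h2 := (norm_eigvec_le hξ').trans hdd
    have h3 := hκ ξ hξ'
    calc _ ≤ (del ξ₀)⁻¹ * ‖h‖ / κ * (del ξ₀)⁻¹ :=
          mul_le_mul (div_le_div₀ (by positivity) h1 hκ0 h3) h2 (norm_nonneg _) (by positivity)
      _ = _ := by ring
  · rw [truncProj_of_notMem hξ, norm_zero]; positivity

/-- Measurability comes from monotonicity in `|ξ|`. Values beyond `ξ₀` are replaced by `0`, since
`lamStar` is uncontrolled outside `(-√π, √π)`. -/
theorem exists_measurable_del {ξ₀ : ℝ} (hπ : ξ₀ < Real.sqrt Real.pi) :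
    ∃ d : ℝ → ℝ, Measurable d ∧ ∀ ξ, |ξ| ≤ ξ₀ → d ξ = del ξ := by
  classical
  set a : ℝ → ℝ := fun x => if x ≤ ξ₀ then del (max x 0) else 0 with ha
  rcases lt_or_ge ξ₀ 0 with hneg | h0
  · exact ⟨fun _ => 0, measurable_const, fun ξ hξ => absurd (abs_nonneg ξ) (by linarith)⟩
  have hb : ∀ x, x ≤ ξ₀ → |max x 0| < Real.sqrt Real.pi := by
    intro x hx
    rw [abs_of_nonneg (le_max_right _ _)]
    exact (max_le hx h0).trans_lt hπ
  have hanti : Antitone a := by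
    intro x y hxy
    simp only [ha]
    by_cases hy : y ≤ ξ₀
    · rw [if_pos hy, if_pos (hxy.trans hy)]
      refine del_anti ?_ (hb y hy)
      rw [abs_of_nonneg (le_max_right _ _), abs_of_nonneg (le_max_right _ _)]
      exact max_le_max_right 0 hxy
    · rw [if_neg hy]
      split_ifs with hx
      · exact (del_pos (hb x hx)).le
      · exact le_rfl
  refine ⟨fun ξ => a |ξ|, hanti.measurable.comp measurable_norm, fun ξ hξ => ?_⟩
  simp only [ha]
  rw [if_pos hξ, max_eq_left (abs_nonneg ξ)]
  have h1 : |ξ| < Real.sqrt Real.pi := hξ.trans_lt hπ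
  exact le_antisymm (del_anti (abs_abs ξ).ge (by rwa [abs_abs])) (del_anti (abs_abs ξ).le h1)

theorem continuous_resOp_apply {Z : Type*} [TopologicalSpace Z] [FirstCountableTopology Z]
    {x y : Z → ℝ} {h : Z → L2w} {r : ℝ} (hr : 0 < r) (hx : Continuous x) (hy : Continuous y)
    (hyr : ∀ q, r ≤ y q) (hh : Continuous h) : Continuous fun q => resOp (x q) (y q) (h q) := by
  have hre : ∀ q, 0 < ((y q : ℝ) : ℂ).re := fun q => by
    rw [Complex.ofReal_re]; exact hr.trans_le (hyr q)
  refine continuous_mulOp_apply (C := r⁻¹) (fun q v => ?_) (fun v => ?_) hh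
  · rw [invDenom_apply (hre q)]
    refine (norm_inv_denom_le (hre q)).trans (inv_anti₀ hr ?_)
    rw [Complex.ofReal_re]; exact hyr q
  · have : (fun q => invDenom (x q) (y q) v) = fun q => (Complex.I * v * x q + (y q : ℂ))⁻¹ := by
      funext q; rw [invDenom_apply (hre q)]
    rw [this]
    exact Continuous.inv₀ (by fun_prop) fun q => denom_ne_zero (hre q)

theorem aestronglyMeasurable_truncProj {ξ₀ : ℝ} (h0 : 0 < ξ₀) (hπ : ξ₀ < Real.sqrt Real.pi)
    {F : ℝ → L2w} (hF : AEStronglyMeasurable F volume) :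
    AEStronglyMeasurable (fun ξ => truncProj ξ₀ ξ (F ξ)) volume := by
  obtain ⟨d, hdm, hd⟩ := exists_measurable_del hπ
  have hπ' : |ξ₀| < Real.sqrt Real.pi := by rwa [abs_of_pos h0]
  have hδ := del_pos hπ'
  -- Clamping keeps the resolvent parameter away from `0`, making the pieces continuous in `(ξ, d,
  -- h)`; for `|ξ| ≤ ξ₀` the clamp is inactive.
  set m : ℝ → ℝ := fun x => max x (del ξ₀) with hm
  have hmr : ∀ x, del ξ₀ ≤ m x := fun x => le_max_right _ _
  have hmc : Continuous m := by fun_prop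
  have hre : ∀ x, 0 < ((m x : ℝ) : ℂ).re := fun q => by
    rw [Complex.ofReal_re]; exact hδ.trans_le (hmr q)
  have c1 : Continuous fun q : ℝ × ℝ × L2w => momentL (resOp q.1 (m q.2.1) q.2.2) :=
    momentL.continuous.comp (continuous_resOp_apply hδ continuous_fst
      (hmc.comp continuous_snd.fst) (fun q => hmr _) continuous_snd.snd)
  have c2 : Continuous fun q : ℝ × ℝ × L2w => resOp q.1 (m q.2.1) oneL :=
    continuous_resOp_apply hδ continuous_fst (hmc.comp continuous_snd.fst) (fun q => hmr _)
      continuous_const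
  have c3 : Continuous fun q : ℝ × ℝ × L2w => kHat1 q.1 (m q.2.1) := by
    simp only [kHat1_eq _ (hre _)]
    exact momentL.continuous.comp (continuous_resOp_apply hδ continuous_fst
      (hmc.comp continuous_snd.fst) (fun q => hmr _) c2)
  have hq : AEStronglyMeasurable (fun ξ => ((ξ, d ξ, F ξ) : ℝ × ℝ × L2w)) volume :=
    aestronglyMeasurable_id.prodMk (hdm.aestronglyMeasurable.prodMk hF)
  have a1 := (c1.comp_aestronglyMeasurable hq)
  have a2 := (c2.comp_aestronglyMeasurable hq)
  have a3 := (c3.comp_aestronglyMeasurable hq)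
  have a4 := (((a1.aemeasurable.div a3.aemeasurable).aestronglyMeasurable).smul a2).indicator
    (measurableSet_Icc (a := -ξ₀) (b := ξ₀))
  refine a4.congr (Eventually.of_forall fun ξ => ?_)
  by_cases hξ : ξ ∈ Icc (-ξ₀) ξ₀
  · have hle := abs_le.2 hξ
    have e : m (d ξ) = del ξ := by
      rw [hm, hd ξ hle]
      exact max_eq_left (del_anti (by rwa [abs_of_pos h0]) hπ')
    simp only [indicator_of_mem hξ]
    rw [truncProj_of_mem hπ hξ]
    simp [e, spectralL_apply, eigvec]
  · simp only [indicator_of_notMem hξ]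
    rw [truncProj_of_notMem hξ]

/-! ### The solution on `L²(ℝ, L²_w)` -/

theorem aestronglyMeasurable_fiberSol (t : ℝ) (f₀ : L2L2w) :
    AEStronglyMeasurable (fun ξ => fiberSol ξ t (f₀ ξ)) volume := by
  have hc : Continuous fun q : ℝ × L2w => fiberSol q.1 t q.2 :=
    continuous_fiberSol continuous_fst continuous_const continuous_snd
  have hm : AEStronglyMeasurable (fun ξ : ℝ => (ξ, f₀ ξ)) volume :=
    aestronglyMeasurable_id.prodMk (Lp.aestronglyMeasurable f₀)
  have := hc.comp_aestronglyMeasurable hm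
  exact this

theorem memLp_fiberSol (t : ℝ) (f₀ : L2L2w) :
    MemLp (fun ξ => fiberSol ξ (max t 0) (f₀ ξ)) 2 volume := by
  obtain ⟨C, -, hC⟩ := exists_norm_fiberSol_le (max t 0)
  exact (Lp.memLp f₀).of_le_mul (c := C) (aestronglyMeasurable_fiberSol _ f₀)
    (Eventually.of_forall fun ξ => hC ξ _ (le_max_right _ _) le_rfl _)

/-- The solution with initial value `f₀` at time `max t 0`. -/
def globalSol (f₀ : L2L2w) (t : ℝ) : L2L2w := (memLp_fiberSol t f₀).toLp _

theorem coeFn_globalSol (f₀ : L2L2w) {t : ℝ} (ht : 0 ≤ t) :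
    globalSol f₀ t =ᵐ[volume] fun ξ => fiberSol ξ t (f₀ ξ) := by
  have := (memLp_fiberSol t f₀).coeFn_toLp
  simp only [max_eq_left ht] at this ⊢
  rw [globalSol]
  simpa only [max_eq_left ht] using this

theorem continuous_globalSol (f₀ : L2L2w) : Continuous (globalSol f₀) := by
  rw [continuous_iff_continuousAt]
  intro t
  obtain ⟨C, -, hC⟩ := exists_norm_fiberSol_le (max t 0 + 1)
  have hev : ∀ᶠ s in 𝓝 t, max s 0 < max t 0 + 1 :=
    (show Continuous fun s : ℝ => max s 0 by fun_prop).continuousAt.eventually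
      (gt_mem_nhds (lt_add_one (max t 0)))
  refine tendsto_toLp_of_dominated (G := fun s ξ => fiberSol ξ (max s 0) (f₀ ξ))
    (fun s => memLp_fiberSol s f₀) (memLp_fiberSol t f₀) ((Lp.memLp f₀).norm.const_mul C)
    ?_ (Eventually.of_forall fun ξ => hC ξ _ (le_max_right _ _) (by linarith) _)
    (Eventually.of_forall fun ξ => ?_)
  · filter_upwards [hev] with s hs
    exact Eventually.of_forall fun ξ => hC ξ _ (le_max_right _ _) hs.le _
  · exact ((continuous_fiberSol_time ξ (f₀ ξ)).comp
      (show Continuous fun s : ℝ => max s 0 by fun_prop)).tendsto t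

theorem isSolution_globalSol (f₀ : L2L2w) : IsSolution f₀ (globalSol f₀) where
  continuousOn := (continuous_globalSol f₀).continuousOn
  initial := by
    refine Lp.ext ?_
    filter_upwards [coeFn_globalSol f₀ le_rfl] with ξ hξ
    rw [hξ, fiberSol_zero]
  equation t ht := by
    have hG : AEStronglyMeasurable (Function.uncurry fun s ξ => fiberSol ξ s (f₀ ξ))
        ((volume.restrict (Ioc 0 t)).prod volume) := by
      have hc : Continuous fun q : ℝ × ℝ × L2w => fiberSol q.2.1 q.1 q.2.2 :=
        continuous_fiberSol continuous_snd.fst continuous_fst continuous_snd.snd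
      have hm : AEStronglyMeasurable (fun p : ℝ × ℝ => (p.1, p.2, f₀ p.2))
          ((volume.restrict (Ioc 0 t)).prod volume) :=
        aestronglyMeasurable_id.fst.prodMk
          (aestronglyMeasurable_id.snd.prodMk (Lp.aestronglyMeasurable f₀).comp_snd)
      have := hc.comp_aestronglyMeasurable hm
      exact this
    have h := intervalIntegral_Lp_ae_eq ht (continuous_globalSol f₀).continuousOn hG
      fun s hs => coeFn_globalSol f₀ hs.1
    filter_upwards [h, Lp.coeFn_sub (globalSol f₀ t) f₀, coeFn_globalSol f₀ ht] with ξ h1 h2 h3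
    rw [h1, h2, Pi.sub_apply, h3]
    exact isL_xi_fiberSol ht (f₀ ξ)

theorem IsSolution.eqOn {f₀ : L2L2w} {f f' : ℝ → L2L2w} (hf : IsSolution f₀ f)
    (hf' : IsSolution f₀ f') : EqOn f f' (Ici 0) := by
  intro t ht
  have hi : ∀ {g : ℝ → L2L2w}, IsSolution f₀ g → ∀ s, 0 ≤ s →
      IntervalIntegrable g volume 0 s := fun hg s hs =>
    (hg.continuousOn.mono (by rw [uIcc_of_le hs]; exact Icc_subset_Ici_self)).intervalIntegrable
  refine sub_eq_zero.1 (eq_zero_of_dissipative (f := fun s => f s - f' s)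
    (hf.continuousOn.sub hf'.continuousOn) (fun s hs => ?_) t ht)
  rw [intervalIntegral.integral_sub (hi hf s hs) (hi hf' s hs)]
  have := (hf.equation s hs).sub (hf'.equation s hs)
  rw [sub_sub_sub_cancel_right] at this
  exact re_inner_le_zero_of_isL this

theorem IsSolution.ae_eq {f₀ : L2L2w} {f : ℝ → L2L2w} (hf : IsSolution f₀ f) {t : ℝ}
    (ht : 0 ≤ t) : f t =ᵐ[volume] fun ξ => fiberSol ξ t (f₀ ξ) := by
  rw [hf.eqOn (isSolution_globalSol f₀) (mem_Ici.2 ht)]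
  exact coeFn_globalSol f₀ ht

/-- Being a solution depends on the values at nonnegative times only. -/
theorem IsSolution.congr {f₀ : L2L2w} {f f' : ℝ → L2L2w} (hf : IsSolution f₀ f)
    (h : EqOn f' f (Ici 0)) : IsSolution f₀ f' where
  continuousOn := hf.continuousOn.congr h
  initial := (h self_mem_Ici).trans hf.initial
  equation t ht := by
    have e : ∫ s in (0 : ℝ)..t, f' s = ∫ s in (0 : ℝ)..t, f s :=
      intervalIntegral.integral_congr fun s hs => by
        rw [uIcc_of_le ht] at hs
        exact h (mem_Ici.2 hs.1)
    rw [e, h (mem_Ici.2 ht)]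
    exact hf.equation t ht

/-! ### The truncation -/

section Truncation

variable {ξ₀ : ℝ} {f₀ : L2L2w} {f g : ℝ → L2L2w}

theorem exists_isTruncation (h0 : 0 < ξ₀) (hπ : ξ₀ < Real.sqrt Real.pi) (f : ℝ → L2L2w) :
    ∃ g : ℝ → L2L2w, IsTruncation ξ₀ f g := by
  obtain ⟨C, -, hC⟩ := exists_norm_truncProj_le h0 hπ
  have hm : ∀ t, MemLp (fun ξ => truncProj ξ₀ ξ (f t ξ)) 2 volume := fun t =>
    (Lp.memLp (f t)).of_le_mul (c := C)
      (aestronglyMeasurable_truncProj h0 hπ (Lp.aestronglyMeasurable (f t)))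
      (Eventually.of_forall fun ξ => hC ξ _)
  exact ⟨fun t => (hm t).toLp _, fun t _ => (hm t).coeFn_toLp⟩

theorem IsTruncation.initial_ae_eq (hf : IsSolution f₀ f) (hg : IsTruncation ξ₀ f g) :
    g 0 =ᵐ[volume] fun ξ => truncProj ξ₀ ξ (f₀ ξ) := by
  have := hg 0 le_rfl
  rwa [hf.initial] at this

theorem IsTruncation.ae_eq (hπ : ξ₀ < Real.sqrt Real.pi) (hf : IsSolution f₀ f)
    (hg : IsTruncation ξ₀ f g) {t : ℝ} (ht : 0 ≤ t) :
    g t =ᵐ[volume] fun ξ => fiberSol ξ t (g 0 ξ) := by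
  filter_upwards [hg t ht, hg.initial_ae_eq hf, hf.ae_eq ht] with ξ h1 h2 h3
  rw [h1, h2, h3, fiberSol_truncProj hπ _ ht]

theorem IsTruncation.isSolution (hπ : ξ₀ < Real.sqrt Real.pi) (hf : IsSolution f₀ f)
    (hg : IsTruncation ξ₀ f g) : IsSolution (g 0) g :=
  (isSolution_globalSol (g 0)).congr fun _ ht =>
    Lp.ext ((hg.ae_eq hπ hf ht).trans (coeFn_globalSol (g 0) ht).symm)

theorem moment_smul_eigvec {ξ : ℝ} (hξ : |ξ| < Real.sqrt Real.pi) (c : ℂ) :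
    moment (c • eigvec ξ) = c := by
  rw [← momentL_apply, map_smul, momentL_eigvec hξ, smul_eq_mul, mul_one]

theorem coeFn_eigvec {ξ : ℝ} (hξ : |ξ| < Real.sqrt Real.pi) :
    eigvec ξ =ᵐ[velMeasure] fun v => (Complex.I * v * ξ + 1 + lamStar ξ)⁻¹ := by
  filter_upwards [coeFn_resOp (ξ := ξ) (del_re_pos hξ) oneL, coeFn_oneL] with v h1 h2
  rw [eigvec, h1, h2, mul_one, add_assoc, one_add_lamStar]

theorem IsTruncation.isGrosslyDetermined (hπ : ξ₀ < Real.sqrt Real.pi) (hf : IsSolution f₀ f)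
    (hg : IsTruncation ξ₀ f g) : IsGrosslyDetermined ξ₀ g where
  solution := hg.isSolution hπ hf
  moment_evolution t ht := by
    filter_upwards [hg.ae_eq hπ hf ht, hg.initial_ae_eq hf] with ξ h1 h2 hξ
    have hξ' := abs_lt_of_mem hπ hξ
    rw [h1, h2, truncProj_of_mem hπ hξ, fiberSol_smul_eigvec hξ' _ ht, smul_smul,
      moment_smul_eigvec hξ', moment_smul_eigvec hξ']
  recovery t ht := by
    filter_upwards [hg t ht] with ξ h1 hξ
    have hξ' := abs_lt_of_mem hπ hξ
    rw [h1, truncProj_of_mem hπ hξ, moment_smul_eigvec hξ']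
    filter_upwards [Lp.coeFn_smul (spectralL ξ (f t ξ) / kHat1 ξ (del ξ)) (eigvec ξ),
      coeFn_eigvec hξ'] with v h2 h3
    rw [h2, Pi.smul_apply, h3, smul_eq_mul]
  vanishing t ht := by
    filter_upwards [hg t ht] with ξ h1 hξ
    rw [h1, truncProj_of_notMem hξ]

end Truncation

/-! ### The Fourier transform -/

/-- The factor `√(2π)` cancels the Jacobian of the dilation. -/
theorem norm_toLp_dilate (h : L2L2w) : ‖((memLp_dilate h).toLp _ : L2L2w)‖ = ‖h‖ := by
  have h2 : (0 : ℝ) < 2 * Real.pi := by positivity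
  have e1 : eLpNorm (fun η : ℝ => h (2 * Real.pi * η)) 2 volume
      = ENNReal.ofReal |(2 * Real.pi)⁻¹| ^ (1 / (2 : ENNReal)).toReal * eLpNorm h 2 volume := by
    have hae : AEStronglyMeasurable (h : ℝ → L2w)
        (Measure.map (fun η : ℝ => 2 * Real.pi * η) volume) := by
      rw [Real.map_volume_mul_left h2.ne']
      exact (Lp.aestronglyMeasurable h).smul_measure _
    have := eLpNorm_map_measure (p := 2) hae (by fun_prop)
    rw [Real.map_volume_mul_left h2.ne', eLpNorm_smul_measure_of_ne_zero
      (by simp [Real.pi_ne_zero])] at this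
    exact this.symm
  have e2 := eLpNorm_const_smul ((Real.sqrt (2 * Real.pi) : ℝ) : ℂ)
    (fun η : ℝ => h (2 * Real.pi * η)) 2 volume
  rw [Lp.norm_toLp, Lp.norm_def]
  change (eLpNorm (((Real.sqrt (2 * Real.pi) : ℝ) : ℂ) • fun η : ℝ => h (2 * Real.pi * η))
    2 volume).toReal = _
  rw [e2, e1, ENNReal.toReal_mul, ENNReal.toReal_mul, ← ENNReal.toReal_rpow,
    ENNReal.toReal_ofReal (abs_nonneg _), toReal_enorm, Complex.norm_real, ← mul_assoc]
  have e3 : ‖Real.sqrt (2 * Real.pi)‖ * |(2 * Real.pi)⁻¹| ^ (1 / (2 : ENNReal)).toReal = 1 := by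
    rw [abs_of_pos (inv_pos.2 h2), Real.norm_of_nonneg (Real.sqrt_nonneg _)]
    have : (1 / (2 : ENNReal)).toReal = 1 / 2 := by simp
    rw [this, ← Real.sqrt_eq_rpow, Real.sqrt_inv]
    exact mul_inv_cancel₀ (Real.sqrt_pos.2 h2).ne'
  rw [e3, one_mul]

theorem norm_invFourier (h : L2L2w) : ‖invFourier h‖ = ‖h‖ :=
  ((Lp.fourierTransformₗᵢ ℝ L2w).symm.norm_map _).trans (norm_toLp_dilate h)

theorem invFourier_sub (a b : L2L2w) : invFourier a - invFourier b = invFourier (a - b) := by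
  have e : ((memLp_dilate (a - b)).toLp _ : L2L2w)
      = (memLp_dilate a).toLp _ - (memLp_dilate b).toLp _ := by
    rw [← MemLp.toLp_sub, MemLp.toLp_eq_toLp_iff]
    have hq : Measure.QuasiMeasurePreserving (fun η : ℝ => 2 * Real.pi * η) volume volume := by
      refine ⟨by fun_prop, ?_⟩
      rw [Real.map_volume_mul_left (by positivity)]
      exact Measure.smul_absolutelyContinuous
    filter_upwards [hq.ae (Lp.coeFn_sub a b)] with η hη
    rw [hη, Pi.sub_apply, smul_sub, Pi.sub_apply]
  rw [invFourier, invFourier, invFourier, e]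
  exact ((Lp.fourierTransformₗᵢ ℝ L2w).symm.map_sub _ _).symm

theorem norm_invFourier_sub (a b : L2L2w) : ‖invFourier a - invFourier b‖ = ‖a - b‖ := by
  rw [invFourier_sub, norm_invFourier]

/-! ### Decay of the remainder -/

/-- At almost every frequency `f - g` is the flow of `f₀ - g(0)`, which the spectral functional
annihilates for `|ξ| ≤ ξ₀`; the fiber estimate then integrates. -/
theorem exists_norm_sub_truncation_le {ε : ℝ} (hε : 0 < ε) : ∃ C : ℝ, 0 < C ∧
    ∀ ξ₀ : ℝ, 0 < ξ₀ → ξ₀ < Real.sqrt Real.pi → ∀ (f₀ : L2L2w) (f g : ℝ → L2L2w),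
      IsSolution f₀ f → IsTruncation ξ₀ f g → ∀ t : ℝ, 0 ≤ t →
        ‖f t - g t‖ ≤ C * Real.exp ((lamStar ξ₀ + ε) * t) * ‖f₀ - g 0‖ := by
  obtain ⟨C, hC0, hC⟩ := exists_remainder_decay hε
  refine ⟨C, hC0, fun ξ₀ h0 hπ f₀ f g hf hg t ht => Lp.norm_le_mul_norm_of_ae_le_mul ?_⟩
  filter_upwards [hf.ae_eq ht, hg.ae_eq hπ hf ht, hg.initial_ae_eq hf,
    Lp.coeFn_sub (f t) (g t), Lp.coeFn_sub f₀ (g 0)] with ξ h1 h2 h3 h4 h5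
  rw [h4, h5, Pi.sub_apply, Pi.sub_apply, h1, h2, ← fiberSol_sub]
  refine hC ξ₀ h0 hπ ξ _ (fun hξ => ?_) t ht
  rw [h3]
  exact spectralL_sub_truncProj hπ (abs_le.1 hξ) _

theorem exists_norm_initial_sub_le {ξ₀ : ℝ} (h0 : 0 < ξ₀) (hπ : ξ₀ < Real.sqrt Real.pi) :
    ∃ K : ℝ, 0 < K ∧ ∀ (f₀ : L2L2w) (f g : ℝ → L2L2w), IsSolution f₀ f → IsTruncation ξ₀ f g →
      ‖f₀ - g 0‖ ≤ K * ‖f₀‖ := by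
  obtain ⟨K, hK0, hK⟩ := exists_norm_truncProj_le h0 hπ
  refine ⟨1 + K, by positivity, fun f₀ f g hf hg => ?_⟩
  have h1 : ‖g 0‖ ≤ K * ‖f₀‖ := by
    refine Lp.norm_le_mul_norm_of_ae_le_mul ?_
    filter_upwards [hg.initial_ae_eq hf] with ξ hξ
    rw [hξ]
    exact hK ξ _
  linarith [norm_sub_le f₀ (g 0)]

theorem tendsto_norm_sub_truncation {ξ₀ : ℝ} (h0 : 0 < ξ₀) (hπ : ξ₀ < Real.sqrt Real.pi)
    {f₀ : L2L2w} {f g : ℝ → L2L2w} (hf : IsSolution f₀ f) (hg : IsTruncation ξ₀ f g) :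
    Tendsto (fun t => ‖f t - g t‖) atTop (𝓝 0) := by
  have hneg := lamStar_neg h0.ne' (by rwa [abs_of_pos h0])
  -- This `ε` leaves the negative exponent `λ*(ξ₀)/2`.
  obtain ⟨C, -, hC⟩ := exists_norm_sub_truncation_le (ε := -lamStar ξ₀ / 2) (by linarith)
  have h1 : Tendsto (fun t => (lamStar ξ₀ + -lamStar ξ₀ / 2) * t) atTop atBot :=
    tendsto_id.const_mul_atTop_of_neg (by linarith)
  have h2 : Tendsto (fun t => C * Real.exp ((lamStar ξ₀ + -lamStar ξ₀ / 2) * t) * ‖f₀ - g 0‖)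
      atTop (𝓝 0) := by
    simpa using ((Real.tendsto_exp_atBot.comp h1).const_mul C).mul_const ‖f₀ - g 0‖
  refine squeeze_zero' (Eventually.of_forall fun _ => norm_nonneg _) ?_ h2
  filter_upwards [eventually_ge_atTop 0] with t ht
  exact hC ξ₀ h0 hπ f₀ f g hf hg t ht

end

end BGK

/-! ### Assembly of the theorem -/

theorem theorem9p4 :
    -- well-posedness of the Cauchy problem in `L²(ℝ, L²_w)`
    (∀ f₀ : BGK.L2L2w, (∃ f : ℝ → BGK.L2L2w, BGK.IsSolution f₀ f) ∧
      ∀ f f' : ℝ → BGK.L2L2w, BGK.IsSolution f₀ f → BGK.IsSolution f₀ f' →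
        Set.EqOn f f' (Set.Ici 0)) ∧
    -- `P_{ξ₀} f` is a well-defined curve in `L²(ℝ, L²_w)`, and a grossly determined solution
    (∀ ξ₀ : ℝ, 0 < ξ₀ → ξ₀ < Real.sqrt Real.pi →
      ∀ (f₀ : BGK.L2L2w) (f : ℝ → BGK.L2L2w), BGK.IsSolution f₀ f →
        (∃ g : ℝ → BGK.L2L2w, BGK.IsTruncation ξ₀ f g) ∧
        ∀ g : ℝ → BGK.L2L2w, BGK.IsTruncation ξ₀ f g →
          BGK.IsGrosslyDetermined ξ₀ g ∧
          Filter.Tendsto (fun t => ‖BGK.invFourier (f t) - BGK.invFourier (g t)‖)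
            Filter.atTop (nhds 0)) ∧
    -- the exponential rate
    (∀ ε : ℝ, 0 < ε → ∃ C : ℝ, 0 < C ∧
      ∀ ξ₀ : ℝ, 0 < ξ₀ → ξ₀ < Real.sqrt Real.pi → ∃ C₂ : ℝ, 0 < C₂ ∧
        ∀ (f₀ : BGK.L2L2w) (f g : ℝ → BGK.L2L2w),
          BGK.IsSolution f₀ f → BGK.IsTruncation ξ₀ f g → ∀ t : ℝ, 0 ≤ t →
            ‖BGK.invFourier (f t) - BGK.invFourier (g t)‖ ≤
              C * Real.exp ((BGK.lamStar ξ₀ + ε) * t) *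
                ‖BGK.invFourier f₀ - BGK.invFourier (g 0)‖ ∧
            C * Real.exp ((BGK.lamStar ξ₀ + ε) * t) *
                ‖BGK.invFourier f₀ - BGK.invFourier (g 0)‖ ≤
              C₂ * Real.exp ((BGK.lamStar ξ₀ + ε) * t) * ‖BGK.invFourier f₀‖) := by
  refine ⟨fun f₀ => ⟨⟨_, BGK.isSolution_globalSol f₀⟩, fun f f' hf hf' => hf.eqOn hf'⟩,
    fun ξ₀ h0 hπ f₀ f hf => ⟨BGK.exists_isTruncation h0 hπ f, fun g hg =>
      ⟨hg.isGrosslyDetermined hπ hf, ?_⟩⟩, fun ε hε => ?_⟩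
  · simp only [BGK.norm_invFourier_sub]
    exact BGK.tendsto_norm_sub_truncation h0 hπ hf hg
  · obtain ⟨C, hC0, hC⟩ := BGK.exists_norm_sub_truncation_le hε
    refine ⟨C, hC0, fun ξ₀ h0 hπ => ?_⟩
    obtain ⟨K, hK0, hK⟩ := BGK.exists_norm_initial_sub_le h0 hπ
    refine ⟨C * K, mul_pos hC0 hK0, fun f₀ f g hf hg t ht => ?_⟩
    rw [BGK.norm_invFourier_sub, BGK.norm_invFourier_sub, BGK.norm_invFourier]
    refine ⟨hC ξ₀ h0 hπ f₀ f g hf hg t ht, ?_⟩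
    refine (mul_le_mul_of_nonneg_left (hK f₀ f g hf hg) (by positivity)).trans_eq ?_
    ring
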